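/- Let $n\ge 1$ and let $M=\{tp:\ t\ge 0,\ p\in\mathcal D\}\subseteq\mathbb R^{n+1}$ be a smooth solid cone, where $\mathcal D\subseteq\mathbb S^n$ is a smooth region (a connected open set of the sphere together with its $C^\infty$ boundary). Put $M^*=M\setminus\{0\}$. Let $k\in\mathbb R$ with $k\ne-(n+1)$ and $k\ne-n$, and let $f=e^\psi$ be a homogeneous density of degree $k$ on $M$, i.e. a positive $C^\infty$ function on $M^*$ with $f(tp)=t^kf(p)$ for all $t>0$, $p\in M^*$. Let $\Sigma$ be a nonempty smooth compact orientable hypersurface, possibly with boundary, immersed in $M^*$ with $\partial\Sigma\subset\partial M$, let $N$ be a smooth unit normal along $\Sigma$, and let $X(p)=p$ be the position vector field. For an immersed compact hypersurface with a chosen unit normal $N$ put $$A_f(\Sigma)=\int_\Sigma f\,da,\qquad V_f(\Sigma)=\frac{-1}{n+k+1}\int_\Sigma\langle X,N\rangle f\,da,\qquad H_f=-\operatorname{div}_\Sigma N-\langle\nabla\psi,N\rangle .$$ A variation of $\Sigma$ is a smooth family of immersions $\phi_t:\Sigma\to M$, $|t|<\varepsilon$, with $\phi_0$ the given immersion and $\phi_t(\partial\Sigma)\subset\partial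 M$; its volumes are computed with the unit normals $N_t$ depending continuously on $t$ with $N_0=N$. Assume that $\Sigma$ is $f$-stationary: $\frac{d}{dt}\big|_{t=0}A_f(\phi_t(\Sigma))=0$ for every variation with $V_f(\phi_t(\Sigma))=V_f(\Sigma)$ for all $t$. Then $f$ extends to a positive $C^\infty$ function, still homogeneous of degree $k$, on some open set $U\supseteq M^*$ invariant under dilations. For every such $U$ and extension (again denoted $f$, and used to define $V_f$ for hypersurfaces in $U$) the following holds. Let $\varphi_t(p)=p+t(n+k)N(p)$, $p\in\Sigma$. There are $\varepsilon>0$ and a $C^\infty$ function $s:(-\varepsilon,\varepsilon)\to(0,\infty)$ with $s(0)=1$ such that, for every $|t|<\varepsilon$, $\varphi_t$ is an immersion of $\Sigma$ into $U$ with unit normal $N$, and $s(t)$ is the unique positive number with $$V_f\big(s(t)\,\varphi_t(\Sigma)\big)=V_f(\Sigma).$$ Moreover, the normal component of the velocity vector at $t=0$ of the family $\phi_t(p)=s(t)\,\varphi_t(p)$ is $$\Big\langle\frac{d}{dt}\Big|_{t=0}\phi_t,\,N\Big\rangle=n+k+H_f\,\langle X,N\rangle\qquad\text{on }\Sigma .$$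 -/

import Mathlib

open Set MeasureTheory
open scoped Manifold ContDiff Topology

noncomputable section

namespace ConeHypersurface

/-- The Euclidean space `ℝⁿ⁺¹`. -/
abbrev E (n : ℕ) : Type := EuclideanSpace ℝ (Fin (n + 1))

/-! ### Solid cones and homogeneous densities -/

section Cone

variable {n : ℕ}

/-- The interior of `D` relative to the unit sphere. -/
def relInterior (D : Set (E n)) : Set (E n) :=
  {p | p ∈ Metric.sphere (0 : E n) 1 ∧ D ∈ 𝓝[Metric.sphere (0 : E n) 1] p}

/-- `D` is a smooth region of the unit sphere: a closed subset of the sphere, with connected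
(nonempty) relative interior, which near each of its other points `p` is the sublevel set
`{g ≤ 0}` of a `C^∞` function `g` whose derivative does not vanish on the tangent space
`p^⊥` of the sphere at `p`. -/
structure IsSmoothRegion (D : Set (E n)) : Prop where
  subset_sphere : D ⊆ Metric.sphere (0 : E n) 1
  isClosed : IsClosed D
  isConnected : IsConnected (relInterior D)
  smooth_boundary : ∀ p ∈ D, p ∉ relInterior D →
    ∃ (W : Set (E n)) (g : E n → ℝ), IsOpen W ∧ p ∈ W ∧ ContDiffOn ℝ ∞ g W ∧ g p = 0 ∧
      (∃ v : E n, inner ℝ p v = 0 ∧ fderiv ℝ g p v ≠ 0) ∧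
      ∀ q ∈ W ∩ Metric.sphere (0 : E n) 1, q ∈ D ↔ g q ≤ 0

/-- The cone `{t p ; t ≥ 0, p ∈ D}`. -/
def coneOver (D : Set (E n)) : Set (E n) :=
  {x | ∃ t : ℝ, 0 ≤ t ∧ ∃ p ∈ D, x = t • p}

/-- Smooth solid cones in `ℝⁿ⁺¹`. -/
def IsSolidCone (M : Set (E n)) : Prop :=
  ∃ D : Set (E n), IsSmoothRegion D ∧ M = coneOver D

/-- `f` is a smooth homogeneous density of degree `k` on the solid cone `M`: a positive function
on `M^* = M \ {0}` which is `C^∞` there (it is the restriction of a `C^∞` function defined on an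
open set containing `M^*`) and satisfies `f (t p) = t ^ k f p` for `t > 0`. -/
structure IsHomogeneousDensity (M : Set (E n)) (k : ℝ) (f : E n → ℝ) : Prop where
  smooth : ∃ (W : Set (E n)) (g : E n → ℝ), IsOpen W ∧ M \ {0} ⊆ W ∧ ContDiffOn ℝ ∞ g W ∧
    EqOn f g (M \ {0})
  pos : ∀ p ∈ M \ {0}, 0 < f p
  homogeneous : ∀ p ∈ M \ {0}, ∀ t : ℝ, 0 < t → f (t • p) = t ^ k * f p

/-- `F` extends the density `f` of `M^*` to a positive `C^∞` function, still homogeneous of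
degree `k`, on an open set `U ⊇ M^*` invariant under dilations. -/
structure IsHomogeneousExtension (M : Set (E n)) (k : ℝ) (f : E n → ℝ)
    (U : Set (E n)) (F : E n → ℝ) : Prop where
  isOpen : IsOpen U
  subset : M \ {0} ⊆ U
  dilation : ∀ p ∈ U, ∀ t : ℝ, 0 < t → t • p ∈ U
  eqOn : EqOn F f (M \ {0})
  smooth : ContDiffOn ℝ ∞ F U
  pos : ∀ p ∈ U, 0 < F p
  homogeneous : ∀ p ∈ U, ∀ t : ℝ, 0 < t → F (t • p) = t ^ k * F p

end Cone

/-! ### Immersed hypersurfaces, weighted area and oriented weighted volume -/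

section Hypersurface

variable {n : ℕ} [NeZero n] {S : Type*} [TopologicalSpace S]
  [ChartedSpace (EuclideanHalfSpace n) S]

/-- The differential at `p` of a map from an `n`-manifold with boundary to `ℝⁿ⁺¹`. -/
def diff (φ : S → E n) (p : S) : EuclideanSpace ℝ (Fin n) →L[ℝ] E n :=
  mfderiv (𝓡∂ n) 𝓘(ℝ, E n) φ p

/-- `φ` is a `C^∞` immersion. -/
structure IsSmoothImmersion (φ : S → E n) : Prop where
  smooth : ContMDiff (𝓡∂ n) 𝓘(ℝ, E n) ∞ φ
  injective_diff : ∀ p, Function.Injective (diff φ p)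

/-- `ν p` is a unit vector normal to the immersed hypersurface `φ`, for every `p`. -/
def IsUnitNormal (φ ν : S → E n) : Prop :=
  ∀ p, ‖ν p‖ = 1 ∧ ∀ v, inner ℝ (ν p) (diff φ p v) = 0

/-- The Riemannian area density `√det(⟪∂ᵢφ, ∂ⱼφ⟫)` of `φ` in the chart at `x`, at the point of
coordinates `y`. -/
def areaDensity (φ : S → E n) (x : S) (y : EuclideanSpace ℝ (Fin n)) : ℝ :=
  Real.sqrt (Matrix.gram ℝ (fun i : Fin n =>
    fderivWithin ℝ (φ ∘ (extChartAt (𝓡∂ n) x).symm) (range (𝓡∂ n)) y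
      (EuclideanSpace.single i 1))).det

/-- A smooth partition of unity subordinate to the chart domains. -/
def chartPartition (S : Type*) [TopologicalSpace S] [ChartedSpace (EuclideanHalfSpace n) S]
    [IsManifold (𝓡∂ n) ∞ S] [T2Space S] [CompactSpace S] :
    SmoothPartitionOfUnity S (𝓡∂ n) S univ :=
  (SmoothPartitionOfUnity.exists_isSubordinate_chartAt_source (𝓡∂ n) S).choose

/-- The integral `∫_S h da` with respect to the Riemannian area element induced by the
immersion `φ`, computed in charts by means of a partition of unity (as `S` is compact, only
finitely many terms are nonzero). -/
def areaIntegral [IsManifold (𝓡∂ n) ∞ S] [T2Space S] [CompactSpace S]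
    (φ : S → E n) (h : S → ℝ) : ℝ :=
  ∑ᶠ x : S, ∫ y in (extChartAt (𝓡∂ n) x).target,
    chartPartition (n := n) S x ((extChartAt (𝓡∂ n) x).symm y) *
      h ((extChartAt (𝓡∂ n) x).symm y) * areaDensity φ x y

/-- The weighted area `A_f = ∫ f da`. -/
def weightedArea [IsManifold (𝓡∂ n) ∞ S] [T2Space S] [CompactSpace S]
    (f : E n → ℝ) (φ : S → E n) : ℝ :=
  areaIntegral φ (fun p => f (φ p))

/-- The oriented weighted volume `V_f = -1/(n+k+1) ∫ ⟨X,ν⟩ f da`, with `X` the position vector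
field and `ν` the chosen unit normal. -/
def weightedVolume [IsManifold (𝓡∂ n) ∞ S] [T2Space S] [CompactSpace S]
    (k : ℝ) (f : E n → ℝ) (φ ν : S → E n) : ℝ :=
  -1 / (n + k + 1) * areaIntegral φ (fun p => inner ℝ (φ p) (ν p) * f (φ p))

/-- The divergence relative to the hypersurface `φ` of the vector field `Y` along it:
`∑ᵢⱼ gⁱʲ ⟨D_{eᵢ} Y, dφ(eⱼ)⟩` where `g` is the induced metric (this is `∑ᵢ ⟨D_{eᵢ} Y, eᵢ⟩` for an
orthonormal basis of the tangent space). -/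
def surfaceDiv (φ Y : S → E n) (p : S) : ℝ :=
  ∑ i : Fin n, ∑ j : Fin n,
    (Matrix.gram ℝ (fun l : Fin n => diff φ p (EuclideanSpace.single l 1)))⁻¹ i j *
      inner ℝ (diff Y p (EuclideanSpace.single i 1)) (diff φ p (EuclideanSpace.single j 1))

/-- The `f`-mean curvature `H_f = -div_{Σ,f} N = -(div_Σ N + ⟨∇ψ,N⟩)`, `ψ = log f`. The derivative
of `ψ` is taken within `M`, as `f` is only given there. -/
def meanCurvature (M : Set (E n)) (f : E n → ℝ) (φ N : S → E n) (p : S) : ℝ :=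
  -(surfaceDiv φ N p + fderivWithin ℝ (fun x => Real.log (f x)) M (φ p) (N p))

/-- `ι : S → ℝⁿ⁺¹` is a smooth hypersurface immersed in `M^*` with `∂S` mapped into `∂M`, and
`N` is a smooth unit normal along it. -/
structure IsHypersurface (M : Set (E n)) (ι N : S → E n) : Prop where
  immersion : IsSmoothImmersion ι
  mapsTo : ∀ p, ι p ∈ M \ {0}
  boundary : ∀ p ∈ (𝓡∂ n).boundary S, ι p ∈ frontier M
  smooth_normal : ContMDiff (𝓡∂ n) 𝓘(ℝ, E n) ∞ N
  unit_normal : IsUnitNormal ι N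

/-- `φ t`, `|t| < ε`, is a variation of the hypersurface `(ι, N)`: a smooth family of immersions
into `M` with `φ 0 = ι` and with `∂S` mapped into `∂M`; `ν t` is the unit normal of `φ t`,
continuous in all variables, with `ν 0 = N`. -/
structure IsVariation (M : Set (E n)) (ι N : S → E n) (ε : ℝ) (φ ν : ℝ → S → E n) : Prop where
  eps_pos : 0 < ε
  smooth : ContMDiffOn (𝓘(ℝ, ℝ).prod (𝓡∂ n)) 𝓘(ℝ, E n) ∞ (fun q : ℝ × S => φ q.1 q.2)
    (Ioo (-ε) ε ×ˢ univ)
  immersion : ∀ t ∈ Ioo (-ε) ε, IsSmoothImmersion (φ t)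
  mapsTo : ∀ t ∈ Ioo (-ε) ε, ∀ p, φ t p ∈ M
  boundary : ∀ t ∈ Ioo (-ε) ε, ∀ p ∈ (𝓡∂ n).boundary S, φ t p ∈ frontier M
  continuous_normal : ContinuousOn (fun q : ℝ × S => ν q.1 q.2) (Ioo (-ε) ε ×ˢ univ)
  unit_normal : ∀ t ∈ Ioo (-ε) ε, IsUnitNormal (φ t) (ν t)
  map_zero : φ 0 = ι
  normal_zero : ν 0 = N

/-- The hypersurface is `f`-stationary: `A_f'(0) = 0` for every volume-preserving variation. -/
def IsStationary [IsManifold (𝓡∂ n) ∞ S] [T2Space S] [CompactSpace S]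
    (M : Set (E n)) (k : ℝ) (f : E n → ℝ) (ι N : S → E n) : Prop :=
  ∀ (ε : ℝ) (φ ν : ℝ → S → E n), IsVariation M ι N ε φ ν →
    (∀ t ∈ Ioo (-ε) ε, weightedVolume k f (φ t) (ν t) = weightedVolume k f ι N) →
    HasDerivAt (fun t => weightedArea f (φ t)) 0 0

end Hypersurface

/-- The map `p ↦ p + t c N(p)` along the hypersurface. -/
def parallelMap {n : ℕ} {S : Type*} (c : ℝ) (ι N : S → E n) (t : ℝ) (p : S) : E n :=
  ι p + (t * c) • N p

end ConeHypersurface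

end

open ConeHypersurface

/-! Write X for the position field, q = n+k+1, A for the weighted area of Σ, V₀ for its weighted
volume and I = ∫⟨X,N⟩f, so that q V₀ = -I.

Stationarity is tested only on radial variations p ↦ (1+t h(p))^(1/q) p. Dilations preserve the cone
and its frontier, so these are admissible for every smooth h, up to the boundary of Σ
(`isVariation_radialMap`). With this exponent the volume is exactly affine in t, with slope
proportional to ∫ h⟨X,N⟩f (`weightedVolume_radialMap`). Hence a function h with ∫ h⟨X,N⟩f = 0 gives
a variation of constant volume without any correction, and the first variation of area reads
∫((n+k)h + ⟨∇h,X⟩)f = 0 (`IsStationary.areaIntegral_eq_zero`).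

If I were 0, the choice h = 1 would force (n+k)A = 0; so I ≠ 0. Subtracting constants from test
functions then yields a weak equation for all g, with multiplier H = -(n+k)A/I
(`IsStationary.weak_equation`). The divergence theorem for the tangential part of gX, with Euler's
identity for f, turns it into the pointwise identity (H_f - H)⟨X,N⟩ = 0
(`IsStationary.inner_mul_eq_zero`). It is proved in chart interiors with compactly supported g and
reaches the boundary by continuity, so no boundary term or contact angle enters. H_f itself need not
be shown constant: only the product with ⟨X,N⟩ is ever used.

For the parallel hypersurfaces with volume V(t), the identity gives V'(0) = -(n+k)/q · ∫(1 -
H⟨X,N⟩)f = -(n+k)A (`IsStationary.hasDerivAt_weightedVolume_parallelMap`). Volume is homogeneous of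
degree q under dilation, so s(t) = (V₀/V(t))^(1/q) is the only possible choice, and s'(0) =
-V'(0)/(qV₀) = H. The normal velocity is H⟨X,N⟩ + n + k, and here H may be replaced by H_f. -/

set_option linter.unusedSectionVars false

noncomputable section

namespace ConeHypersurface

/-! ### Gram determinants of hyperplane frames. -/

section LinearAlgebra
open Matrix
variable {n : ℕ}

/-- The square matrix whose rows are `y` and the vectors `v i`. -/
def rowMatrix (y : E n) (v : Fin n → E n) : Matrix (Fin (n + 1)) (Fin (n + 1)) ℝ :=
  Matrix.of fun i j => (Fin.cons y v : Fin (n + 1) → E n) i j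

theorem rowMatrix_mul_transpose (y z : E n) (v w : Fin n → E n) :
    rowMatrix y v * (rowMatrix z w)ᵀ = Matrix.of fun i j =>
      inner ℝ ((Fin.cons y v : Fin (n + 1) → E n) i) ((Fin.cons z w : Fin (n + 1) → E n) j) := by
  ext i j
  simp only [rowMatrix, Matrix.mul_apply, Matrix.transpose_apply, Matrix.of_apply, PiLp.inner_apply]
  refine Finset.sum_congr rfl fun l _ => ?_
  simp [mul_comm]

/-- If the first row of a Gram-like matrix is `(a, 0)`, its determinant is a product. -/
theorem det_rowMatrix_mul_det_rowMatrix_of_row (y z : E n) (v w : Fin n → E n)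
    (h : ∀ j, inner ℝ y (w j) = 0) :
    (rowMatrix y v).det * (rowMatrix z w).det =
      inner ℝ y z * (Matrix.of fun i j => inner ℝ (v i) (w j)).det := by
  rw [← det_transpose (rowMatrix z w), ← det_mul, rowMatrix_mul_transpose, det_succ_row_zero,
    Fin.sum_univ_succ, Finset.sum_eq_zero]
  · simp only [Fin.val_zero, pow_zero, one_mul, of_apply, Fin.cons_zero, add_zero]
    congr 1
  · intro j _
    simp [h]

theorem det_rowMatrix_mul_det_rowMatrix_of_col (y z : E n) (v w : Fin n → E n)
    (h : ∀ i, inner ℝ z (v i) = 0) :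
    (rowMatrix y v).det * (rowMatrix z w).det =
      inner ℝ y z * (Matrix.of fun i j => inner ℝ (v i) (w j)).det := by
  rw [mul_comm, det_rowMatrix_mul_det_rowMatrix_of_row z y w v h, real_inner_comm,
    ← det_transpose]
  congr 2
  ext i j
  simp [real_inner_comm]

/-- Adding the unit normal as a first row makes the frame square, and the Gram matrix of the
completed frame is block diagonal with blocks 1 and the Gram matrix of v. -/
theorem det_gram_eq_sq {N : E n} {v : Fin n → E n} (hN : ‖N‖ = 1)
    (h : ∀ i, inner ℝ N (v i) = 0) : (gram ℝ v).det = (rowMatrix N v).det ^ 2 := by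
  have := det_rowMatrix_mul_det_rowMatrix_of_row N N v v h
  rw [real_inner_self_eq_norm_sq, hN] at this
  rw [sq, this]
  simp [gram, Matrix.of]

theorem det_gram_pos {v : Fin n → E n} (hv : LinearIndependent ℝ v) : 0 < (gram ℝ v).det :=
  (posDef_gram_of_linearIndependent hv).det_pos

/-- A vector orthogonal to a hyperplane basis and to its normal vanishes. -/
theorem eq_zero_of_inner_eq_zero {N : E n} {v : Fin n → E n} (hN : ‖N‖ = 1)
    (h : ∀ i, inner ℝ N (v i) = 0) (hv : LinearIndependent ℝ v) {y : E n}
    (h0 : inner ℝ y N = 0) (hy : ∀ i, inner ℝ y (v i) = 0) : y = 0 := by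
  have hd : (rowMatrix N v).det ≠ 0 := by
    intro hd
    have := det_gram_pos hv
    rw [det_gram_eq_sq hN h, hd] at this
    simp at this
  have : (WithLp.ofLp y : Fin (n + 1) → ℝ) = 0 := by
    refine eq_zero_of_mulVec_eq_zero hd ?_
    ext i
    have e : ∀ z : E n, ∑ l, z l * y l = inner ℝ y z := fun z => by
      simp [PiLp.inner_apply]
    refine Fin.cases ?_ (fun i => ?_) i
    · simpa [mulVec, dotProduct, rowMatrix, e] using h0
    · simpa [mulVec, dotProduct, rowMatrix, e] using hy i
  ext i
  simpa using congrFun this i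

/-- Decomposition of a vector in a hyperplane frame and its normal. -/
theorem eq_inner_smul_add_sum {N : E n} {v : Fin n → E n} (hN : ‖N‖ = 1)
    (h : ∀ i, inner ℝ N (v i) = 0) (hv : LinearIndependent ℝ v) (X : E n) :
    X = inner ℝ X N • N + ∑ l, (∑ j, (gram ℝ v)⁻¹ l j * inner ℝ X (v j)) • v l := by
  have hGv := det_gram_pos hv
  set z := (gram ℝ v)⁻¹ *ᵥ (fun i => inner ℝ X (v i)) with hz
  have hGz : gram ℝ v *ᵥ z = fun i => inner ℝ X (v i) := by
    rw [hz, mulVec_mulVec, mul_nonsing_inv _ hGv.ne'.isUnit, one_mulVec]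
  change X = inner ℝ X N • N + ∑ l, z l • v l
  rw [← sub_eq_zero]
  refine eq_zero_of_inner_eq_zero hN h hv ?_ fun i => ?_
  · rw [inner_sub_left, inner_add_left, sum_inner, inner_smul_left, real_inner_self_eq_norm_sq, hN]
    simp [inner_smul_left, fun i => (real_inner_comm N (v i)).trans (h i)]
  · rw [inner_sub_left, inner_add_left, sum_inner, ← congrFun hGz i, inner_smul_left, h]
    simp only [inner_smul_left, mulVec, dotProduct, gram_apply, mul_zero, zero_add]
    rw [sub_eq_zero]
    refine Finset.sum_congr rfl fun j _ => ?_
    simp [real_inner_comm, mul_comm]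

/-- The Gram determinant of the vectors `v i + c i • X`, where `c i = ⟪Z, v i⟫`. -/
theorem det_gram_add_smul {N X Z : E n} {v : Fin n → E n} (hN : ‖N‖ = 1)
    (h : ∀ i, inner ℝ N (v i) = 0) (hv : LinearIndependent ℝ v) (hZ : inner ℝ Z N = 0)
    (hb : 0 < 1 + inner ℝ Z X)
    (hw : LinearIndependent ℝ fun i => v i + inner ℝ Z (v i) • X) :
    (gram ℝ fun i => v i + inner ℝ Z (v i) • X).det =
      ((1 + inner ℝ Z X) ^ 2 + inner ℝ X N ^ 2 * ‖Z‖ ^ 2) * (gram ℝ v).det := by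
  set w : Fin n → E n := fun i => v i + inner ℝ Z (v i) • X with hwdef
  set b := inner ℝ Z X with hbdef
  -- This combination of N and Z is orthogonal to every w i, so it is the normal of the perturbed
  -- frame up to scale. The claim amounts to saying that the ratio of the two Gram determinants is
  -- ‖m‖².
  set m : E n := (1 + b) • N - inner ℝ X N • Z with hm
  have hNm : inner ℝ N m = 1 + b := by
    rw [hm, inner_sub_right, inner_smul_right, inner_smul_right, real_inner_self_eq_norm_sq, hN,
      real_inner_comm Z N, hZ]; ring
  have hmm : ‖m‖ ^ 2 = (1 + b) ^ 2 + inner ℝ X N ^ 2 * ‖Z‖ ^ 2 := by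
    rw [← real_inner_self_eq_norm_sq, hm, inner_sub_left, inner_sub_right, inner_sub_right]
    simp only [inner_smul_left, inner_smul_right, hZ, real_inner_comm Z N,
      real_inner_self_eq_norm_sq, hN]
    simp; ring
  have hmw : ∀ i, inner ℝ m (w i) = 0 := by
    intro i
    rw [hm, hwdef]
    simp only [inner_sub_left, inner_add_right, inner_smul_left, inner_smul_right, h,
      real_inner_comm X N, ← hbdef]
    simp; ring
  have hm0 : 0 < ‖m‖ := by
    have : 0 < ‖m‖ ^ 2 := by rw [hmm]; positivity
    exact (norm_nonneg m).lt_of_ne' fun h0 => by simp [h0] at this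
  have hGv := det_gram_pos hv
  have hGw := det_gram_pos hw
  -- normalised normal of the perturbed frame
  set ν : E n := ‖m‖⁻¹ • m with hν
  have hν1 : ‖ν‖ = 1 := by rw [hν, norm_smul, norm_inv, norm_norm, inv_mul_cancel₀ hm0.ne']
  have hνw : ∀ i, inner ℝ ν (w i) = 0 := fun i => by rw [hν, inner_smul_left, hmw]; simp
  have hGw' := det_gram_eq_sq hν1 hνw
  have hGv' := det_gram_eq_sq hN h
  -- The determinant of (N, w) occurs in both mixed products `e1` and `e2`; eliminating it compares
  -- the Gram determinants of w and v. The common factor (1+b)² cancels because 1+b > 0.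
  have e1 := det_rowMatrix_mul_det_rowMatrix_of_col N ν w w hνw
  have e2 := det_rowMatrix_mul_det_rowMatrix_of_row N N w v h
  have hNν : inner ℝ N ν = ‖m‖⁻¹ * (1 + b) := by rw [hν, inner_smul_right, hNm]
  -- A rank-one perturbation of the Gram matrix: the matrix determinant lemma applies, and its
  -- scalar is ⟨Z,X⟩ because Z is tangent and so is recovered from its products with the frame.
  have e3 : (Matrix.of fun i j => inner ℝ (w i) (v j)).det = (gram ℝ v).det * (1 + b) := by
    have : (Matrix.of fun i j => inner ℝ (w i) (v j)) = gram ℝ v +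
        replicateCol Unit (fun i => inner ℝ Z (v i)) * replicateRow Unit
          (fun j => inner ℝ X (v j)) := by
      ext i j
      simp [hwdef, inner_add_left, inner_smul_left, mul_apply, gram_apply]
    rw [this, det_add_replicateCol_mul_replicateRow (ι := Unit) hGv.ne'.isUnit,
      det_unique (n := Unit)]
    congr 1
    rw [Matrix.add_apply, one_apply_eq, Matrix.mul_assoc, mul_apply, hbdef]
    congr 1
    have hX : inner ℝ Z X = inner ℝ X (∑ l, (∑ j, (gram ℝ v)⁻¹ l j * inner ℝ Z (v j)) • v l) := by
      conv_lhs => rw [real_inner_comm, eq_inner_smul_add_sum hN h hv Z, hZ, zero_smul, zero_add]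
    rw [hX, inner_sum]
    refine Finset.sum_congr rfl fun l _ => ?_
    rw [inner_smul_right, mul_comm]
    congr 1
  rw [real_inner_self_eq_norm_sq, hN, e3] at e2
  have e1' : (rowMatrix N w).det * (rowMatrix ν w).det = ‖m‖⁻¹ * (1 + b) * (gram ℝ w).det := by
    rw [e1, hNν]; rfl
  rw [← hmm]
  have s1 : (rowMatrix N w).det ^ 2 = (‖m‖⁻¹ * (1 + b)) ^ 2 * (gram ℝ w).det := by
    have := congrArg (· ^ 2) e1'
    simp only [mul_pow, ← hGw'] at this
    have h2 : (rowMatrix N w).det ^ 2 * (gram ℝ w).det =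
      ((‖m‖⁻¹ * (1 + b)) ^ 2 * (gram ℝ w).det) * (gram ℝ w).det := by rw [this]; ring
    exact mul_right_cancel₀ hGw.ne' h2
  have s2 : (rowMatrix N w).det ^ 2 = (gram ℝ v).det * (1 + b) ^ 2 := by
    have := congrArg (· ^ 2) e2
    simp only [mul_pow, ← hGv', one_pow, one_mul] at this
    have h2 : (rowMatrix N w).det ^ 2 * (gram ℝ v).det =
      ((gram ℝ v).det * (1 + b) ^ 2) * (gram ℝ v).det := by rw [this]; ring
    exact mul_right_cancel₀ hGv.ne' h2
  rw [s1] at s2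
  have hb' : (1 + b) ^ 2 ≠ 0 := by positivity
  field_simp at s2
  linear_combination s2

/-- The matrix of the shape operator: `N' i = ∑ l, (shape v N') i l • v l`. -/
def shapeMatrix (v N' : Fin n → E n) : Matrix (Fin n) (Fin n) ℝ :=
  (Matrix.of fun i j => inner ℝ (N' i) (v j)) * (gram ℝ v)⁻¹

theorem gram_transpose (v : Fin n → E n) : (gram ℝ v)ᵀ = gram ℝ v := by
  ext i j; simp [gram_apply, real_inner_comm]

theorem gram_inv_comm (v : Fin n → E n) (i j : Fin n) :
    (gram ℝ v)⁻¹ i j = (gram ℝ v)⁻¹ j i := by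
  conv_lhs => rw [← gram_transpose v, ← transpose_nonsing_inv, transpose_apply]

theorem eq_sum_shapeMatrix {N : E n} {v N' : Fin n → E n} (hN : ‖N‖ = 1)
    (h : ∀ i, inner ℝ N (v i) = 0) (hv : LinearIndependent ℝ v)
    (h' : ∀ i, inner ℝ (N' i) N = 0) (i : Fin n) :
    N' i = ∑ l, shapeMatrix v N' i l • v l := by
  conv_lhs => rw [eq_inner_smul_add_sum hN h hv (N' i), h', zero_smul, zero_add]
  refine Finset.sum_congr rfl fun l _ => ?_
  congr 1
  rw [shapeMatrix, mul_apply]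
  refine Finset.sum_congr rfl fun j _ => ?_
  rw [gram_inv_comm, mul_comm]; rfl

theorem trace_shapeMatrix (v N' : Fin n → E n) :
    (shapeMatrix v N').trace = ∑ i, ∑ j, (gram ℝ v)⁻¹ i j * inner ℝ (N' i) (v j) := by
  rw [shapeMatrix, trace]
  refine Finset.sum_congr rfl fun i _ => ?_
  rw [diag_apply, mul_apply]
  refine Finset.sum_congr rfl fun j _ => ?_
  rw [gram_inv_comm, mul_comm]; rfl

/-- The Gram determinant transforms by the square of the determinant. -/
theorem det_gram_sum_smul (A : Matrix (Fin n) (Fin n) ℝ) (v : Fin n → E n) :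
    (gram ℝ fun i => ∑ l, A i l • v l).det = A.det ^ 2 * (gram ℝ v).det := by
  have : (gram ℝ fun i => ∑ l, A i l • v l) = A * gram ℝ v * Aᵀ := by
    ext i j
    simp only [gram_apply, mul_apply, transpose_apply, sum_inner, inner_sum, inner_smul_left,
      inner_smul_right, Finset.sum_mul, Finset.mul_sum]
    refine Finset.sum_congr rfl fun a _ => Finset.sum_congr rfl fun c _ => ?_
    simp; ring
  rw [this, det_mul, det_mul, det_transpose]; ring

/-- Since each N' i is tangent, the new frame is the old one multiplied by 1 + τS, with S the shape
matrix. This gives the area element of parallel hypersurfaces. -/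
theorem sqrt_det_gram_add_smul_shape {N : E n} {v N' : Fin n → E n} (hN : ‖N‖ = 1)
    (h : ∀ i, inner ℝ N (v i) = 0) (hv : LinearIndependent ℝ v)
    (h' : ∀ i, inner ℝ (N' i) N = 0) (τ : ℝ) :
    √(gram ℝ fun i => v i + τ • N' i).det =
      |(1 + τ • shapeMatrix v N').det| * √(gram ℝ v).det := by
  have : (fun i => v i + τ • N' i) = fun i => ∑ l, (1 + τ • shapeMatrix v N') i l • v l := by
    ext1 i
    conv_lhs => rw [eq_sum_shapeMatrix hN h hv h' i]
    simp [add_smul, Finset.sum_add_distrib, one_apply, ite_smul, Finset.smul_sum, mul_smul]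
  rw [this, det_gram_sum_smul, Real.sqrt_mul (sq_nonneg _), Real.sqrt_sq_eq_abs]

theorem sqrt_det_gram_smul (r : ℝ) (v : Fin n → E n) :
    √(gram ℝ fun i => r • v i).det = |r| ^ n * √(gram ℝ v).det := by
  have : (gram ℝ fun i => r • v i) = (r ^ 2) • gram ℝ v := by
    ext i j; simp [gram_apply, inner_smul_left, inner_smul_right]; ring
  rw [this, det_smul, Fintype.card_fin, Real.sqrt_mul (by positivity)]
  congr 1
  rw [← pow_mul, mul_comm 2 n, pow_mul, Real.sqrt_sq_eq_abs, abs_pow]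

/-- Gram determinant of the image of a frame under a change of parameters. -/
theorem sqrt_det_gram_comp {m : Type*} [NormedAddCommGroup m] [InnerProductSpace ℝ m]
    (T : EuclideanSpace ℝ (Fin n) →L[ℝ] m)
    (D : EuclideanSpace ℝ (Fin n) →L[ℝ] EuclideanSpace ℝ (Fin n)) :
    √(gram ℝ fun i => T (D (EuclideanSpace.single i 1))).det =
      |D.det| * √(gram ℝ fun i => T (EuclideanSpace.single i 1)).det := by
  let b := (EuclideanSpace.basisFun (Fin n) ℝ).toBasis
  set A : Matrix (Fin n) (Fin n) ℝ := LinearMap.toMatrix b b D with hA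
  have hD : ∀ i, D (EuclideanSpace.single i 1) = ∑ l, A l i • EuclideanSpace.single l 1 := by
    intro i
    have := (LinearMap.toMatrix b b D.toLinearMap)
    have h2 := b.sum_repr (D (EuclideanSpace.single i 1))
    rw [← h2]
    refine Finset.sum_congr rfl fun l _ => ?_
    rw [hA, LinearMap.toMatrix_apply]
    simp [b]
  have : (gram ℝ fun i => T (D (EuclideanSpace.single i 1))) =
      Aᵀ * (gram ℝ fun i => T (EuclideanSpace.single i 1)) * A := by
    ext i j
    simp only [gram_apply, mul_apply, transpose_apply, hD, map_sum, map_smul, sum_inner, inner_sum,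
      inner_smul_left, inner_smul_right, Finset.sum_mul, Finset.mul_sum]
    refine Finset.sum_congr rfl fun a _ => Finset.sum_congr rfl fun c _ => ?_
    simp; ring
  have hdet : D.det = A.det := by
    rw [hA, LinearMap.det_toMatrix]
  rw [this, det_mul, det_mul, det_transpose, hdet,
    show A.det * (gram ℝ fun i => T (EuclideanSpace.single i 1)).det * A.det =
      A.det ^ 2 * (gram ℝ fun i => T (EuclideanSpace.single i 1)).det by ring,
    Real.sqrt_mul (sq_nonneg _), Real.sqrt_sq_eq_abs]

end LinearAlgebra

/-! ### Integrals over a compact set depending smoothly on a parameter. -/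

section ParametricIntegral

variable {Y V : Type*} [TopologicalSpace Y] [T2Space Y] [MeasurableSpace Y] [OpensMeasurableSpace Y]
  [SecondCountableTopologyEither Y ℝ] [NormedAddCommGroup V] [NormedSpace ℝ V]
  {μ : Measure Y} [IsFiniteMeasureOnCompacts μ]

/-- All dependence on t sits in one function Ψ on an open set, while y enters through the continuous
data a y. The t-derivative is therefore bounded on a compact product of a time interval with K, and
a constant dominates. -/
theorem hasDerivAt_integral_comp {K : Set Y} (hK : IsCompact K) {w : Y → ℝ}
    (hw : ContinuousOn w K) {a : Y → V} (ha : ContinuousOn a K) {O : Set (ℝ × V)} (hO : IsOpen O)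
    {Ψ : ℝ × V → ℝ} (hΨ : ContDiffOn ℝ 1 Ψ O) {ε : ℝ}
    (hmem : ∀ t ∈ Ioo (-ε) ε, ∀ y ∈ K, (t, a y) ∈ O) {t₀ : ℝ} (ht₀ : t₀ ∈ Ioo (-ε) ε) :
    HasDerivAt (fun t => ∫ y in K, w y * Ψ (t, a y) ∂μ)
      (∫ y in K, w y * fderiv ℝ Ψ (t₀, a y) (1, 0) ∂μ) t₀ := by
  obtain ⟨δ, hδ, hsub⟩ : ∃ δ > 0, Icc (t₀ - δ) (t₀ + δ) ⊆ Ioo (-ε) ε := by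
    refine ⟨min (t₀ + ε) (ε - t₀) / 2, ?_, fun t ht => ?_⟩
    · have : 0 < min (t₀ + ε) (ε - t₀) := lt_min (by linarith [ht₀.1]) (by linarith [ht₀.2])
      linarith
    · have h1 := min_le_left (t₀ + ε) (ε - t₀)
      have h2 := min_le_right (t₀ + ε) (ε - t₀)
      have h3 : 0 < min (t₀ + ε) (ε - t₀) := lt_min (by linarith [ht₀.1]) (by linarith [ht₀.2])
      exact ⟨by linarith [ht.1], by linarith [ht.2]⟩
  have hcd : ContinuousOn (fun z => fderiv ℝ Ψ z (1, 0)) O :=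
    (hΨ.continuousOn_fderiv_of_isOpen hO le_rfl).clm_apply continuousOn_const
  have hmap : ∀ t ∈ Ioo (-ε) ε, ContinuousOn (fun y => (t, a y)) K := fun t _ =>
    continuousOn_const.prodMk ha
  have hc : ∀ t ∈ Ioo (-ε) ε, ContinuousOn (fun y => w y * Ψ (t, a y)) K := fun t ht =>
    hw.mul (hΨ.continuousOn.comp (hmap t ht) fun y hy => hmem t ht y hy)
  have hc' : ∀ t ∈ Ioo (-ε) ε, ContinuousOn (fun y => w y * fderiv ℝ Ψ (t, a y) (1, 0)) K :=
    fun t ht => hw.mul (hcd.comp (hmap t ht) fun y hy => hmem t ht y hy)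
  have hjoint : ContinuousOn (fun z : ℝ × Y => w z.2 * fderiv ℝ Ψ (z.1, a z.2) (1, 0))
      (Icc (t₀ - δ) (t₀ + δ) ×ˢ K) := by
    refine (hw.comp continuousOn_snd fun z hz => hz.2).mul
      (hcd.comp (continuousOn_fst.prodMk (ha.comp continuousOn_snd fun z hz => hz.2)) ?_)
    exact fun z hz => hmem _ (hsub hz.1) _ hz.2
  obtain ⟨C, hC⟩ := (isCompact_Icc.prod hK).exists_bound_of_continuousOn hjoint
  have hmeas := hK.measurableSet
  refine (hasDerivAt_integral_of_dominated_loc_of_deriv_le (s := Icc (t₀ - δ) (t₀ + δ))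
    (F := fun t y => w y * Ψ (t, a y)) (F' := fun t y => w y * fderiv ℝ Ψ (t, a y) (1, 0))
    (bound := fun _ => C)
    (Icc_mem_nhds (by linarith) (by linarith)) ?_ ?_ ?_ ?_ ?_ ?_).2
  · filter_upwards [Ioo_mem_nhds ht₀.1 ht₀.2] with t ht
    exact (hc t ht).aestronglyMeasurable hmeas
  · exact (hc t₀ ht₀).integrableOn_compact hK
  · exact (hc' t₀ ht₀).aestronglyMeasurable hmeas
  · filter_upwards [ae_restrict_mem hmeas] with y hy t ht using hC (t, y) ⟨ht, hy⟩
  · exact integrableOn_const hK.measure_lt_top.ne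
  · filter_upwards [ae_restrict_mem hmeas] with y hy t ht
    have hd : HasFDerivAt Ψ (fderiv ℝ Ψ (t, a y)) (t, a y) :=
      ((hΨ.differentiableOn one_ne_zero).differentiableAt
        (hO.mem_nhds (hmem t (hsub ht) y hy))).hasFDerivAt
    have hl : HasDerivAt (fun s : ℝ => (s, a y)) ((1 : ℝ), (0 : V)) t :=
      (hasDerivAt_id t).prodMk (hasDerivAt_const t (a y))
    exact (hd.comp_hasDerivAt t hl).const_mul (w y)

/-- The derivative is an integral of the same shape with Ψ replaced by its t-derivative, hence the
induction over all Ψ at once. -/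
theorem contDiffOn_integral_comp {K : Set Y} (hK : IsCompact K) {w : Y → ℝ}
    (hw : ContinuousOn w K) {a : Y → V} (ha : ContinuousOn a K) {O : Set (ℝ × V)} (hO : IsOpen O)
    {Ψ : ℝ × V → ℝ} (hΨ : ContDiffOn ℝ ∞ Ψ O) {ε : ℝ}
    (hmem : ∀ t ∈ Ioo (-ε) ε, ∀ y ∈ K, (t, a y) ∈ O) :
    ContDiffOn ℝ ∞ (fun t => ∫ y in K, w y * Ψ (t, a y) ∂μ) (Ioo (-ε) ε) := by
  rw [contDiffOn_infty]
  intro m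
  induction m generalizing Ψ with
  | zero =>
    simp only [CharP.cast_eq_zero, contDiffOn_zero]
    exact fun t ht => (hasDerivAt_integral_comp hK hw ha hO
      (hΨ.of_le (by exact_mod_cast le_top)) hmem ht).continuousAt.continuousWithinAt
  | succ m ih =>
    have hd : ∀ t ∈ Ioo (-ε) ε, HasDerivAt (fun t => ∫ y in K, w y * Ψ (t, a y) ∂μ)
        (∫ y in K, w y * fderiv ℝ Ψ (t, a y) (1, 0) ∂μ) t := fun t ht =>
      hasDerivAt_integral_comp hK hw ha hO (hΨ.of_le (by exact_mod_cast le_top)) hmem ht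
    push_cast
    rw [contDiffOn_succ_iff_deriv_of_isOpen isOpen_Ioo]
    refine ⟨fun t ht => (hd t ht).differentiableAt.differentiableWithinAt, by simp, ?_⟩
    have h2 : ContDiffOn ℝ ∞ (fun z => fderiv ℝ Ψ z (1, 0)) O :=
      (hΨ.fderiv_of_isOpen hO (by simp)).clm_apply contDiffOn_const
    exact (ih h2).congr fun t ht => (hd t ht).deriv

end ParametricIntegral

/-! ### Derivative and smoothness of determinants and inverses. -/

section Det
open Matrix
variable {n : ℕ}

theorem contDiff_det_pi (m : ℕ∞ω) :
    ContDiff ℝ m fun A : Fin n → Fin n → ℝ => (Matrix.of A).det := by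
  simp only [det_apply, of_apply]
  refine ContDiff.sum fun σ _ => ContDiff.const_smul _ (contDiff_prod fun i _ => ?_)
  exact contDiff_apply_apply ℝ ℝ _ _

theorem hasDerivAt_det_one_add_smul (M : Matrix (Fin n) (Fin n) ℝ) :
    HasDerivAt (fun t : ℝ => (1 + t • M).det) M.trace 0 := by
  set p := (1 + (Polynomial.X : Polynomial ℝ) • M.map Polynomial.C).det with hp
  have h : (fun t : ℝ => (1 + t • M).det) = fun t => p.eval t := by
    ext t
    rw [hp, ← Polynomial.coe_evalRingHom, RingHom.map_det]
    congr 1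
    ext i j
    by_cases hij : i = j <;> simp [hij, mul_comm (M _ _)]
  rw [h, ← derivative_det_one_add_X_smul M]
  exact p.hasDerivAt 0

/-- Jacobi's formula, as a Fréchet derivative at an invertible matrix. -/
theorem fderiv_det_pi {A : Fin n → Fin n → ℝ} (hA : (Matrix.of A).det ≠ 0)
    (B : Fin n → Fin n → ℝ) :
    fderiv ℝ (fun A : Fin n → Fin n → ℝ => (Matrix.of A).det) A B =
      (Matrix.of A).det * ((Matrix.of A)⁻¹ * Matrix.of B).trace := by
  have h1 : HasDerivAt (fun t : ℝ => (Matrix.of (A + t • B)).det)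
      (fderiv ℝ (fun A : Fin n → Fin n → ℝ => (Matrix.of A).det) A B) 0 := by
    have hd := (((contDiff_det_pi (n := n) 1).differentiable one_ne_zero) A).hasFDerivAt
    have hl : HasDerivAt (fun t : ℝ => A + t • B) B 0 := by
      simpa using ((hasDerivAt_id (0 : ℝ)).smul_const B).const_add A
    have h0 : A + (0 : ℝ) • B = A := by simp
    rw [← h0] at hd
    have := hd.comp_hasDerivAt (0 : ℝ) hl
    rwa [h0] at this
  -- Factoring A out of A + tB reduces to the derivative at the identity.
  have h2 : HasDerivAt (fun t : ℝ => (Matrix.of (A + t • B)).det)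
      ((Matrix.of A).det * ((Matrix.of A)⁻¹ * Matrix.of B).trace) 0 := by
    have := (hasDerivAt_det_one_add_smul ((Matrix.of A)⁻¹ * Matrix.of B)).const_mul
      (Matrix.of A).det
    refine this.congr_of_eventuallyEq (Filter.Eventually.of_forall fun t => ?_)
    simp only
    rw [← det_mul, Matrix.mul_add, Matrix.mul_one, Matrix.mul_smul, ← Matrix.mul_assoc,
      mul_nonsing_inv _ hA.isUnit, Matrix.one_mul]
    rfl
  exact h1.unique h2

theorem contDiffOn_det {V : Type*} [NormedAddCommGroup V] [NormedSpace ℝ V] {s : Set V}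
    {m : ℕ∞ω} {A : V → Matrix (Fin n) (Fin n) ℝ}
    (hA : ∀ i j, ContDiffOn ℝ m (fun y => A y i j) s) : ContDiffOn ℝ m (fun y => (A y).det) s :=
  (contDiff_det_pi m).comp_contDiffOn (f := fun y => (fun i j => A y i j))
    (contDiffOn_pi.2 fun i => contDiffOn_pi.2 fun j => hA i j)

/-- Cramer's rule: the entries are quotients of determinants. -/
theorem contDiffOn_inv_apply {V : Type*} [NormedAddCommGroup V] [NormedSpace ℝ V] {s : Set V}
    {m : ℕ∞ω} {A : V → Matrix (Fin n) (Fin n) ℝ}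
    (hA : ∀ i j, ContDiffOn ℝ m (fun y => A y i j) s) (h0 : ∀ y ∈ s, (A y).det ≠ 0)
    (i j : Fin n) : ContDiffOn ℝ m (fun y => (A y)⁻¹ i j) s := by
  have h1 : ∀ y, (A y)⁻¹ i j = ((A y).det)⁻¹ * ((A y).updateRow j (Pi.single i 1)).det := by
    intro y
    rw [Matrix.inv_def, Matrix.smul_apply, Matrix.adjugate_apply, smul_eq_mul, Ring.inverse_eq_inv']
  simp only [h1]
  refine ((contDiffOn_det hA).inv h0).mul (contDiffOn_det fun a b => ?_)
  by_cases hj : a = j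
  · subst hj; simp only [updateRow_self]; exact contDiffOn_const
  · simp only [updateRow_ne hj]; exact hA a b

end Det

/-! ### Immersions read in charts of a manifold with boundary. -/

section Charts

variable {n : ℕ} [NeZero n] {S : Type*} [TopologicalSpace S]
  [ChartedSpace (EuclideanHalfSpace n) S] [IsManifold (𝓡∂ n) ∞ S]
  {V : Type*} [NormedAddCommGroup V] [NormedSpace ℝ V]

/-- The derivative of `φ` in the chart at `x`, at the point of coordinates `y`. -/
def chartDeriv (φ : S → V) (x : S) (y : EuclideanSpace ℝ (Fin n)) :
    EuclideanSpace ℝ (Fin n) →L[ℝ] V :=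
  fderivWithin ℝ (φ ∘ (extChartAt (𝓡∂ n) x).symm) (range (𝓡∂ n)) y

/-- The coordinate vectors of the immersion `φ` in the chart at `x`. -/
def chartFrame (φ : S → V) (x : S) (y : EuclideanSpace ℝ (Fin n)) (i : Fin n) : V :=
  chartDeriv φ x y (EuclideanSpace.single i 1)

theorem areaDensity_eq (φ : S → E n) (x : S) (y : EuclideanSpace ℝ (Fin n)) :
    areaDensity φ x y = √(Matrix.gram ℝ (chartFrame φ x y)).det := rfl

theorem contDiffOn_chart {φ : S → V} (hφ : ContMDiff (𝓡∂ n) 𝓘(ℝ, V) ∞ φ) (x : S) :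
    ContDiffOn ℝ ∞ (φ ∘ (extChartAt (𝓡∂ n) x).symm) (extChartAt (𝓡∂ n) x).target :=
  (hφ.comp_contMDiffOn (contMDiffOn_extChartAt_symm x)).contDiffOn

/-- The chart target is relatively open in the half-space, so derivatives within the target and
within the half-space agree, also at edge points. -/
theorem nhdsWithin_target_eq {x : S} {y : EuclideanSpace ℝ (Fin n)}
    (hy : y ∈ (extChartAt (𝓡∂ n) x).target) :
    𝓝[(extChartAt (𝓡∂ n) x).target] y = 𝓝[range (𝓡∂ n)] y :=
  nhdsWithin_extChartAt_target_eq_of_mem hy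

theorem hasFDerivWithinAt_chart {φ : S → V} (hφ : ContMDiff (𝓡∂ n) 𝓘(ℝ, V) ∞ φ) {x : S}
    {y : EuclideanSpace ℝ (Fin n)} (hy : y ∈ (extChartAt (𝓡∂ n) x).target) :
    HasFDerivWithinAt (φ ∘ (extChartAt (𝓡∂ n) x).symm) (chartDeriv φ x y) (range (𝓡∂ n)) y := by
  have h := (contDiffOn_chart hφ x).differentiableOn (by simp) y hy
  have : DifferentiableWithinAt ℝ (φ ∘ (extChartAt (𝓡∂ n) x).symm) (range (𝓡∂ n)) y := by
    exact h.mono_of_mem_nhdsWithin (by rw [← nhdsWithin_target_eq hy]; exact self_mem_nhdsWithin)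
  exact this.hasFDerivWithinAt

theorem contDiffOn_chartDeriv {φ : S → V} (hφ : ContMDiff (𝓡∂ n) 𝓘(ℝ, V) ∞ φ) (x : S) :
    ContDiffOn ℝ ∞ (chartDeriv φ x) (extChartAt (𝓡∂ n) x).target := by
  have := (contDiffOn_chart hφ x).fderivWithin (m := ∞) (uniqueDiffOn_extChartAt_target x) (by simp)
  exact this.congr fun y hy => (((hasFDerivWithinAt_chart hφ hy).mono
    (extChartAt_target_subset_range x)).fderivWithin (uniqueDiffOn_extChartAt_target x y hy)).symm

theorem contDiffOn_chartFrame {φ : S → V} (hφ : ContMDiff (𝓡∂ n) 𝓘(ℝ, V) ∞ φ) (x : S) (i : Fin n) :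
    ContDiffOn ℝ ∞ (fun y => chartFrame φ x y i) (extChartAt (𝓡∂ n) x).target :=
  (contDiffOn_chartDeriv hφ x).clm_apply contDiffOn_const

theorem uniqueDiffWithinAt_range {x : S} {y : EuclideanSpace ℝ (Fin n)}
    (hy : y ∈ (extChartAt (𝓡∂ n) x).target) : UniqueDiffWithinAt ℝ (range (𝓡∂ n)) y :=
  (𝓡∂ n).uniqueDiffOn y (extChartAt_target_subset_range x hy)

/-- The derivative of the inverse chart. -/
def chartSymmDeriv (x : S) (y : EuclideanSpace ℝ (Fin n)) :
    EuclideanSpace ℝ (Fin n) →L[ℝ] EuclideanSpace ℝ (Fin n) :=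
  mfderivWithin 𝓘(ℝ, EuclideanSpace ℝ (Fin n)) (𝓡∂ n) (extChartAt (𝓡∂ n) x).symm
    (range (𝓡∂ n)) y

theorem chartSymmDeriv_isInvertible {x : S} {y : EuclideanSpace ℝ (Fin n)}
    (hy : y ∈ (extChartAt (𝓡∂ n) x).target) : (chartSymmDeriv x y).IsInvertible :=
  haveI : IsManifold (𝓡∂ n) 1 S := IsManifold.of_le (n := ∞) (by simp)
  isInvertible_mfderivWithin_extChartAt_symm hy

theorem chartDeriv_eq {φ : S → V} (hφ : ContMDiff (𝓡∂ n) 𝓘(ℝ, V) ∞ φ) {x : S}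
    {y : EuclideanSpace ℝ (Fin n)} (hy : y ∈ (extChartAt (𝓡∂ n) x).target)
    (v : EuclideanSpace ℝ (Fin n)) :
    chartDeriv φ x y v =
      (mfderiv (𝓡∂ n) 𝓘(ℝ, V) φ ((extChartAt (𝓡∂ n) x).symm y) : _ →L[ℝ] V)
        (chartSymmDeriv x y v) := by
  have : IsManifold (𝓡∂ n) 1 S := IsManifold.of_le (n := ∞) (by simp)
  have h1 : MDifferentiableAt (𝓡∂ n) 𝓘(ℝ, V) φ ((extChartAt (𝓡∂ n) x).symm y) :=
    hφ.mdifferentiableAt (by simp)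
  have h2 := mdifferentiableWithinAt_extChartAt_symm (I := 𝓡∂ n) hy
  have h3 := mfderiv_comp_mfderivWithin y h1 h2
    (uniqueDiffWithinAt_range hy).uniqueMDiffWithinAt
  rw [mfderivWithin_eq_fderivWithin] at h3
  exact congrArg (fun L : EuclideanSpace ℝ (Fin n) →L[ℝ] V => L v) h3

theorem diff_eq_chartDeriv (φ : S → E n) (hφ : ContMDiff (𝓡∂ n) 𝓘(ℝ, E n) ∞ φ) (p : S) :
    diff φ p = chartDeriv φ p (extChartAt (𝓡∂ n) p p) := by
  unfold diff mfderiv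
  exact if_pos (hφ.mdifferentiableAt (by simp))

theorem chartFrame_eq {φ : S → E n} (hφ : ContMDiff (𝓡∂ n) 𝓘(ℝ, E n) ∞ φ) {x : S}
    {y : EuclideanSpace ℝ (Fin n)} (hy : y ∈ (extChartAt (𝓡∂ n) x).target) (i : Fin n) :
    chartFrame φ x y i = diff φ ((extChartAt (𝓡∂ n) x).symm y)
      (chartSymmDeriv x y (EuclideanSpace.single i 1)) :=
  chartDeriv_eq hφ hy _

theorem linearIndependent_chartFrame_iff {φ : S → E n} {x : S} {y : EuclideanSpace ℝ (Fin n)} :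
    LinearIndependent ℝ (chartFrame φ x y) ↔ Function.Injective (chartDeriv φ x y) := by
  let b := (EuclideanSpace.basisFun (Fin n) ℝ).toBasis
  have hb : chartFrame φ x y = (chartDeriv φ x y).toLinearMap ∘ b := by
    ext1 i; simp [chartFrame, b]
  rw [hb]
  constructor
  · intro h
    refine (injective_iff_map_eq_zero _).2 fun v hv => ?_
    have h2 := b.sum_repr v
    have h3 := Fintype.linearIndependent_iff.1 h (fun i => b.repr v i) (by
      simp only [Function.comp_apply, ← map_smul, ← map_sum, h2]; exact hv)
    rw [← h2]; simp [h3]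
  · intro h
    exact b.linearIndependent.map' _ (LinearMap.ker_eq_bot.2 h)

/-- The two differentials differ by the invertible derivative of the inverse chart. -/
theorem injective_chartDeriv_iff {φ : S → E n} (hφ : ContMDiff (𝓡∂ n) 𝓘(ℝ, E n) ∞ φ) {x : S}
    {y : EuclideanSpace ℝ (Fin n)} (hy : y ∈ (extChartAt (𝓡∂ n) x).target) :
    Function.Injective (chartDeriv φ x y) ↔
      Function.Injective (diff φ ((extChartAt (𝓡∂ n) x).symm y)) := by
  have h : (chartDeriv φ x y : _ → E n) =
      diff φ ((extChartAt (𝓡∂ n) x).symm y) ∘ chartSymmDeriv x y :=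
    funext fun v => chartDeriv_eq hφ hy v
  have hb : Function.Bijective (chartSymmDeriv x y) := by
    obtain ⟨e, he⟩ := chartSymmDeriv_isInvertible hy
    rw [← he]; exact e.bijective
  rw [h]
  exact ⟨fun H => H.of_comp_right hb.2, fun H => H.comp hb.1⟩

theorem linearIndependent_chartFrame {φ : S → E n} (hφ : IsSmoothImmersion φ) {x : S}
    {y : EuclideanSpace ℝ (Fin n)} (hy : y ∈ (extChartAt (𝓡∂ n) x).target) :
    LinearIndependent ℝ (chartFrame φ x y) :=
  linearIndependent_chartFrame_iff.2 <|
    (injective_chartDeriv_iff hφ.smooth hy).2 (hφ.injective_diff _)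

theorem contDiffOn_gram {φ : S → E n} (hφ : ContMDiff (𝓡∂ n) 𝓘(ℝ, E n) ∞ φ) (x : S)
    (i j : Fin n) :
    ContDiffOn ℝ ∞ (fun y => Matrix.gram ℝ (chartFrame φ x y) i j)
      (extChartAt (𝓡∂ n) x).target :=
  (contDiffOn_chartFrame hφ x i).inner ℝ (contDiffOn_chartFrame hφ x j)

theorem contDiffOn_areaDensity {φ : S → E n} (hφ : IsSmoothImmersion φ) (x : S) :
    ContDiffOn ℝ ∞ (areaDensity φ x) (extChartAt (𝓡∂ n) x).target := by
  refine ContDiffOn.sqrt (contDiffOn_det (contDiffOn_gram hφ.smooth x)) fun y hy => ?_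
  exact (det_gram_pos (linearIndependent_chartFrame hφ hy)).ne'

theorem areaDensity_pos {φ : S → E n} (hφ : IsSmoothImmersion φ) {x : S}
    {y : EuclideanSpace ℝ (Fin n)} (hy : y ∈ (extChartAt (𝓡∂ n) x).target) :
    0 < areaDensity φ x y :=
  Real.sqrt_pos.2 (det_gram_pos (linearIndependent_chartFrame hφ hy))

end Charts

/-! ### The area integral as a finite sum over compact sets. -/

section AreaIntegral

variable {n : ℕ} [NeZero n] {S : Type*} [TopologicalSpace S]
  [ChartedSpace (EuclideanHalfSpace n) S] [IsManifold (𝓡∂ n) ∞ S] [T2Space S] [CompactSpace S]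
  {V : Type*} [NormedAddCommGroup V] [NormedSpace ℝ V]

/-- The partition function of index `x`, read in the chart at `x`. -/
def chartWeight (x : S) (y : EuclideanSpace ℝ (Fin n)) : ℝ :=
  chartPartition (n := n) S x ((extChartAt (𝓡∂ n) x).symm y)

/-- The support of the partition function of index `x`, read in the chart at `x`. -/
def chartSupport (n : ℕ) [NeZero n] {S : Type*} [TopologicalSpace S]
    [ChartedSpace (EuclideanHalfSpace n) S] [IsManifold (𝓡∂ n) ∞ S] [T2Space S] [CompactSpace S]
    (x : S) : Set (EuclideanSpace ℝ (Fin n)) :=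
  extChartAt (𝓡∂ n) x '' tsupport (chartPartition (n := n) S x)

theorem tsupport_chartPartition_subset (x : S) :
    tsupport (chartPartition (n := n) S x) ⊆ (extChartAt (𝓡∂ n) x).source := by
  rw [extChartAt_source]
  exact (SmoothPartitionOfUnity.exists_isSubordinate_chartAt_source (𝓡∂ n) S).choose_spec x

theorem isCompact_chartSupport (x : S) : IsCompact (chartSupport n x) :=
  (isClosed_tsupport _).isCompact.image_of_continuousOn
    ((continuousOn_extChartAt x).mono (tsupport_chartPartition_subset x))

theorem chartSupport_subset (x : S) : chartSupport n x ⊆ (extChartAt (𝓡∂ n) x).target := by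
  rintro _ ⟨p, hp, rfl⟩
  exact (extChartAt (𝓡∂ n) x).map_source (tsupport_chartPartition_subset x hp)

theorem chartWeight_eq_zero {x : S} {y : EuclideanSpace ℝ (Fin n)}
    (hy : y ∈ (extChartAt (𝓡∂ n) x).target) (h : y ∉ chartSupport n x) : chartWeight x y = 0 := by
  by_contra h0
  refine h ⟨_, subset_tsupport _ h0, (extChartAt (𝓡∂ n) x).right_inv hy⟩

theorem chartWeight_nonneg (x : S) (y : EuclideanSpace ℝ (Fin n)) : 0 ≤ chartWeight x y :=
  SmoothPartitionOfUnity.nonneg _ _ _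

theorem continuousOn_chartWeight (x : S) :
    ContinuousOn (chartWeight x) (extChartAt (𝓡∂ n) x).target :=
  (chartPartition (n := n) S x).contMDiff.continuous.comp_continuousOn
    (continuousOn_extChartAt_symm x)

theorem measurableSet_target (x : S) : MeasurableSet (extChartAt (𝓡∂ n) x).target := by
  rw [extChartAt_target]
  exact ((chartAt _ x).open_target.preimage (𝓡∂ n).continuous_symm).measurableSet.inter
    (𝓡∂ n).isClosed_range.measurableSet

/-- Passing to the compact support of the weight makes continuous integrands integrable and brings
the parametric integral results into play. -/
theorem setIntegral_target_eq (x : S) (g : EuclideanSpace ℝ (Fin n) → ℝ) :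
    ∫ y in (extChartAt (𝓡∂ n) x).target, chartWeight x y * g y =
      ∫ y in chartSupport n x, chartWeight x y * g y :=
  setIntegral_eq_of_subset_of_forall_sdiff_eq_zero (measurableSet_target x)
    (chartSupport_subset x) fun y hy => by rw [chartWeight_eq_zero hy.1 hy.2, zero_mul]

theorem finite_chartIndices (n : ℕ) [NeZero n] (S : Type*) [TopologicalSpace S]
    [ChartedSpace (EuclideanHalfSpace n) S] [IsManifold (𝓡∂ n) ∞ S] [T2Space S]
    [CompactSpace S] :
    {x : S | (Function.support (chartPartition (n := n) S x)).Nonempty}.Finite :=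
  (chartPartition (n := n) S).locallyFinite.finite_nonempty_of_compact

/-- The charts which contribute to the area integral. -/
def chartIndices (n : ℕ) [NeZero n] (S : Type*) [TopologicalSpace S]
    [ChartedSpace (EuclideanHalfSpace n) S] [IsManifold (𝓡∂ n) ∞ S] [T2Space S]
    [CompactSpace S] : Finset S :=
  (finite_chartIndices n S).toFinset

theorem mem_chartIndices {x p : S} (h : chartPartition (n := n) S x p ≠ 0) :
    x ∈ chartIndices n S :=
  (finite_chartIndices n S).mem_toFinset.2 ⟨p, h⟩

theorem sum_chartPartition (p : S) :
    ∑ x ∈ chartIndices n S, chartPartition (n := n) S x p = 1 := by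
  rw [← (chartPartition (n := n) S).sum_eq_one (mem_univ p)]
  refine (finsum_eq_sum_of_support_subset _ fun x hx => ?_).symm
  exact mem_chartIndices hx

/-- A condition checked on finitely many compact chart supports thereby holds at every point of the
manifold. -/
theorem exists_mem_chartSupport (p : S) : ∃ x ∈ chartIndices n S, ∃ y ∈ chartSupport n x,
    (extChartAt (𝓡∂ n) x).symm y = p ∧ 0 < chartWeight x y := by
  obtain ⟨x, hx⟩ := (chartPartition (n := n) S).exists_pos_of_mem (mem_univ p)
  have hp : p ∈ tsupport (chartPartition (n := n) S x) := subset_tsupport _ hx.ne'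
  have h := (extChartAt (𝓡∂ n) x).left_inv (tsupport_chartPartition_subset x hp)
  refine ⟨x, mem_chartIndices hx.ne', _, ⟨p, hp, rfl⟩, h, ?_⟩
  rw [chartWeight, h]; exact hx

theorem areaIntegral_eq (φ : S → E n) (h : S → ℝ) :
    areaIntegral φ h = ∑ x ∈ chartIndices n S, ∫ y in chartSupport n x,
      chartWeight x y * areaDensity φ x y * h ((extChartAt (𝓡∂ n) x).symm y) := by
  rw [areaIntegral, finsum_eq_sum_of_support_subset (s := chartIndices n S)]
  · refine Finset.sum_congr rfl fun x _ => ?_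
    have := setIntegral_target_eq x fun y => h ((extChartAt (𝓡∂ n) x).symm y) * areaDensity φ x y
    simp only [← mul_assoc] at this
    simp only [chartWeight] at this ⊢
    rw [this]
    exact integral_congr_ae (Filter.Eventually.of_forall fun y => by ring)
  · intro x hx
    by_contra h0
    refine hx ?_
    have : ∀ p, chartPartition (n := n) S x p = 0 := fun p => by
      by_contra h1; exact h0 (mem_chartIndices h1)
    simp [this]

/-- The area density is part of the comparison, so the two immersions may differ: integrals over a
deformed hypersurface are pulled back to the original one. -/
theorem areaIntegral_congr {φ φ' : S → E n} {h h' : S → ℝ}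
    (H : ∀ x : S, ∀ y ∈ (extChartAt (𝓡∂ n) x).target,
      areaDensity φ x y * h ((extChartAt (𝓡∂ n) x).symm y) =
        areaDensity φ' x y * h' ((extChartAt (𝓡∂ n) x).symm y)) :
    areaIntegral φ h = areaIntegral φ' h' := by
  rw [areaIntegral_eq, areaIntegral_eq]
  refine Finset.sum_congr rfl fun x _ =>
    setIntegral_congr_fun (isCompact_chartSupport x).measurableSet fun y hy => ?_
  simp only [mul_assoc, H x y (chartSupport_subset x hy)]

theorem continuousOn_comp_chart {Z : Type*} [TopologicalSpace Z] {u : S → Z} (hu : Continuous u)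
    (x : S) :
    ContinuousOn (fun y => u ((extChartAt (𝓡∂ n) x).symm y)) (extChartAt (𝓡∂ n) x).target :=
  hu.comp_continuousOn (continuousOn_extChartAt_symm x)

variable {ι : S → E n}

theorem continuousOn_weight_mul_areaDensity (hι : IsSmoothImmersion ι) (x : S) :
    ContinuousOn (fun y => chartWeight x y * areaDensity ι x y) (chartSupport n x) :=
  ((continuousOn_chartWeight x).mul (contDiffOn_areaDensity hι x).continuousOn).mono
    (chartSupport_subset x)

theorem integrableOn_chartSupport (hι : IsSmoothImmersion ι) {u : S → ℝ} (hu : Continuous u)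
    (x : S) : IntegrableOn (fun y => chartWeight x y * areaDensity ι x y *
      u ((extChartAt (𝓡∂ n) x).symm y)) (chartSupport n x) :=
  ((continuousOn_weight_mul_areaDensity hι x).mul
    ((continuousOn_comp_chart hu x).mono (chartSupport_subset x))).integrableOn_compact
      (isCompact_chartSupport x)

theorem areaIntegral_add (hι : IsSmoothImmersion ι) {u v : S → ℝ} (hu : Continuous u)
    (hv : Continuous v) :
    areaIntegral ι (fun p => u p + v p) = areaIntegral ι u + areaIntegral ι v := by
  simp only [areaIntegral_eq, ← Finset.sum_add_distrib]
  refine Finset.sum_congr rfl fun x _ => ?_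
  rw [← integral_add (integrableOn_chartSupport hι hu x) (integrableOn_chartSupport hι hv x)]
  simp only [mul_add]

theorem areaIntegral_const_mul (c : ℝ) (u : S → ℝ) :
    areaIntegral ι (fun p => c * u p) = c * areaIntegral ι u := by
  simp only [areaIntegral_eq, Finset.mul_sum, ← integral_const_mul]
  refine Finset.sum_congr rfl fun x _ => integral_congr_ae (Filter.Eventually.of_forall fun y => ?_)
  simp only; ring

theorem hasDerivAt_areaIntegral (hι : IsSmoothImmersion ι) {a : S → V} (ha : Continuous a)
    {O : Set (ℝ × V)} (hO : IsOpen O) {Ψ : ℝ × V → ℝ} (hΨ : ContDiffOn ℝ 1 Ψ O) {ε : ℝ}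
    (hε : 0 < ε) (hmem : ∀ t ∈ Ioo (-ε) ε, ∀ p, (t, a p) ∈ O) {u' : S → ℝ}
    (hu' : ∀ p, HasDerivAt (fun t => Ψ (t, a p)) (u' p) 0) :
    HasDerivAt (fun t => areaIntegral ι fun p => Ψ (t, a p)) (areaIntegral ι u') 0 := by
  have hu : ∀ p, fderiv ℝ Ψ (0, a p) (1, 0) = u' p := fun p => by
    have hd : HasFDerivAt Ψ (fderiv ℝ Ψ (0, a p)) (0, a p) :=
      ((hΨ.differentiableOn one_ne_zero).differentiableAt
        (hO.mem_nhds (hmem 0 ⟨by linarith, hε⟩ p))).hasFDerivAt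
    have hl : HasDerivAt (fun s : ℝ => (s, a p)) ((1 : ℝ), (0 : V)) 0 :=
      (hasDerivAt_id (0 : ℝ)).prodMk (hasDerivAt_const (0 : ℝ) (a p))
    exact (hd.comp_hasDerivAt (0 : ℝ) hl).unique (hu' p)
  simp only [areaIntegral_eq]
  refine HasDerivAt.fun_sum fun x _ => ?_
  have := hasDerivAt_integral_comp (μ := volume) (isCompact_chartSupport x)
    (continuousOn_weight_mul_areaDensity hι x)
    ((continuousOn_comp_chart ha x).mono (chartSupport_subset x)) hO hΨ
    (fun t ht y _ => hmem t ht _) (t₀ := 0) ⟨by linarith, hε⟩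
  simpa only [hu] using this

/-- A point of the chart domain is a limit of points in the interior of the half space. -/
theorem mem_closure_target_inter_interior {x : S} {y : EuclideanSpace ℝ (Fin n)}
    (hy : y ∈ (extChartAt (𝓡∂ n) x).target) :
    y ∈ closure ((extChartAt (𝓡∂ n) x).target ∩ interior (range (𝓡∂ n))) := by
  have h1 : y ∈ closure (interior (range (𝓡∂ n))) :=
    (𝓡∂ n).range_subset_closure_interior (extChartAt_target_subset_range x hy)
  rw [mem_closure_iff_nhdsWithin_neBot] at h1 ⊢
  have h2 : 𝓝[(extChartAt (𝓡∂ n) x).target ∩ interior (range (𝓡∂ n))] y =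
      𝓝[interior (range (𝓡∂ n))] y := by
    rw [inter_comm, nhdsWithin_inter, nhdsWithin_target_eq hy, ← nhdsWithin_inter,
      inter_eq_left.2 interior_subset]
  rwa [h2]

theorem isOpen_target_inter_interior (x : S) :
    IsOpen ((extChartAt (𝓡∂ n) x).target ∩ interior (range (𝓡∂ n))) := by
  rw [extChartAt_target, inter_assoc, inter_eq_right.2 interior_subset]
  exact ((chartAt _ x).open_target.preimage (𝓡∂ n).continuous_symm).inter isOpen_interior

/-- A point of positive weight may lie on the edge of the half-space; a nearby interior point still
has positive weight and supplies an open set of positive measure. -/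
theorem areaIntegral_pos [Nonempty S] (hι : IsSmoothImmersion ι) {u : S → ℝ} (hu : Continuous u)
    (hpos : ∀ p, 0 < u p) : 0 < areaIntegral ι u := by
  obtain ⟨p⟩ := ‹Nonempty S›
  obtain ⟨x, hx, y, hy, -, hw⟩ := exists_mem_chartSupport (n := n) p
  rw [areaIntegral_eq]
  have hnn : ∀ x : S, ∀ y ∈ chartSupport n x, 0 ≤ chartWeight x y * areaDensity ι x y *
      u ((extChartAt (𝓡∂ n) x).symm y) := fun x y hy =>
    mul_nonneg (mul_nonneg (chartWeight_nonneg x y)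
      (areaDensity_pos hι (chartSupport_subset x hy)).le) (hpos _).le
  refine Finset.sum_pos' (fun x _ => setIntegral_nonneg
    (isCompact_chartSupport x).measurableSet (hnn x)) ⟨x, hx, ?_⟩
  rw [setIntegral_pos_iff_support_of_nonneg_ae
    (by filter_upwards [ae_restrict_mem (isCompact_chartSupport x).measurableSet] with y hy
          using hnn x y hy) (integrableOn_chartSupport hι hu x)]
  -- the integrand is positive on a nonempty open set
  have hyt := chartSupport_subset x hy
  have hcl := mem_closure_target_inter_interior hyt
  have hev : ∀ᶠ z in 𝓝[(extChartAt (𝓡∂ n) x).target ∩ interior (range (𝓡∂ n))] y,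
      0 < chartWeight x z :=
    ((continuousOn_chartWeight x y hyt).mono inter_subset_left).eventually (lt_mem_nhds hw)
  have := mem_closure_iff_nhdsWithin_neBot.1 hcl
  obtain ⟨z, hz, hzT⟩ := (hev.and self_mem_nhdsWithin).exists
  have hcont : ContinuousOn (chartWeight x)
      ((extChartAt (𝓡∂ n) x).target ∩ interior (range (𝓡∂ n))) :=
    (continuousOn_chartWeight x).mono inter_subset_left
  have hopen := hcont.isOpen_inter_preimage (isOpen_target_inter_interior x)
    (isOpen_Ioi (a := (0 : ℝ)))
  refine (hopen.measure_pos volume ⟨z, hzT, hz⟩).trans_le (measure_mono fun q hq => ?_)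
  have hqt : q ∈ (extChartAt (𝓡∂ n) x).target := hq.1.1
  have hq0 : 0 < chartWeight x q := hq.2
  refine ⟨(mul_pos (mul_pos hq0 (areaDensity_pos hι hqt)) (hpos _)).ne', ?_⟩
  by_contra h
  exact hq0.ne' (chartWeight_eq_zero hqt h)

/-! ### Change of charts -/

/-- By the chain rule for the transition map the densities differ by exactly its Jacobian, the
factor in the change of variables formula. -/
theorem areaDensity_change (hι : IsSmoothImmersion ι) (x x₀ : S) {y : EuclideanSpace ℝ (Fin n)}
    (hy : y ∈ (extChartAt (𝓡∂ n) x).target)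
    (hy₀ : (extChartAt (𝓡∂ n) x).symm y ∈ (extChartAt (𝓡∂ n) x₀).source) :
    areaDensity ι x y =
      |(fderivWithin ℝ (extChartAt (𝓡∂ n) x₀ ∘ (extChartAt (𝓡∂ n) x).symm) (range (𝓡∂ n)) y).det| *
        areaDensity ι x₀ (extChartAt (𝓡∂ n) x₀ ((extChartAt (𝓡∂ n) x).symm y)) ∧
    HasFDerivWithinAt (extChartAt (𝓡∂ n) x₀ ∘ (extChartAt (𝓡∂ n) x).symm)
      (fderivWithin ℝ (extChartAt (𝓡∂ n) x₀ ∘ (extChartAt (𝓡∂ n) x).symm) (range (𝓡∂ n)) y)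
      (range (𝓡∂ n)) y := by
  set τ := extChartAt (𝓡∂ n) x₀ ∘ (extChartAt (𝓡∂ n) x).symm with hτ
  have h1 : HasFDerivWithinAt τ (fderivWithin ℝ τ (range (𝓡∂ n)) y) (range (𝓡∂ n)) y := by
    refine ((contDiffWithinAt_ext_coord_change (I := 𝓡∂ n) (n := ∞) x₀ x
      (y := y) ?_).differentiableWithinAt (by simp)).hasFDerivWithinAt
    exact ⟨hy, hy₀⟩
  refine ⟨?_, h1⟩
  have hτy : τ y ∈ (extChartAt (𝓡∂ n) x₀).target := (extChartAt (𝓡∂ n) x₀).map_source hy₀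
  have h2 := hasFDerivWithinAt_chart hι.smooth hτy
  have hmaps : MapsTo τ ((extChartAt (𝓡∂ n) x).symm ⁻¹' (extChartAt (𝓡∂ n) x₀).source)
      (range (𝓡∂ n)) := fun z hz =>
    extChartAt_target_subset_range x₀ ((extChartAt (𝓡∂ n) x₀).map_source hz)
  have hnhds : (extChartAt (𝓡∂ n) x).symm ⁻¹' (extChartAt (𝓡∂ n) x₀).source ∈
      𝓝[range (𝓡∂ n)] y := by
    rw [← nhdsWithin_target_eq hy]
    exact (continuousOn_extChartAt_symm x y hy).preimage_mem_nhdsWithin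
      ((isOpen_extChartAt_source x₀).mem_nhds hy₀)
  have h3 := h2.comp y (h1.mono inter_subset_left)
    (s := range (𝓡∂ n) ∩ (extChartAt (𝓡∂ n) x).symm ⁻¹' (extChartAt (𝓡∂ n) x₀).source)
    (fun z hz => hmaps hz.2)
  have h4 : HasFDerivWithinAt (ι ∘ (extChartAt (𝓡∂ n) x).symm)
      ((chartDeriv ι x₀ (τ y)).comp (fderivWithin ℝ τ (range (𝓡∂ n)) y)) (range (𝓡∂ n)) y := by
    rw [hasFDerivWithinAt_inter' hnhds] at h3
    refine h3.congr_of_eventuallyEq ?_ ?_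
    · filter_upwards [hnhds] with z hz
      simp only [Function.comp_apply, hτ]
      rw [(extChartAt (𝓡∂ n) x₀).left_inv hz]
    · simp only [Function.comp_apply, hτ]
      rw [(extChartAt (𝓡∂ n) x₀).left_inv hy₀]
  have h5 : chartDeriv ι x y = (chartDeriv ι x₀ (τ y)).comp (fderivWithin ℝ τ (range (𝓡∂ n)) y) :=
    h4.fderivWithin (uniqueDiffWithinAt_range hy)
  have := sqrt_det_gram_comp (chartDeriv ι x₀ (τ y)) (fderivWithin ℝ τ (range (𝓡∂ n)) y)
  rw [areaDensity_eq, areaDensity_eq]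
  have e : chartFrame ι x y = fun i => chartDeriv ι x₀ (τ y) (fderivWithin ℝ τ (range (𝓡∂ n)) y
      (EuclideanSpace.single i 1)) := by
    ext1 i; rw [chartFrame, h5]; rfl
  rw [e]
  exact this

/-- The integral of a function supported in a single chart. -/
theorem areaIntegral_eq_of_tsupport (hι : IsSmoothImmersion ι) {u : S → ℝ} (hu : Continuous u)
    (x₀ : S) (hsupp : tsupport u ⊆ (extChartAt (𝓡∂ n) x₀).source) :
    areaIntegral ι u = ∫ y in (extChartAt (𝓡∂ n) x₀).target,
      u ((extChartAt (𝓡∂ n) x₀).symm y) * areaDensity ι x₀ y := by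
  set K := extChartAt (𝓡∂ n) x₀ '' tsupport u with hK
  have hKc : IsCompact K := (isClosed_tsupport _).isCompact.image_of_continuousOn
    ((continuousOn_extChartAt x₀).mono hsupp)
  have hKt : K ⊆ (extChartAt (𝓡∂ n) x₀).target := by
    rintro _ ⟨p, hp, rfl⟩
    exact (extChartAt (𝓡∂ n) x₀).map_source (hsupp hp)
  have hK0 : ∀ y ∈ (extChartAt (𝓡∂ n) x₀).target, y ∉ K →
      u ((extChartAt (𝓡∂ n) x₀).symm y) = 0 := by
    intro y hy hyK
    by_contra h0
    exact hyK ⟨_, subset_tsupport _ h0, (extChartAt (𝓡∂ n) x₀).right_inv hy⟩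
  -- each partition piece, transported to the chart at `x₀`
  have key : ∀ x : S, ∫ y in chartSupport n x,
      chartWeight x y * areaDensity ι x y * u ((extChartAt (𝓡∂ n) x).symm y) =
      ∫ y in K, chartPartition (n := n) S x ((extChartAt (𝓡∂ n) x₀).symm y) *
        (u ((extChartAt (𝓡∂ n) x₀).symm y) * areaDensity ι x₀ y) := by
    intro x
    set s : Set (EuclideanSpace ℝ (Fin n)) :=
      (extChartAt (𝓡∂ n) x).symm ⁻¹' (extChartAt (𝓡∂ n) x₀).source ∩
        (extChartAt (𝓡∂ n) x).target with hs
    set τ := extChartAt (𝓡∂ n) x₀ ∘ (extChartAt (𝓡∂ n) x).symm with hτ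
    have hmeas : ∀ x x₀ : S, MeasurableSet ((extChartAt (𝓡∂ n) x).symm ⁻¹'
        (extChartAt (𝓡∂ n) x₀).source ∩ (extChartAt (𝓡∂ n) x).target) := by
      intro x x₀
      obtain ⟨w, hw, hw2⟩ := continuousOn_iff'.1 (continuousOn_extChartAt_symm (I := 𝓡∂ n) x)
        _ (isOpen_extChartAt_source (I := 𝓡∂ n) x₀)
      rw [hw2]
      exact hw.measurableSet.inter (measurableSet_target x)
    have himg : τ '' s = (extChartAt (𝓡∂ n) x₀).symm ⁻¹' (extChartAt (𝓡∂ n) x).source ∩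
        (extChartAt (𝓡∂ n) x₀).target := by
      ext z
      constructor
      · rintro ⟨y, hy, rfl⟩
        refine ⟨?_, (extChartAt (𝓡∂ n) x₀).map_source hy.1⟩
        simp only [mem_preimage, hτ, Function.comp_apply]
        rw [(extChartAt (𝓡∂ n) x₀).left_inv hy.1]
        exact (extChartAt (𝓡∂ n) x).map_target hy.2
      · intro hz
        refine ⟨extChartAt (𝓡∂ n) x ((extChartAt (𝓡∂ n) x₀).symm z), ⟨?_, ?_⟩, ?_⟩
        · simp only [mem_preimage]
          rw [(extChartAt (𝓡∂ n) x).left_inv hz.1]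
          exact (extChartAt (𝓡∂ n) x₀).map_target hz.2
        · exact (extChartAt (𝓡∂ n) x).map_source hz.1
        · simp only [hτ, Function.comp_apply]
          rw [(extChartAt (𝓡∂ n) x).left_inv hz.1, (extChartAt (𝓡∂ n) x₀).right_inv hz.2]
    have hinj : InjOn τ s := by
      intro y hy z hz h
      have h1 := (extChartAt (𝓡∂ n) x₀).injOn hy.1 hz.1 h
      exact (extChartAt (𝓡∂ n) x).symm.injOn hy.2 hz.2 h1
    have hcv := integral_image_eq_integral_abs_det_fderiv_smul volume (hmeas x x₀)
      (fun y hy => ((areaDensity_change hι x x₀ hy.2 hy.1).2.mono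
        (inter_subset_right.trans (extChartAt_target_subset_range x)))) hinj
      (fun y => chartPartition (n := n) S x ((extChartAt (𝓡∂ n) x₀).symm y) *
        (u ((extChartAt (𝓡∂ n) x₀).symm y) * areaDensity ι x₀ y))
    have e1 : ∫ y in chartSupport n x,
        chartWeight x y * areaDensity ι x y * u ((extChartAt (𝓡∂ n) x).symm y) =
        ∫ y in s, chartWeight x y * areaDensity ι x y * u ((extChartAt (𝓡∂ n) x).symm y) := by
      simp only [mul_assoc]
      rw [← setIntegral_target_eq x fun y => areaDensity ι x y * u ((extChartAt (𝓡∂ n) x).symm y)]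
      refine setIntegral_eq_of_subset_of_forall_sdiff_eq_zero (measurableSet_target x)
        inter_subset_right fun y hy => ?_
      have : u ((extChartAt (𝓡∂ n) x).symm y) = 0 := by
        by_contra h0
        exact hy.2 ⟨hsupp (subset_tsupport _ h0), hy.1⟩
      rw [this]; simp
    have e2 : ∫ y in K, chartPartition (n := n) S x ((extChartAt (𝓡∂ n) x₀).symm y) *
        (u ((extChartAt (𝓡∂ n) x₀).symm y) * areaDensity ι x₀ y) =
        ∫ y in τ '' s, chartPartition (n := n) S x ((extChartAt (𝓡∂ n) x₀).symm y) *
        (u ((extChartAt (𝓡∂ n) x₀).symm y) * areaDensity ι x₀ y) := by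
      rw [himg, ← setIntegral_eq_of_subset_of_forall_sdiff_eq_zero (measurableSet_target x₀) hKt
        fun y hy => by rw [hK0 y hy.1 hy.2]; ring]
      refine setIntegral_eq_of_subset_of_forall_sdiff_eq_zero (measurableSet_target x₀)
        inter_subset_right fun y hy => ?_
      have : chartPartition (n := n) S x ((extChartAt (𝓡∂ n) x₀).symm y) = 0 := by
        by_contra h0
        exact hy.2 ⟨tsupport_chartPartition_subset x (subset_tsupport _ h0), hy.1⟩
      rw [this, zero_mul]
    rw [e1, e2, hcv]
    refine setIntegral_congr_fun (hmeas x x₀) fun y hy => ?_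
    simp only [Function.comp_apply, smul_eq_mul, chartWeight]
    rw [(extChartAt (𝓡∂ n) x₀).left_inv hy.1, (areaDensity_change hι x x₀ hy.2 hy.1).1]
    ring
  have hcontK : ContinuousOn (fun y => u ((extChartAt (𝓡∂ n) x₀).symm y) * areaDensity ι x₀ y) K :=
    ((continuousOn_comp_chart hu x₀).mul (contDiffOn_areaDensity hι x₀).continuousOn).mono hKt
  -- All pieces now live in the chart at x₀, where the partition functions add up to 1.
  rw [areaIntegral_eq, Finset.sum_congr rfl fun x _ => key x, ← integral_finsetSum]
  · rw [setIntegral_eq_of_subset_of_forall_sdiff_eq_zero (measurableSet_target x₀) hKt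
        fun y hy => by rw [hK0 y hy.1 hy.2]; ring]
    refine setIntegral_congr_fun hKc.measurableSet fun y hy => ?_
    simp only [← Finset.sum_mul, sum_chartPartition, one_mul]
  · intro x _
    exact ((((chartPartition (n := n) S x).contMDiff.continuous.comp_continuousOn
      (continuousOn_extChartAt_symm x₀)).mono hKt).mul hcontK).integrableOn_compact hKc

end AreaIntegral

/-! ### Dilations of a solid cone. -/

section Cone
variable {n : ℕ} {M : Set (E n)}

theorem IsSolidCone.smul_mem (hM : IsSolidCone M) {p : E n} (hp : p ∈ M) {t : ℝ} (ht : 0 < t) :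
    t • p ∈ M := by
  obtain ⟨D, -, rfl⟩ := hM
  obtain ⟨s, hs, d, hd, rfl⟩ := hp
  exact ⟨t * s, by positivity, d, hd, smul_smul _ _ _⟩

theorem IsSolidCone.image_smul (hM : IsSolidCone M) {t : ℝ} (ht : 0 < t) :
    (fun p : E n => t • p) '' M = M := by
  ext p
  constructor
  · rintro ⟨q, hq, rfl⟩
    exact hM.smul_mem hq ht
  · intro hp
    exact ⟨t⁻¹ • p, hM.smul_mem hp (inv_pos.2 ht), smul_inv_smul₀ ht.ne' p⟩

/-- A dilation is a homeomorphism of the ambient space carrying M onto itself, hence its frontier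
onto itself. This gives radial variations their boundary condition. -/
theorem IsSolidCone.smul_mem_frontier (hM : IsSolidCone M) {p : E n} (hp : p ∈ frontier M) {t : ℝ}
    (ht : 0 < t) : t • p ∈ frontier M := by
  have h := (Homeomorph.smulOfNeZero (α := E n) t ht.ne').image_frontier M
  have h2 : (Homeomorph.smulOfNeZero (α := E n) t ht.ne' : E n → E n) = fun p => t • p := rfl
  rw [h2, hM.image_smul ht] at h
  rw [← h]
  exact ⟨p, hp, rfl⟩

end Cone

/-! ### Rank-one perturbations of a frame. -/

section LinearAlgebra
variable {n : ℕ}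

/-- The map u ↦ u + ⟨Z,u⟩X is injective: pairing u + ⟨Z,u⟩X = 0 with Z gives ⟨Z,u⟩(1 + ⟨Z,X⟩) = 0,
and then u = 0. -/
theorem linearIndependent_add_smul {X Z : E n} {v : Fin n → E n} (hv : LinearIndependent ℝ v)
    (hb : 1 + inner ℝ Z X ≠ 0) : LinearIndependent ℝ fun i => v i + inner ℝ Z (v i) • X := by
  rw [Fintype.linearIndependent_iff] at hv ⊢
  intro a ha
  refine hv a ?_
  have h1 : (∑ i, a i • v i) + inner ℝ Z (∑ i, a i • v i) • X = 0 := by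
    rw [← ha, inner_sum, Finset.sum_smul, ← Finset.sum_add_distrib]
    refine Finset.sum_congr rfl fun i _ => ?_
    rw [inner_smul_right, smul_add, smul_smul]
  have h2 : inner ℝ Z (∑ i, a i • v i) * (1 + inner ℝ Z X) = 0 := by
    have := congrArg (fun w => inner ℝ Z w) h1
    simp only [inner_add_right, inner_smul_right, inner_zero_right] at this
    linear_combination this
  have h3 := (mul_eq_zero.1 h2).resolve_right hb
  rwa [h3, zero_smul, add_zero] at h1

end LinearAlgebra

/-! ### Radial variations and the integrated stationarity condition. -/

section Radial

variable {n : ℕ} [NeZero n] {S : Type*} [TopologicalSpace S]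
  [ChartedSpace (EuclideanHalfSpace n) S] [IsManifold (𝓡∂ n) ∞ S]

/-- `Z` is the gradient, tangent to the hypersurface `(ι, N)`, of the smooth function `h`. -/
structure IsGradient (ι N : S → E n) (h : S → ℝ) (Z : S → E n) : Prop where
  smooth : ContMDiff (𝓡∂ n) 𝓘(ℝ, ℝ) ∞ h
  continuous : Continuous Z
  inner_normal : ∀ p, inner ℝ (Z p) (N p) = 0
  inner_diff : ∀ p v, inner ℝ (Z p) (diff ι p v) =
    (mfderiv (𝓡∂ n) 𝓘(ℝ, ℝ) h p : EuclideanSpace ℝ (Fin n) →L[ℝ] ℝ) v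

variable {ι N : S → E n} {h : S → ℝ} {Z : S → E n}

theorem IsGradient.sub_const (hZ : IsGradient ι N h Z) (c : ℝ) :
    IsGradient ι N (fun p => h p - c) Z where
  smooth := hZ.smooth.sub contMDiff_const
  continuous := hZ.continuous
  inner_normal := hZ.inner_normal
  inner_diff p v := by
    rw [hZ.inner_diff]
    have h1 : MDifferentiableAt (𝓡∂ n) 𝓘(ℝ, ℝ) h p := hZ.smooth.mdifferentiableAt (by simp)
    have h2 := (h1.hasMFDerivAt.sub (hasMFDerivAt_const c p)).mfderiv
    have h3 : (h - fun _ => c) = fun p => h p - c := rfl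
    rw [h3] at h2
    exact (congrArg (fun L : EuclideanSpace ℝ (Fin n) →L[ℝ] ℝ => L v) (h2.trans (sub_zero _))).symm

theorem isGradient_const (c : ℝ) : IsGradient ι N (fun _ : S => c) fun _ => 0 where
  smooth := contMDiff_const
  continuous := continuous_const
  inner_normal p := inner_zero_left _
  inner_diff p v := by rw [mfderiv_const, inner_zero_left]; rfl

/-- The factor of the radial variation `p ↦ (1 + t h(p)) ^ (1 / q) ι(p)`. -/
def radialFactor (q : ℝ) (h : S → ℝ) (t : ℝ) (p : S) : ℝ := (1 + t * h p) ^ (1 / q)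

theorem radialFactor_pos {q t : ℝ} {p : S} (ht : 0 < 1 + t * h p) : 0 < radialFactor q h t p :=
  Real.rpow_pos_of_pos ht _

/-- The radial variation. -/
def radialMap (q : ℝ) (ι : S → E n) (h : S → ℝ) (t : ℝ) (p : S) : E n :=
  radialFactor q h t p • ι p

theorem IsGradient.chartDeriv_eq_inner (hZ : IsGradient ι N h Z)
    (hι : ContMDiff (𝓡∂ n) 𝓘(ℝ, E n) ∞ ι) {x : S} {y : EuclideanSpace ℝ (Fin n)}
    (hy : y ∈ (extChartAt (𝓡∂ n) x).target) (v : EuclideanSpace ℝ (Fin n)) :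
    chartDeriv h x y v = inner ℝ (Z ((extChartAt (𝓡∂ n) x).symm y)) (chartDeriv ι x y v) := by
  rw [chartDeriv_eq hZ.smooth hy, chartDeriv_eq hι hy, ← hZ.inner_diff]
  rfl

/-- The logarithmic derivative of the factor is (t/q)/(1+th) times dh, and dh is the product with Z.
The differential is thus a dilation of the rank-one perturbation treated by `det_gram_add_smul`. -/
theorem chartDeriv_radialMap {q : ℝ} (hZ : IsGradient ι N h Z)
    (hι : ContMDiff (𝓡∂ n) 𝓘(ℝ, E n) ∞ ι) {t : ℝ} {x : S} {y : EuclideanSpace ℝ (Fin n)}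
    (hy : y ∈ (extChartAt (𝓡∂ n) x).target)
    (ht : 0 < 1 + t * h ((extChartAt (𝓡∂ n) x).symm y)) (v : EuclideanSpace ℝ (Fin n)) :
    chartDeriv (radialMap q ι h t) x y v =
      radialFactor q h t ((extChartAt (𝓡∂ n) x).symm y) • (chartDeriv ι x y v +
        inner ℝ ((t / q / (1 + t * h ((extChartAt (𝓡∂ n) x).symm y))) •
          Z ((extChartAt (𝓡∂ n) x).symm y)) (chartDeriv ι x y v) •
            ι ((extChartAt (𝓡∂ n) x).symm y)) := by
  set p := (extChartAt (𝓡∂ n) x).symm y with hp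
  have h1 := hasFDerivWithinAt_chart hι hy
  have h2 := hasFDerivWithinAt_chart hZ.smooth hy
  have h3 : HasFDerivWithinAt (fun z => (1 + t * (h ∘ (extChartAt (𝓡∂ n) x).symm) z) ^ (1 / q))
      _ (range (𝓡∂ n)) y :=
    ((h2.const_mul t).const_add 1).rpow_const (p := 1 / q) (Or.inl ht.ne')
  have h4 := (h3.smul h1).fderivWithin (uniqueDiffWithinAt_range hy)
  have h5 : chartDeriv (radialMap q ι h t) x y = _ := h4
  rw [h5, inner_smul_left, ← hZ.chartDeriv_eq_inner hι hy]
  simp only [_root_.add_apply, _root_.smul_apply,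
    ContinuousLinearMap.smulRight_apply, Function.comp_apply, ← hp, smul_add, smul_smul,
    radialFactor, smul_eq_mul, conj_trivial]
  congr 2
  rw [Real.rpow_sub ht, Real.rpow_one]
  ring

/-- The factor, up to powers of `1 + t h`, by which the radial variation changes the area. -/
def radialJacobian (q t h b e : ℝ) : ℝ := (1 + t * h + t / q * b) ^ 2 + (t / q) ^ 2 * e

theorem areaDensity_radialMap {q : ℝ} (hι : IsSmoothImmersion ι) (hN : IsUnitNormal ι N)
    (hZ : IsGradient ι N h Z)
    {t : ℝ} {x : S} {y : EuclideanSpace ℝ (Fin n)} (hy : y ∈ (extChartAt (𝓡∂ n) x).target) {p : S}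
    (hp : (extChartAt (𝓡∂ n) x).symm y = p)
    (ht : 0 < 1 + t * h p) (ht' : 0 < 1 + t * h p + t / q * inner ℝ (Z p) (ι p)) :
    LinearIndependent ℝ (chartFrame (radialMap q ι h t) x y) ∧
    areaDensity (radialMap q ι h t) x y =
      radialFactor q h t p ^ n * (√(radialJacobian q t (h p) (inner ℝ (Z p) (ι p))
        (inner ℝ (ι p) (N p) ^ 2 * ‖Z p‖ ^ 2)) / (1 + t * h p)) * areaDensity ι x y := by
  set β := t / q / (1 + t * h p) with hβ
  have hv := linearIndependent_chartFrame hι hy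
  have hN0 : ∀ i, inner ℝ (N p) (chartFrame ι x y i) = 0 := fun i => by
    rw [chartFrame_eq hι.smooth hy, hp]; exact (hN p).2 _
  have hb : 1 + inner ℝ (β • Z p) (ι p) =
      (1 + t * h p + t / q * inner ℝ (Z p) (ι p)) / (1 + t * h p) := by
    rw [inner_smul_left, hβ]; simp only [conj_trivial]; field_simp
  have hb0 : 0 < 1 + inner ℝ (β • Z p) (ι p) := by rw [hb]; positivity
  have hw := linearIndependent_add_smul hv hb0.ne'
  have hZN : inner ℝ (β • Z p) (N p) = 0 := by rw [inner_smul_left, hZ.inner_normal, mul_zero]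
  have hdet := det_gram_add_smul (hN p).1 hN0 hv hZN hb0 hw
  have hl : 0 < radialFactor q h t p := radialFactor_pos ht
  have hfr : chartFrame (radialMap q ι h t) x y = fun i => radialFactor q h t p •
      (chartFrame ι x y i + inner ℝ (β • Z p) (chartFrame ι x y i) • ι p) := by
    ext1 i
    have := chartDeriv_radialMap (q := q) hZ hι.smooth hy (by rw [hp]; exact ht)
      (EuclideanSpace.single i 1)
    rw [hp] at this
    exact this
  refine ⟨?_, ?_⟩
  · rw [hfr]
    exact hw.units_smul fun _ => Units.mk0 _ hl.ne'
  · rw [areaDensity_eq, hfr, sqrt_det_gram_smul, hdet, Real.sqrt_mul (by positivity), abs_of_pos hl,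
      mul_assoc, areaDensity_eq]
    congr 2
    rw [hb, norm_smul, radialJacobian, eq_div_iff ht.ne', ← Real.sqrt_sq ht.le,
      ← Real.sqrt_mul (by positivity), Real.sqrt_sq ht.le]
    congr 1
    rw [mul_pow, Real.norm_eq_abs, sq_abs, hβ]
    field_simp

/-- The unit normal of the radial variation. -/
def radialNormal (q : ℝ) (ι N : S → E n) (h : S → ℝ) (Z : S → E n) (t : ℝ) (p : S) : E n :=
  (√(radialJacobian q t (h p) (inner ℝ (Z p) (ι p)) (inner ℝ (ι p) (N p) ^ 2 * ‖Z p‖ ^ 2)))⁻¹ •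
    ((1 + t * h p + t / q * inner ℝ (Z p) (ι p)) • N p - (t / q * inner ℝ (ι p) (N p)) • Z p)

theorem radialJacobian_pos {q t h b e : ℝ} (h1 : 0 < 1 + t * h + t / q * b) (he : 0 ≤ e) :
    0 < radialJacobian q t h b e := by unfold radialJacobian; positivity

theorem norm_radialNormal {q : ℝ} (hN : IsUnitNormal ι N) (hZ : IsGradient ι N h Z) {t : ℝ} {p : S}
    (ht' : 0 < 1 + t * h p + t / q * inner ℝ (Z p) (ι p)) :
    ‖radialNormal q ι N h Z t p‖ = 1 := by
  have hR := radialJacobian_pos ht' (show 0 ≤ inner ℝ (ι p) (N p) ^ 2 * ‖Z p‖ ^ 2 by positivity)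
  rw [radialNormal, norm_smul, norm_inv, Real.norm_of_nonneg (Real.sqrt_nonneg _)]
  rw [inv_mul_eq_one₀ (Real.sqrt_pos.2 hR).ne', Real.sqrt_eq_iff_mul_self_eq hR.le (norm_nonneg _),
    ← real_inner_self_eq_norm_mul_norm]
  simp only [inner_sub_left, inner_sub_right, inner_smul_left, inner_smul_right,
    hZ.inner_normal, real_inner_comm (Z p) (N p), real_inner_self_eq_norm_sq, (hN p).1,
    conj_trivial]
  unfold radialJacobian
  ring

/-- Against X the two terms containing Z cancel. The remaining square root is inverse to the one in
`areaDensity_radialMap`, so the gradient of h drops out of the volume altogether. -/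
theorem inner_radialNormal (q : ℝ) (t : ℝ) (p : S) :
    inner ℝ (ι p) (radialNormal q ι N h Z t p) =
      (√(radialJacobian q t (h p) (inner ℝ (Z p) (ι p))
        (inner ℝ (ι p) (N p) ^ 2 * ‖Z p‖ ^ 2)))⁻¹ * ((1 + t * h p) * inner ℝ (ι p) (N p)) := by
  rw [radialNormal, inner_smul_right, inner_sub_right, inner_smul_right, inner_smul_right,
    real_inner_comm (ι p) (Z p)]
  ring

theorem exists_pos_forall_one_add_mul_pos {T : Type*} [TopologicalSpace T] [CompactSpace T]
    {u : T → ℝ} (hu : Continuous u) : ∃ ε > 0, ∀ t ∈ Ioo (-ε) ε, ∀ p, 0 < 1 + t * u p := by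
  obtain ⟨C, hC⟩ := isCompact_univ.exists_bound_of_continuousOn hu.continuousOn
  have hC' : ∀ p, |u p| ≤ |C| := fun p => (hC p (mem_univ p)).trans (le_abs_self C)
  refine ⟨1 / (|C| + 1), by positivity, fun t ht p => ?_⟩
  have h1 : |t| < 1 / (|C| + 1) := abs_lt.2 ht
  have h2 : |t * u p| < 1 := by
    rw [abs_mul]
    calc |t| * |u p| ≤ |t| * (|C| + 1) :=
          mul_le_mul_of_nonneg_left ((hC' p).trans (by linarith)) (abs_nonneg _)
      _ < 1 / (|C| + 1) * (|C| + 1) := mul_lt_mul_of_pos_right h1 (by positivity)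
      _ = 1 := by field_simp
  linarith [(abs_lt.1 h2).1]

theorem IsHomogeneousDensity.continuous_comp {M : Set (E n)} {k : ℝ} {f : E n → ℝ}
    (hf : IsHomogeneousDensity M k f) (hι : Continuous ι) (hM : ∀ p, ι p ∈ M \ {0}) :
    Continuous fun p => f (ι p) := by
  obtain ⟨W, g, hW, hMW, hg, he⟩ := hf.smooth
  have : (fun p => f (ι p)) = fun p => g (ι p) := funext fun p => he (hM p)
  rw [this]
  exact hg.continuousOn.comp_continuous hι fun p => hMW (hM p)

/-- Points only move along rays, which stay in the cone and in its frontier; hence h is unrestricted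
at the boundary of the hypersurface. -/
theorem isVariation_radialMap [CompactSpace S] {M : Set (E n)} (hM : IsSolidCone M)
    (hS : IsHypersurface M ι N) {q : ℝ} (hZ : IsGradient ι N h Z) {ε : ℝ} (hε : 0 < ε)
    (h1 : ∀ t ∈ Ioo (-ε) ε, ∀ p, 0 < 1 + t * h p)
    (h2 : ∀ t ∈ Ioo (-ε) ε, ∀ p, 0 < 1 + t * h p + t / q * inner ℝ (Z p) (ι p)) :
    IsVariation M ι N ε (radialMap q ι h) (radialNormal q ι N h Z) := by
  have hι := hS.immersion
  have hι' := hι.smooth.continuous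
  have hN' := hS.smooth_normal.continuous
  have hZ' := hZ.continuous
  have hh' := hZ.smooth.continuous
  have hsm : ContMDiffOn (𝓘(ℝ, ℝ).prod (𝓡∂ n)) 𝓘(ℝ, E n) ∞
      (fun z : ℝ × S => radialMap q ι h z.1 z.2) (Ioo (-ε) ε ×ˢ univ) := by
    intro z hz
    refine ContMDiffAt.contMDiffWithinAt ?_
    have a1 : ContMDiffAt (𝓘(ℝ, ℝ).prod (𝓡∂ n)) 𝓘(ℝ, ℝ) ∞
        (fun z : ℝ × S => 1 + z.1 * h z.2) z :=
      contMDiffAt_const.add (contMDiffAt_fst.mul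
        ((hZ.smooth _).comp z contMDiffAt_snd))
    have a2 : ContMDiffAt (𝓘(ℝ, ℝ).prod (𝓡∂ n)) 𝓘(ℝ, ℝ) ∞
        (fun z : ℝ × S => radialFactor q h z.1 z.2) z :=
      ((Real.contDiffAt_rpow_const_of_ne (p := 1 / q) (n := ∞)
        (h1 z.1 hz.1 z.2).ne').contMDiffAt).comp z a1
    exact a2.smul ((hι.smooth _).comp z contMDiffAt_snd)
  have hsm1 : ∀ t ∈ Ioo (-ε) ε, ContMDiff (𝓡∂ n) 𝓘(ℝ, E n) ∞ (radialMap q ι h t) := by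
    intro t ht
    rw [← contMDiffOn_univ]
    exact hsm.comp (contMDiff_const.prodMk contMDiff_id).contMDiffOn
      (fun p _ => ⟨ht, mem_univ _⟩)
  have hdiff : ∀ t ∈ Ioo (-ε) ε, ∀ p v, diff (radialMap q ι h t) p v = radialFactor q h t p •
      (diff ι p v + inner ℝ ((t / q / (1 + t * h p)) • Z p) (diff ι p v) • ι p) := by
    intro t ht p v
    have hy := mem_extChartAt_target (I := 𝓡∂ n) p
    have hp := extChartAt_to_inv (I := 𝓡∂ n) p
    have := chartDeriv_radialMap (q := q) hZ hι.smooth hy (by rw [hp]; exact h1 t ht p) v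
    rw [diff_eq_chartDeriv _ (hsm1 t ht), diff_eq_chartDeriv _ hι.smooth, this, hp]
  refine ⟨hε, hsm, ?_, ?_, ?_, ?_, ?_, ?_, ?_⟩
  · intro t ht
    refine ⟨hsm1 t ht, fun p => ?_⟩
    rw [diff_eq_chartDeriv _ (hsm1 t ht)]
    exact linearIndependent_chartFrame_iff.1 (areaDensity_radialMap hι hS.unit_normal hZ
      (mem_extChartAt_target (I := 𝓡∂ n) p) (extChartAt_to_inv (I := 𝓡∂ n) p)
        (h1 t ht p) (h2 t ht p)).1
  · exact fun t ht p => hM.smul_mem (hS.mapsTo p).1 (radialFactor_pos (h1 t ht p))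
  · exact fun t ht p hp =>
      hM.smul_mem_frontier (hS.boundary p hp) (radialFactor_pos (h1 t ht p))
  · have hc : Continuous fun z : ℝ × S => radialJacobian q z.1 (h z.2)
        (inner ℝ (Z z.2) (ι z.2)) (inner ℝ (ι z.2) (N z.2) ^ 2 * ‖Z z.2‖ ^ 2) := by
      unfold radialJacobian; fun_prop
    refine ContinuousOn.smul (hc.sqrt.continuousOn.inv₀ fun z hz =>
      (Real.sqrt_pos.2 (radialJacobian_pos (h2 z.1 hz.1 z.2) (by positivity))).ne')
      (Continuous.continuousOn ?_)
    fun_prop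
  · refine fun t ht p => ⟨norm_radialNormal hS.unit_normal hZ (h2 t ht p), fun v => ?_⟩
    have h0 := h1 t ht p
    rw [hdiff t ht, radialNormal]
    simp only [inner_smul_left, inner_smul_right, inner_add_right, inner_sub_left,
      (hS.unit_normal p).2, real_inner_comm (ι p) (N p), conj_trivial]
    field_simp
    ring
  · ext1 p; simp [radialMap, radialFactor]
  · ext1 p; simp [radialNormal, radialJacobian]

variable [T2Space S] [CompactSpace S] {M : Set (E n)} {k : ℝ} {f : E n → ℝ}

/-- The weighted volume is affine along radial variations. -/
theorem weightedVolume_radialMap (hf : IsHomogeneousDensity M k f) (hS : IsHypersurface M ι N)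
    (hk : (n : ℝ) + k + 1 ≠ 0) (hZ : IsGradient ι N h Z) {t : ℝ}
    (h1 : ∀ p, 0 < 1 + t * h p)
    (h2 : ∀ p, 0 < 1 + t * h p + t / (n + k + 1) * inner ℝ (Z p) (ι p)) :
    weightedVolume k f (radialMap (n + k + 1) ι h t) (radialNormal (n + k + 1) ι N h Z t) =
      -1 / (n + k + 1) * areaIntegral ι fun p => (1 + t * h p) * (inner ℝ (ι p) (N p) * f (ι p)) := by
  rw [weightedVolume]
  congr 1
  refine areaIntegral_congr fun x y hy => ?_
  set p := (extChartAt (𝓡∂ n) x).symm y with hp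
  have h10 := h1 p
  rw [(areaDensity_radialMap hS.immersion hS.unit_normal hZ hy hp.symm h10 (h2 p)).2,
    radialMap, inner_smul_left, inner_radialNormal, hf.homogeneous _ (hS.mapsTo p) _
      (radialFactor_pos h10)]
  have hR := Real.sqrt_pos.2 (radialJacobian_pos (h2 p)
    (show 0 ≤ inner ℝ (ι p) (N p) ^ 2 * ‖Z p‖ ^ 2 by positivity))
  -- The powers n from the area, k from the density and 1 from the position vector add up to n+k+1,
  -- which the exponent 1/(n+k+1) reduces to the first power of 1 + th. This makes the volume affine
  -- in t.
  have hpow : radialFactor (n + k + 1) h t p ^ n * radialFactor (n + k + 1) h t p ^ k *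
      radialFactor (n + k + 1) h t p = 1 + t * h p := by
    have hl : 0 < radialFactor (n + k + 1) h t p := radialFactor_pos h10
    rw [← Real.rpow_natCast, ← Real.rpow_add hl, ← Real.rpow_add_one hl.ne', radialFactor,
      ← Real.rpow_mul h10.le, one_div_mul_cancel hk, Real.rpow_one]
  simp only [conj_trivial]
  field_simp
  rw [← hpow]
  ring

/-- The exponent collects n from the area and k from the density; the -1 comes from clearing the
denominator 1 + th under the square root. -/
theorem weightedArea_radialMap (hf : IsHomogeneousDensity M k f) (hS : IsHypersurface M ι N)
    (hZ : IsGradient ι N h Z) {q t : ℝ}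
    (h1 : ∀ p, 0 < 1 + t * h p)
    (h2 : ∀ p, 0 < 1 + t * h p + t / q * inner ℝ (Z p) (ι p)) :
    weightedArea f (radialMap q ι h t) = areaIntegral ι fun p =>
      f (ι p) * (1 + t * h p) ^ ((n + k) / q - 1) * √(radialJacobian q t (h p)
        (inner ℝ (Z p) (ι p)) (inner ℝ (ι p) (N p) ^ 2 * ‖Z p‖ ^ 2)) := by
  rw [weightedArea]
  refine areaIntegral_congr fun x y hy => ?_
  set p := (extChartAt (𝓡∂ n) x).symm y with hp
  have h10 := h1 p
  rw [(areaDensity_radialMap hS.immersion hS.unit_normal hZ hy hp.symm h10 (h2 p)).2,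
    radialMap, hf.homogeneous _ (hS.mapsTo p) _ (radialFactor_pos h10)]
  have hpow : (1 + t * h p) ^ ((n + k) / q - 1) =
      radialFactor q h t p ^ n * radialFactor q h t p ^ k / (1 + t * h p) := by
    have hl : 0 < radialFactor q h t p := radialFactor_pos h10
    rw [← Real.rpow_natCast, ← Real.rpow_add hl, Real.rpow_sub h10, Real.rpow_one, radialFactor,
      ← Real.rpow_mul h10.le]
    congr 2
    ring
  rw [hpow]
  ring

/-- The hypothesis on h kills the slope of an affine function of t, so the radial variation keeps
the volume exactly. Its area has derivative 1/q times the asserted integral. -/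
theorem IsStationary.areaIntegral_eq_zero (hM : IsSolidCone M) (hf : IsHomogeneousDensity M k f)
    (hS : IsHypersurface M ι N) (hstat : IsStationary M k f ι N)
    (hk : (n : ℝ) + k + 1 ≠ 0) (hZ : IsGradient ι N h Z)
    (hvol : areaIntegral ι (fun p => h p * (inner ℝ (ι p) (N p) * f (ι p))) = 0) :
    areaIntegral ι (fun p => ((n + k) * h p + inner ℝ (Z p) (ι p)) * f (ι p)) = 0 := by
  set q : ℝ := n + k + 1 with hq
  have hι := hS.immersion
  have hι' := hι.smooth.continuous
  have hN' := hS.smooth_normal.continuous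
  have hZ' := hZ.continuous
  have hh' := hZ.smooth.continuous
  have hf' := hf.continuous_comp hι' hS.mapsTo
  obtain ⟨ε₁, hε₁, H1⟩ := exists_pos_forall_one_add_mul_pos hh'
  obtain ⟨ε₂, hε₂, H2⟩ := exists_pos_forall_one_add_mul_pos
    (u := fun p => h p + inner ℝ (Z p) (ι p) / q) (by fun_prop)
  set ε := min ε₁ ε₂
  have hε : 0 < ε := lt_min hε₁ hε₂
  have h1 : ∀ t ∈ Ioo (-ε) ε, ∀ p, 0 < 1 + t * h p := fun t ht p =>
    H1 t ⟨by linarith [ht.1, min_le_left ε₁ ε₂], by linarith [ht.2, min_le_left ε₁ ε₂]⟩ p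
  have h2 : ∀ t ∈ Ioo (-ε) ε, ∀ p, 0 < 1 + t * h p + t / q * inner ℝ (Z p) (ι p) := by
    intro t ht p
    have := H2 t ⟨by linarith [ht.1, min_le_right ε₁ ε₂], by linarith [ht.2, min_le_right ε₁ ε₂]⟩ p
    calc (0 : ℝ) < _ := this
      _ = _ := by ring
  have hvar := isVariation_radialMap hM hS (q := q) hZ hε h1 h2
  have hstat' := hstat ε _ _ hvar fun t ht => by
    rw [hq, weightedVolume_radialMap hf hS hk hZ (h1 t ht) (h2 t ht), weightedVolume]
    congr 1
    have : ∀ p, (1 + t * h p) * (inner ℝ (ι p) (N p) * f (ι p)) =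
      inner ℝ (ι p) (N p) * f (ι p) + t * (h p * (inner ℝ (ι p) (N p) * f (ι p))) :=
        fun p => by ring
    simp only [this]
    have hc : Continuous fun p => inner ℝ (ι p) (N p) * f (ι p) := (hι'.inner hN').mul hf'
    have hc' : Continuous fun p => t * (h p * (inner ℝ (ι p) (N p) * f (ι p))) :=
      continuous_const.mul (hh'.mul hc)
    rw [areaIntegral_add hι hc hc', areaIntegral_const_mul, hvol]
    simp
  -- compute the derivative of the area
  let Ψ : ℝ × (ℝ × ℝ × ℝ × ℝ) → ℝ := fun z =>
    z.2.1 * (1 + z.1 * z.2.2.1) ^ ((n + k) / q - 1) *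
      √(radialJacobian q z.1 z.2.2.1 z.2.2.2.1 z.2.2.2.2)
  let O : Set (ℝ × (ℝ × ℝ × ℝ × ℝ)) := {z | 0 < 1 + z.1 * z.2.2.1} ∩
    {z | 0 < radialJacobian q z.1 z.2.2.1 z.2.2.2.1 z.2.2.2.2}
  have hJ : ContDiff ℝ 1 fun z : ℝ × (ℝ × ℝ × ℝ × ℝ) =>
      radialJacobian q z.1 z.2.2.1 z.2.2.2.1 z.2.2.2.2 := by
    unfold radialJacobian; fun_prop
  have hO : IsOpen O := (isOpen_lt continuous_const (by fun_prop)).inter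
    (isOpen_lt continuous_const hJ.continuous)
  have hΨ : ContDiffOn ℝ 1 Ψ O := by
    intro z hz
    refine ContDiffAt.contDiffWithinAt ?_
    refine ContDiffAt.mul (ContDiffAt.mul (by fun_prop) ?_) (hJ.contDiffAt.sqrt hz.2.ne')
    exact ContDiffAt.rpow_const_of_ne (by fun_prop) hz.1.ne'
  let a : S → ℝ × ℝ × ℝ × ℝ := fun p => (f (ι p), h p, inner ℝ (Z p) (ι p),
    inner ℝ (ι p) (N p) ^ 2 * ‖Z p‖ ^ 2)
  have ha : Continuous a := hf'.prodMk (by fun_prop)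
  have hder := hasDerivAt_areaIntegral hι ha hO hΨ hε
    (fun t ht p => ⟨h1 t ht p, radialJacobian_pos (h2 t ht p) (by positivity)⟩)
    (u' := fun p => 1 / q * (((n + k) * h p + inner ℝ (Z p) (ι p)) * f (ι p))) (fun p => by
      simp only [Ψ, a, radialJacobian]
      have d0 : HasDerivAt (fun t : ℝ => t) 1 0 := hasDerivAt_id 0
      have d1 : HasDerivAt (fun t : ℝ => 1 + t * h p) (1 * h p) 0 :=
        (d0.mul_const _).const_add 1
      have d2 := d1.rpow_const (p := (n + k) / q - 1) (Or.inl (by simp))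
      have d3 := ((((d1.add ((d0.div_const q).mul_const (inner ℝ (Z p) (ι p)))).pow 2).add
        (((d0.div_const q).pow 2).mul_const (inner ℝ (ι p) (N p) ^ 2 * ‖Z p‖ ^ 2))).sqrt
        (by simp))
      have d4 := (d2.const_mul (f (ι p))).mul d3
      refine d4.congr_deriv ?_
      simp
      field_simp
      ring)
  have hA : HasDerivAt (fun t => weightedArea f (radialMap q ι h t))
      (areaIntegral ι fun p => 1 / q * (((n + k) * h p + inner ℝ (Z p) (ι p)) * f (ι p))) 0 := by
    refine hder.congr_of_eventuallyEq ?_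
    filter_upwards [Ioo_mem_nhds (show -ε < 0 by linarith) hε] with t ht
    exact weightedArea_radialMap hf hS hZ (h1 t ht) (h2 t ht)
  rw [areaIntegral_const_mul] at hA
  exact (mul_eq_zero.1 (hA.unique hstat')).resolve_left (by simpa using hk)

end Radial

/-! ### Divergence of the weighted tangential part of the position field. -/

section Divergence
open Matrix
variable {n : ℕ}

theorem sum_gram_inv_mul_inner {v : Fin n → E n} (hv : LinearIndependent ℝ v) (l m : Fin n) :
    ∑ j, (gram ℝ v)⁻¹ l j * inner ℝ (v m) (v j) = if l = m then 1 else 0 := by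
  have h := congrFun (congrFun (nonsing_inv_mul (gram ℝ v) (det_gram_pos hv).ne'.isUnit) l) m
  rw [mul_apply, one_apply] at h
  rw [← h]
  exact Finset.sum_congr rfl fun j _ => by rw [gram_apply, real_inner_comm]

/-- The algebraic identity behind the first variation of area: the divergence of the tangential
part of `g • X`. -/
theorem sum_divergence_eq {N X : E n} {v N' : Fin n → E n} {v2 : Fin n → Fin n → E n} {g : ℝ}
    {g' s Z : Fin n → ℝ} {Z' : Fin n → Fin n → ℝ}
    (h : ∀ i, inner ℝ N (v i) = 0) (hv : LinearIndependent ℝ v)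
    (hsymm : ∀ i l, v2 i l = v2 l i)
    (hd : ∀ i, g' i • X + g • v i - (s i • N + (g * inner ℝ X N) • N' i) =
      ∑ l, (Z' i l • v l + Z l • v2 i l)) :
    ∑ i, Z' i i + ∑ l, Z l * ∑ i, ∑ j, (gram ℝ v)⁻¹ i j * inner ℝ (v2 l i) (v j) =
      (∑ i, ∑ j, (gram ℝ v)⁻¹ i j * g' i * inner ℝ X (v j)) + n * g
        - g * inner ℝ X N * ∑ i, ∑ j, (gram ℝ v)⁻¹ i j * inner ℝ (N' i) (v j) := by
  -- Contracting the differentiated decomposition with the inverse metric gives the divergence;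
  -- symmetry of the second derivatives puts the last term in the form of the logarithmic derivative
  -- of the area density.
  have hL : ∑ i, ∑ j, (gram ℝ v)⁻¹ i j * inner ℝ (∑ l, (Z' i l • v l + Z l • v2 i l)) (v j) =
      ∑ i, Z' i i + ∑ l, Z l * ∑ i, ∑ j, (gram ℝ v)⁻¹ i j * inner ℝ (v2 l i) (v j) := by
    simp only [sum_inner, inner_add_left, inner_smul_left, conj_trivial, Finset.sum_add_distrib,
      mul_add, Finset.mul_sum]
    congr 1
    · refine Finset.sum_congr rfl fun i _ => ?_
      rw [Finset.sum_comm]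
      calc ∑ l, ∑ j, (gram ℝ v)⁻¹ i j * (Z' i l * inner ℝ (v l) (v j))
          = ∑ l, Z' i l * ∑ j, (gram ℝ v)⁻¹ i j * inner ℝ (v l) (v j) := by
            simp only [Finset.mul_sum]
            exact Finset.sum_congr rfl fun l _ => Finset.sum_congr rfl fun j _ => by ring
        _ = Z' i i := by simp [sum_gram_inv_mul_inner hv]
    · calc ∑ i, ∑ j, ∑ l, (gram ℝ v)⁻¹ i j * (Z l * inner ℝ (v2 i l) (v j))
          = ∑ i, ∑ l, ∑ j, (gram ℝ v)⁻¹ i j * (Z l * inner ℝ (v2 i l) (v j)) :=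
            Finset.sum_congr rfl fun i _ => Finset.sum_comm
        _ = ∑ l, ∑ i, ∑ j, (gram ℝ v)⁻¹ i j * (Z l * inner ℝ (v2 i l) (v j)) := Finset.sum_comm
        _ = _ := Finset.sum_congr rfl fun l _ => Finset.sum_congr rfl fun i _ =>
            Finset.sum_congr rfl fun j _ => by rw [hsymm i l]; ring
  rw [← hL]
  simp only [← hd, inner_sub_left, inner_add_left, inner_smul_left, h, conj_trivial, mul_zero,
    zero_add]
  have hg : ∑ i, ∑ j, (gram ℝ v)⁻¹ i j * inner ℝ (v i) (v j) = n := by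
    simp [sum_gram_inv_mul_inner hv]
  rw [← hg, Finset.sum_mul, Finset.mul_sum, ← Finset.sum_add_distrib, ← Finset.sum_sub_distrib]
  refine Finset.sum_congr rfl fun i _ => ?_
  rw [Finset.sum_mul, Finset.mul_sum, ← Finset.sum_add_distrib, ← Finset.sum_sub_distrib]
  exact Finset.sum_congr rfl fun j _ => by ring

variable {Ω : Set (EuclideanSpace ℝ (Fin n))} {φ ν : EuclideanSpace ℝ (Fin n) → E n}

/-- The coordinate vectors of a parametrised hypersurface of `ℝⁿ⁺¹`. -/
def frame (φ : EuclideanSpace ℝ (Fin n) → E n) (y : EuclideanSpace ℝ (Fin n)) (i : Fin n) : E n :=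
  fderiv ℝ φ y (EuclideanSpace.single i 1)

theorem contDiffOn_frame (hΩ : IsOpen Ω) (hφ : ContDiffOn ℝ ∞ φ Ω) (i : Fin n) :
    ContDiffOn ℝ ∞ (fun y => frame φ y i) Ω :=
  (hφ.fderiv_of_isOpen hΩ (by simp)).clm_apply contDiffOn_const

theorem contDiffOn_gram_frame (hΩ : IsOpen Ω) (hφ : ContDiffOn ℝ ∞ φ Ω) (i j : Fin n) :
    ContDiffOn ℝ ∞ (fun y => gram ℝ (frame φ y) i j) Ω :=
  (contDiffOn_frame hΩ hφ i).inner ℝ (contDiffOn_frame hΩ hφ j)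

theorem fderiv_frame_comm (hΩ : IsOpen Ω) (hφ : ContDiffOn ℝ ∞ φ Ω)
    {y : EuclideanSpace ℝ (Fin n)} (hy : y ∈ Ω) (i j : Fin n) :
    fderiv ℝ (fun z => frame φ z i) y (EuclideanSpace.single j 1) =
      fderiv ℝ (fun z => frame φ z j) y (EuclideanSpace.single i 1) := by
  have hd : DifferentiableAt ℝ (fderiv ℝ φ) y :=
    ((hφ.fderiv_of_isOpen (m := ∞) hΩ (by simp)).differentiableOn (by simp)).differentiableAt
      (hΩ.mem_nhds hy)
  have h1 : ∀ i j : Fin n, fderiv ℝ (fun z => frame φ z i) y (EuclideanSpace.single j 1) =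
      fderiv ℝ (fderiv ℝ φ) y (EuclideanSpace.single j 1) (EuclideanSpace.single i 1) := by
    intro i j
    have := (hd.hasFDerivAt.clm_apply
      (hasFDerivAt_const (EuclideanSpace.single i (1 : ℝ)) y)).fderiv
    unfold frame
    rw [this]
    simp
  rw [h1, h1]
  have hs : IsSymmSndFDerivAt ℝ φ y :=
    (hφ.contDiffAt (hΩ.mem_nhds hy)).isSymmSndFDerivAt
      (by rw [minSmoothness_of_isRCLikeNormedField]; exact WithTop.coe_le_coe.2 (le_top : (2 : ℕ∞) ≤ ⊤))
  exact hs.eq _ _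

/-- Jacobi's formula gives half the trace of G⁻¹G'. By symmetry of G the two halves of the product
rule for G' contribute equally, which absorbs the factor 1/2. -/
theorem fderiv_sqrt_det_gram (hΩ : IsOpen Ω) (hφ : ContDiffOn ℝ ∞ φ Ω)
    {y : EuclideanSpace ℝ (Fin n)} (hy : y ∈ Ω) (hind : LinearIndependent ℝ (frame φ y))
    (u : EuclideanSpace ℝ (Fin n)) :
    fderiv ℝ (fun z => √(gram ℝ (frame φ z)).det) y u = √(gram ℝ (frame φ y)).det *
      ∑ i, ∑ j, (gram ℝ (frame φ y))⁻¹ i j *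
        inner ℝ (fderiv ℝ (fun z => frame φ z i) y u) (frame φ y j) := by
  set G : EuclideanSpace ℝ (Fin n) → Fin n → Fin n → ℝ := fun z i j => gram ℝ (frame φ z) i j with hG
  have hpos := det_gram_pos hind
  have hfr : ∀ i, HasFDerivAt (fun z => frame φ z i) (fderiv ℝ (fun z => frame φ z i) y) y :=
    fun i => (((contDiffOn_frame hΩ hφ i).differentiableOn (by simp)).differentiableAt
      (hΩ.mem_nhds hy)).hasFDerivAt
  have hGd : HasFDerivAt G (ContinuousLinearMap.pi fun i => ContinuousLinearMap.pi fun j =>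
      fderiv ℝ (fun z => G z i j) y) y := by
    refine hasFDerivAt_pi.2 fun i => hasFDerivAt_pi.2 fun j => ?_
    exact (((contDiffOn_gram_frame hΩ hφ i j).differentiableOn (by simp)).differentiableAt
      (hΩ.mem_nhds hy)).hasFDerivAt
  have hG' : ∀ i j, fderiv ℝ (fun z => G z i j) y u =
      inner ℝ (frame φ y i) (fderiv ℝ (fun z => frame φ z j) y u) +
      inner ℝ (fderiv ℝ (fun z => frame φ z i) y u) (frame φ y j) := by
    intro i j
    have := ((hfr i).inner ℝ (hfr j)).fderiv
    simp only [hG, gram_apply]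
    rw [this]
    simp [fderivInnerCLM_apply]
  have hdet : HasFDerivAt (fun A : Fin n → Fin n → ℝ => (Matrix.of A).det) _ (G y) :=
    (((contDiff_det_pi (n := n) 1).differentiable one_ne_zero) (G y)).hasFDerivAt
  have hJ := (hdet.comp y hGd).sqrt (show (Matrix.of (G y)).det ≠ 0 from hpos.ne')
  have e1 : fderiv ℝ (fun z => √(gram ℝ (frame φ z)).det) y = _ := hJ.fderiv
  rw [e1]
  simp only [_root_.smul_apply, ContinuousLinearMap.comp_apply, smul_eq_mul]
  rw [fderiv_det_pi (A := G y) hpos.ne']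
  have e2 : ((Matrix.of (G y))⁻¹ * Matrix.of ((ContinuousLinearMap.pi fun i =>
      ContinuousLinearMap.pi fun j => fderiv ℝ (fun z => G z i j) y) u)).trace =
      2 * ∑ i, ∑ j, (gram ℝ (frame φ y))⁻¹ i j *
        inner ℝ (fderiv ℝ (fun z => frame φ z i) y u) (frame φ y j) := by
    rw [two_mul]
    simp only [trace, diag_apply, mul_apply, of_apply, ContinuousLinearMap.coe_pi', hG',
      mul_add, Finset.sum_add_distrib]
    congr 1
    · refine Finset.sum_congr rfl fun i _ => Finset.sum_congr rfl fun j _ => ?_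
      rw [real_inner_comm]; rfl
    · rw [Finset.sum_comm]
      refine Finset.sum_congr rfl fun i _ => Finset.sum_congr rfl fun j _ => ?_
      rw [gram_inv_comm]; rfl
  rw [e2]
  have e3 : (Matrix.of (G y)).det = √(gram ℝ (frame φ y)).det * √(gram ℝ (frame φ y)).det :=
    (Real.mul_self_sqrt hpos.le).symm
  have e4 : √(Matrix.of (G y)).det = √(gram ℝ (frame φ y)).det := rfl
  simp only [Function.comp_apply, e4]
  rw [e3]
  have := (Real.sqrt_pos.2 hpos).ne'
  field_simp

/-- The components of the tangential part of `g • φ`, weighted by `F` and the area density. -/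
def fluxComponent (F : E n → ℝ) (φ : EuclideanSpace ℝ (Fin n) → E n)
    (g : EuclideanSpace ℝ (Fin n) → ℝ) (l : Fin n) (y : EuclideanSpace ℝ (Fin n)) : ℝ :=
  F (φ y) * √(gram ℝ (frame φ y)).det *
    (g y * ∑ j, (gram ℝ (frame φ y))⁻¹ l j * inner ℝ (φ y) (frame φ y j))

theorem contDiffOn_fluxComponent (hΩ : IsOpen Ω) (hφ : ContDiffOn ℝ ∞ φ Ω)
    (hind : ∀ y ∈ Ω, LinearIndependent ℝ (frame φ y)) {U : Set (E n)} {F : E n → ℝ}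
    (hF : ContDiffOn ℝ ∞ F U) (hU : MapsTo φ Ω U) {g : EuclideanSpace ℝ (Fin n) → ℝ}
    (hg : ContDiff ℝ ∞ g) (l : Fin n) : ContDiffOn ℝ ∞ (fluxComponent F φ g l) Ω := by
  have hG := contDiffOn_gram_frame hΩ hφ
  have h0 : ∀ y ∈ Ω, (gram ℝ (frame φ y)).det ≠ 0 := fun y hy => (det_gram_pos (hind y hy)).ne'
  refine ((hF.comp hφ hU).mul ((contDiffOn_det hG).sqrt h0)).mul (hg.contDiffOn.mul ?_)
  exact ContDiffOn.sum fun j _ => (contDiffOn_inv_apply hG h0 l j).mul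
    (hφ.inner ℝ (contDiffOn_frame hΩ hφ j))

/-- The divergence of the weighted tangential part of `g • φ`. -/
theorem sum_fderiv_fluxComponent (hΩ : IsOpen Ω) (hφ : ContDiffOn ℝ ∞ φ Ω)
    (hν : ContDiffOn ℝ ∞ ν Ω) (hν1 : ∀ y ∈ Ω, ‖ν y‖ = 1)
    (hν2 : ∀ y ∈ Ω, ∀ i, inner ℝ (ν y) (frame φ y i) = 0)
    (hind : ∀ y ∈ Ω, LinearIndependent ℝ (frame φ y)) {U : Set (E n)} (hUo : IsOpen U)
    {F : E n → ℝ} (hF : ContDiffOn ℝ ∞ F U) (hF0 : ∀ p ∈ U, 0 < F p) {k : ℝ}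
    (hk : ∀ p ∈ U, fderiv ℝ F p p = k * F p)
    (hU : MapsTo φ Ω U) {g : EuclideanSpace ℝ (Fin n) → ℝ} (hg : ContDiff ℝ ∞ g)
    {y : EuclideanSpace ℝ (Fin n)} (hy : y ∈ Ω) :
    ∑ l, fderiv ℝ (fluxComponent F φ g l) y (EuclideanSpace.single l 1) =
      ((n + k) * g y + (∑ i, ∑ j, (gram ℝ (frame φ y))⁻¹ i j *
          fderiv ℝ g y (EuclideanSpace.single i 1) * inner ℝ (φ y) (frame φ y j)) -
        g y * inner ℝ (φ y) (ν y) * ((∑ i, ∑ j, (gram ℝ (frame φ y))⁻¹ i j *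
          inner ℝ (frame ν y i) (frame φ y j)) + fderiv ℝ F (φ y) (ν y) / F (φ y))) *
        (F (φ y) * √(gram ℝ (frame φ y)).det) := by
  have hG := contDiffOn_gram_frame hΩ hφ
  have h0 : ∀ y ∈ Ω, (gram ℝ (frame φ y)).det ≠ 0 := fun y hy => (det_gram_pos (hind y hy)).ne'
  have hnhds := hΩ.mem_nhds hy
  set e : Fin n → EuclideanSpace ℝ (Fin n) := fun i => EuclideanSpace.single i 1 with he
  set J : EuclideanSpace ℝ (Fin n) → ℝ := fun z => √(gram ℝ (frame φ z)).det with hJ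
  set Z : Fin n → EuclideanSpace ℝ (Fin n) → ℝ := fun l z =>
    g z * ∑ j, (gram ℝ (frame φ z))⁻¹ l j * inner ℝ (φ z) (frame φ z j) with hZ
  have dφ : HasFDerivAt φ (fderiv ℝ φ y) y :=
    ((hφ.differentiableOn (by simp)).differentiableAt hnhds).hasFDerivAt
  have dν : HasFDerivAt ν (fderiv ℝ ν y) y :=
    ((hν.differentiableOn (by simp)).differentiableAt hnhds).hasFDerivAt
  have dg : HasFDerivAt g (fderiv ℝ g y) y := (hg.differentiable (by simp) y).hasFDerivAt
  have dF : HasFDerivAt F (fderiv ℝ F (φ y)) (φ y) :=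
    ((hF.differentiableOn (by simp)).differentiableAt (hUo.mem_nhds (hU hy))).hasFDerivAt
  have dJ : HasFDerivAt J (fderiv ℝ J y) y :=
    ((((contDiffOn_det hG).sqrt h0).differentiableOn (by simp)).differentiableAt hnhds).hasFDerivAt
  have dZ : ∀ l, HasFDerivAt (Z l) (fderiv ℝ (Z l) y) y := fun l => by
    have : ContDiffOn ℝ ∞ (Z l) Ω := hg.contDiffOn.mul
      (ContDiffOn.sum fun j _ => (contDiffOn_inv_apply hG h0 l j).mul
        (hφ.inner ℝ (contDiffOn_frame hΩ hφ j)))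
    exact ((this.differentiableOn (by simp)).differentiableAt hnhds).hasFDerivAt
  have dv : ∀ l, HasFDerivAt (fun z => frame φ z l) (fderiv ℝ (fun z => frame φ z l) y) y :=
    fun l => (((contDiffOn_frame hΩ hφ l).differentiableOn (by simp)).differentiableAt
      hnhds).hasFDerivAt
  -- the tangential decomposition, and its derivative
  have hdec : ∀ z ∈ Ω, g z • φ z - (g z * inner ℝ (φ z) (ν z)) • ν z =
      ∑ l, Z l z • frame φ z l := by
    intro z hz
    have := eq_inner_smul_add_sum (hν1 z hz) (hν2 z hz) (hind z hz) (φ z)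
    conv_lhs => rw [mul_smul, ← smul_sub]; enter [2, 1]; rw [this]
    rw [add_sub_cancel_left, Finset.smul_sum]
    simp only [smul_smul, hZ]
  have hder : ∀ i, fderiv ℝ g y (e i) • φ y + g y • frame φ y i -
      (fderiv ℝ (fun z => g z * inner ℝ (φ z) (ν z)) y (e i) • ν y +
        (g y * inner ℝ (φ y) (ν y)) • frame ν y i) =
      ∑ l, (fderiv ℝ (Z l) y (e i) • frame φ y l +
        Z l y • fderiv ℝ (fun z => frame φ z l) y (e i)) := by
    intro i
    have dgi : HasFDerivAt (fun z => g z * inner ℝ (φ z) (ν z))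
        (fderiv ℝ (fun z => g z * inner ℝ (φ z) (ν z)) y) y :=
      (dg.differentiableAt.mul (dφ.differentiableAt.inner ℝ dν.differentiableAt)).hasFDerivAt
    have a1 := (dg.smul dφ).sub (dgi.smul dν)
    have a2 := HasFDerivAt.fun_sum (u := Finset.univ) fun l _ => (dZ l).smul (dv l)
    have a3 := a2.congr_of_eventuallyEq (Filter.eventuallyEq_of_mem hnhds hdec)
    have a4 := congrArg (fun L : EuclideanSpace ℝ (Fin n) →L[ℝ] E n => L (e i)) (a1.unique a3)
    simp only [_root_.sum_apply, _root_.sub_apply,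
      _root_.add_apply, _root_.smul_apply,
      ContinuousLinearMap.smulRight_apply] at a4
    rw [Finset.sum_congr rfl fun l _ => add_comm _ _, ← a4]
    simp only [frame]
    abel
  have hdiv := sum_divergence_eq (hν2 y hy) (hind y hy)
    (v2 := fun i l => fderiv ℝ (fun z => frame φ z l) y (e i))
    (fun i l => fderiv_frame_comm hΩ hφ hy l i) hder
  -- the derivative of the flux
  have hflux : ∀ l, fderiv ℝ (fluxComponent F φ g l) y (e l) =
      F (φ y) * J y * (fderiv ℝ (Z l) y (e l) + Z l y * ∑ i, ∑ j, (gram ℝ (frame φ y))⁻¹ i j *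
        inner ℝ (fderiv ℝ (fun z => frame φ z i) y (e l)) (frame φ y j)) +
      J y * fderiv ℝ F (φ y) (Z l y • frame φ y l) := by
    intro l
    have a1 : HasFDerivAt (fluxComponent F φ g l) _ y := ((dF.comp y dφ).mul dJ).mul (dZ l)
    rw [a1.fderiv]
    have a2 := fderiv_sqrt_det_gram hΩ hφ hy (hind y hy) (e l)
    change F (φ y) * J y * fderiv ℝ (Z l) y (e l) +
      Z l y * (F (φ y) * fderiv ℝ J y (e l) + J y * fderiv ℝ F (φ y) (frame φ y l)) = _
    rw [hJ, a2, map_smul, smul_eq_mul]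
    ring
  -- The derivative of F is taken along the tangential part gX - g⟨X,N⟩N. Euler's identity turns the
  -- first term into kgF, which joins the n of the divergence; the second is the normal derivative
  -- of the density.
  rw [Finset.sum_congr rfl fun l _ => hflux l, Finset.sum_add_distrib, ← Finset.mul_sum,
    ← Finset.mul_sum, ← map_sum, ← hdec y hy, Finset.sum_add_distrib, hdiv, map_sub, map_smul,
    map_smul, hk _ (hU hy)]
  have := (hF0 _ (hU hy)).ne'
  simp only [smul_eq_mul]
  field_simp
  ring

end Divergence

/-! ### From the weak equation to a pointwise one. -/

section WeakEquation
open Matrix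
variable {n : ℕ} {Ω : Set (EuclideanSpace ℝ (Fin n))} {φ ν : EuclideanSpace ℝ (Fin n) → E n}

/-- Integration by parts against the constant 1. -/
theorem integral_fderiv_apply_eq_zero {u : EuclideanSpace ℝ (Fin n) → ℝ} (hu : ContDiff ℝ 1 u)
    (hc : HasCompactSupport u) (v : EuclideanSpace ℝ (Fin n)) :
    Integrable (fun y => fderiv ℝ u y v) ∧ ∫ y, fderiv ℝ u y v = 0 := by
  have h1 : Integrable (fun y => fderiv ℝ u y v) := by
    refine Continuous.integrable_of_hasCompactSupport
      ((hu.continuous_fderiv one_ne_zero).clm_apply continuous_const) ?_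
    exact (hc.fderiv ℝ).comp_left (g := fun L : _ →L[ℝ] ℝ => L v) (by simp)
  refine ⟨h1, ?_⟩
  have := integral_mul_fderiv_eq_neg_fderiv_mul_of_integrable (μ := volume)
    (f := fun _ : EuclideanSpace ℝ (Fin n) => (1 : ℝ)) (g := u) (v := v) (by simp)
    (by simpa using h1) (by simpa using hu.continuous.integrable_of_hasCompactSupport hc)
    (fun x _ => differentiableAt_const _) (fun x _ => (hu.differentiable one_ne_zero) x)
  simpa using this

/-- The integrand of the weak form of the stationarity equation. -/
def weakIntegrand (F : E n → ℝ) (φ ν : EuclideanSpace ℝ (Fin n) → E n) (k H : ℝ)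
    (g : EuclideanSpace ℝ (Fin n) → ℝ) (y : EuclideanSpace ℝ (Fin n)) : ℝ :=
  ((n + k) * g y + (∑ i, ∑ j, (gram ℝ (frame φ y))⁻¹ i j *
    fderiv ℝ g y (EuclideanSpace.single i 1) * inner ℝ (φ y) (frame φ y j)) +
      H * (g y * inner ℝ (φ y) (ν y))) * (F (φ y) * √(gram ℝ (frame φ y)).det)

theorem weakIntegrand_eq_zero (F : E n → ℝ) (k H : ℝ) {g : EuclideanSpace ℝ (Fin n) → ℝ}
    {y : EuclideanSpace ℝ (Fin n)} (hy : y ∉ tsupport g) : weakIntegrand F φ ν k H g y = 0 := by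
  have h1 : g y = 0 := image_eq_zero_of_notMem_tsupport hy
  have h2 : fderiv ℝ g y = 0 :=
    image_eq_zero_of_notMem_tsupport fun h => hy (tsupport_fderiv_subset ℝ h)
  simp [weakIntegrand, h1, h2]

/-- The weak integrand is a divergence plus g·P, and the divergence integrates to zero. The
fundamental lemma of the calculus of variations gives P = 0 almost everywhere, continuity gives it
everywhere, and the positive weight F√det can be divided out. -/
theorem inner_mul_eq_zero_of_weak (hΩ : IsOpen Ω) (hφ : ContDiffOn ℝ ∞ φ Ω)
    (hν : ContDiffOn ℝ ∞ ν Ω) (hν1 : ∀ y ∈ Ω, ‖ν y‖ = 1)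
    (hν2 : ∀ y ∈ Ω, ∀ i, inner ℝ (ν y) (frame φ y i) = 0)
    (hind : ∀ y ∈ Ω, LinearIndependent ℝ (frame φ y)) {U : Set (E n)} (hUo : IsOpen U)
    {F : E n → ℝ} (hF : ContDiffOn ℝ ∞ F U) (hF0 : ∀ p ∈ U, 0 < F p) {k : ℝ}
    (hk : ∀ p ∈ U, fderiv ℝ F p p = k * F p) (hU : MapsTo φ Ω U) (H : ℝ)
    (hweak : ∀ g : EuclideanSpace ℝ (Fin n) → ℝ, ContDiff ℝ ∞ g → HasCompactSupport g →
      tsupport g ⊆ Ω → ∫ y, weakIntegrand F φ ν k H g y = 0) {y : EuclideanSpace ℝ (Fin n)}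
    (hy : y ∈ Ω) :
    inner ℝ (φ y) (ν y) * (H + ((∑ i, ∑ j, (gram ℝ (frame φ y))⁻¹ i j *
      inner ℝ (frame ν y i) (frame φ y j)) + fderiv ℝ F (φ y) (ν y) / F (φ y))) = 0 := by
  have hG := contDiffOn_gram_frame hΩ hφ
  have h0 : ∀ y ∈ Ω, (gram ℝ (frame φ y)).det ≠ 0 := fun y hy => (det_gram_pos (hind y hy)).ne'
  set P : EuclideanSpace ℝ (Fin n) → ℝ := fun y =>
    inner ℝ (φ y) (ν y) * (H + ((∑ i, ∑ j, (gram ℝ (frame φ y))⁻¹ i j *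
      inner ℝ (frame ν y i) (frame φ y j)) + fderiv ℝ F (φ y) (ν y) / F (φ y))) *
      (F (φ y) * √(gram ℝ (frame φ y)).det) with hP
  have hFφ : ContDiffOn ℝ ∞ (fun y => F (φ y)) Ω := hF.comp hφ hU
  have hdF : ContDiffOn ℝ ∞ (fun y => fderiv ℝ F (φ y) (ν y)) Ω :=
    ((hF.fderiv_of_isOpen hUo (by simp)).comp hφ hU).clm_apply hν
  have hPc : ContinuousOn P Ω := by
    refine ContDiffOn.continuousOn (𝕜 := ℝ) (n := ∞) ?_
    refine ((hφ.inner ℝ hν).mul (contDiffOn_const.add (ContDiffOn.add ?_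
      (hdF.div hFφ fun y hy => (hF0 _ (hU hy)).ne')))).mul
      (hFφ.mul ((contDiffOn_det hG).sqrt h0))
    exact ContDiffOn.sum fun i _ => ContDiffOn.sum fun j _ =>
      (contDiffOn_inv_apply hG h0 i j).mul
        ((contDiffOn_frame hΩ hν i).inner ℝ (contDiffOn_frame hΩ hφ j))
  have hint : ∀ g : EuclideanSpace ℝ (Fin n) → ℝ, ContDiff ℝ ∞ g → HasCompactSupport g →
      tsupport g ⊆ Ω → ∫ y, g y • P y = 0 := by
    intro g hg hgc hgΩ
    -- Regularity of the frame is known only on Ω; elsewhere the factor g makes the flux vanish near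
    -- every point outside its support.
    have hflux : ∀ l, ContDiff ℝ 1 (fluxComponent F φ g l) ∧
        HasCompactSupport (fluxComponent F φ g l) := by
      intro l
      have hz : ∀ z, z ∉ tsupport g → fluxComponent F φ g l z = 0 := fun z hz => by
        rw [fluxComponent, image_eq_zero_of_notMem_tsupport hz]; simp
      refine ⟨contDiff_iff_contDiffAt.2 fun z => ?_, HasCompactSupport.intro hgc hz⟩
      by_cases hzg : z ∈ tsupport g
      · exact ((contDiffOn_fluxComponent hΩ hφ hind hF hU hg l).contDiffAt
          (hΩ.mem_nhds (hgΩ hzg))).of_le (by exact_mod_cast le_top)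
      · refine (contDiffAt_const (c := (0 : ℝ))).congr_of_eventuallyEq ?_
        filter_upwards [(isClosed_tsupport g).isOpen_compl.mem_nhds hzg] with w hw using hz w hw
    have hR := fun l => integral_fderiv_apply_eq_zero (hflux l).1 (hflux l).2
      (EuclideanSpace.single l 1)
    have hsplit : ∀ z, weakIntegrand F φ ν k H g z =
        ∑ l, fderiv ℝ (fluxComponent F φ g l) z (EuclideanSpace.single l 1) + g z • P z := by
      intro z
      by_cases hzg : z ∈ tsupport g
      · rw [sum_fderiv_fluxComponent hΩ hφ hν hν1 hν2 hind hUo hF hF0 hk hU hg (hgΩ hzg),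
          weakIntegrand, hP, smul_eq_mul]
        ring
      · have hz : ∀ l, fderiv ℝ (fluxComponent F φ g l) z = 0 := fun l => by
          refine image_eq_zero_of_notMem_tsupport (f := fderiv ℝ (fluxComponent F φ g l))
            fun h => hzg ?_
          refine closure_minimal (fun w hw => ?_) (isClosed_tsupport g)
            (tsupport_fderiv_subset ℝ h)
          by_contra hwg
          refine hw ?_
          rw [fluxComponent, image_eq_zero_of_notMem_tsupport hwg]; simp
        rw [weakIntegrand_eq_zero _ _ _ hzg, image_eq_zero_of_notMem_tsupport hzg]
        simp [hz]
    have hgP : Integrable fun z => g z • P z := by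
      refine Continuous.integrable_of_hasCompactSupport (continuous_of_tsupport fun z hz => ?_)
        (hgc.smul_right (f' := P))
      have hz' := hgΩ (tsupport_smul_subset_left g P hz)
      exact hg.continuous.continuousAt.smul (hPc.continuousAt (hΩ.mem_nhds hz'))
    have h1 := hweak g hg hgc hgΩ
    rw [integral_congr_ae (Filter.Eventually.of_forall hsplit),
      integral_add (integrable_finsetSum _ fun l _ => (hR l).1) hgP,
      integral_finsetSum _ fun l _ => (hR l).1] at h1
    simpa [(hR _).2] using h1
  have hae := hΩ.ae_eq_zero_of_integral_contDiff_smul_eq_zero (μ := volume)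
    (hPc.locallyIntegrableOn hΩ.measurableSet) hint
  have hP0 : P y = 0 := by
    refine Measure.eqOn_open_of_ae_eq (μ := volume) (f := P) (g := fun _ => 0) ?_ hΩ hPc
      continuousOn_const hy
    exact (ae_restrict_iff' hΩ.measurableSet).2 hae
  refine (mul_eq_zero.1 hP0).resolve_right ?_
  exact (mul_pos (hF0 _ (hU hy)) (Real.sqrt_pos.2 (det_gram_pos (hind y hy)))).ne'

end WeakEquation

/-! ### Transplanting test functions from a chart to the manifold. -/

section ChartExtension

variable {n : ℕ} [NeZero n] {S : Type*} [TopologicalSpace S]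
  [ChartedSpace (EuclideanHalfSpace n) S] [IsManifold (𝓡∂ n) ∞ S] [T2Space S]
  {V : Type*} [NormedAddCommGroup V] [NormedSpace ℝ V]

/-- The function on the manifold given by `u` in the chart at `x`, and `0` elsewhere. -/
def chartExtend (x : S) (u : EuclideanSpace ℝ (Fin n) → V) : S → V :=
  (extChartAt (𝓡∂ n) x).source.indicator (u ∘ extChartAt (𝓡∂ n) x)

theorem chartExtend_symm (x : S) (u : EuclideanSpace ℝ (Fin n) → V)
    {y : EuclideanSpace ℝ (Fin n)} (hy : y ∈ (extChartAt (𝓡∂ n) x).target) :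
    chartExtend x u ((extChartAt (𝓡∂ n) x).symm y) = u y := by
  rw [chartExtend, indicator_of_mem ((extChartAt (𝓡∂ n) x).map_target hy), Function.comp_apply,
    (extChartAt (𝓡∂ n) x).right_inv hy]

theorem chartExtend_eq_zero (x : S) {u : EuclideanSpace ℝ (Fin n) → V}
    {K : Set (EuclideanSpace ℝ (Fin n))} (hu : ∀ y ∉ K, u y = 0) {p : S}
    (hp : p ∉ (extChartAt (𝓡∂ n) x).symm '' K) : chartExtend x u p = 0 := by
  by_cases hs : p ∈ (extChartAt (𝓡∂ n) x).source
  · rw [chartExtend, indicator_of_mem hs]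
    exact hu _ fun h => hp ⟨_, h, (extChartAt (𝓡∂ n) x).left_inv hs⟩
  · exact indicator_of_notMem hs _

theorem isClosed_image_symm {x : S} {K : Set (EuclideanSpace ℝ (Fin n))} (hK : IsCompact K)
    (hKt : K ⊆ (extChartAt (𝓡∂ n) x).target) : IsClosed ((extChartAt (𝓡∂ n) x).symm '' K) :=
  (hK.image_of_continuousOn ((continuousOn_extChartAt_symm x).mono hKt)).isClosed

/-- The image of K is compact, hence closed, so taking the closure of the support does not leave the
chart domain. -/
theorem tsupport_subset_source {x : S} {K : Set (EuclideanSpace ℝ (Fin n))} (hK : IsCompact K)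
    (hKt : K ⊆ (extChartAt (𝓡∂ n) x).target) {w : S → V}
    (hw : ∀ p ∉ (extChartAt (𝓡∂ n) x).symm '' K, w p = 0) :
    tsupport w ⊆ (extChartAt (𝓡∂ n) x).source := by
  refine (closure_minimal (t := (extChartAt (𝓡∂ n) x).symm '' K) (fun p hp => ?_)
    (isClosed_image_symm hK hKt)).trans ?_
  · by_contra h
    exact hp (hw p h)
  · rintro _ ⟨y, hy, rfl⟩
    exact (extChartAt (𝓡∂ n) x).map_target (hKt hy)

theorem continuous_chartExtend {x : S} {K : Set (EuclideanSpace ℝ (Fin n))} (hK : IsCompact K)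
    (hKt : K ⊆ (extChartAt (𝓡∂ n) x).target) {u : EuclideanSpace ℝ (Fin n) → V}
    (hu : ∀ y ∉ K, u y = 0) (huc : ContinuousOn u (extChartAt (𝓡∂ n) x).target) :
    Continuous (chartExtend x u) := by
  refine continuous_of_tsupport fun p hp => ?_
  have hps := tsupport_subset_source hK hKt (fun p hp => chartExtend_eq_zero x hu hp) hp
  have hnh := (isOpen_extChartAt_source (I := 𝓡∂ n) x).mem_nhds hps
  have h1 : ContinuousAt (u ∘ extChartAt (𝓡∂ n) x) p :=
    (huc.comp (continuousOn_extChartAt x) (extChartAt (𝓡∂ n) x).mapsTo).continuousAt hnh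
  exact h1.congr (Filter.eventuallyEq_of_mem hnh fun q hq => (indicator_of_mem hq _).symm)

theorem contMDiff_chartExtend {x : S} {K : Set (EuclideanSpace ℝ (Fin n))} (hK : IsCompact K)
    (hKt : K ⊆ (extChartAt (𝓡∂ n) x).target) {u : EuclideanSpace ℝ (Fin n) → V}
    (hu : ∀ y ∉ K, u y = 0) (huc : ContDiff ℝ ∞ u) :
    ContMDiff (𝓡∂ n) 𝓘(ℝ, V) ∞ (chartExtend x u) := by
  refine contMDiff_of_tsupport fun p hp => ?_
  have hps := tsupport_subset_source hK hKt (fun p hp => chartExtend_eq_zero x hu hp) hp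
  have hnh := (isOpen_extChartAt_source (I := 𝓡∂ n) x).mem_nhds hps
  have h1 : ContMDiffAt (𝓡∂ n) 𝓘(ℝ, V) ∞ (u ∘ extChartAt (𝓡∂ n) x) p :=
    huc.contMDiff.contMDiffAt.comp p (contMDiffAt_extChartAt' (by rwa [← extChartAt_source (𝓡∂ n)]))
  exact h1.congr_of_eventuallyEq (Filter.eventuallyEq_of_mem hnh fun q hq => indicator_of_mem hq _)

variable {ι N : S → E n}

/-- The tangential gradient of a function given in the chart at `x`. -/
def chartGradient (ι : S → E n) (x : S) (g : EuclideanSpace ℝ (Fin n) → ℝ)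
    (y : EuclideanSpace ℝ (Fin n)) : E n :=
  ∑ i, ∑ j, ((Matrix.gram ℝ (chartFrame ι x y))⁻¹ i j *
    fderiv ℝ g y (EuclideanSpace.single i 1)) • chartFrame ι x y j

theorem inner_chartGradient (hι : IsSmoothImmersion ι) {x : S}
    (g : EuclideanSpace ℝ (Fin n) → ℝ) {y : EuclideanSpace ℝ (Fin n)}
    (hy : y ∈ (extChartAt (𝓡∂ n) x).target) (u : EuclideanSpace ℝ (Fin n)) :
    inner ℝ (chartGradient ι x g y) (chartDeriv ι x y u) = fderiv ℝ g y u := by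
  have hind := linearIndependent_chartFrame hι hy
  let b := (EuclideanSpace.basisFun (Fin n) ℝ).toBasis
  have : (innerSL ℝ (chartGradient ι x g y)).toLinearMap ∘ₗ (chartDeriv ι x y).toLinearMap =
      (fderiv ℝ g y).toLinearMap := by
    refine b.ext fun l => ?_
    have hb : b l = EuclideanSpace.single l 1 := by simp [b]
    rw [hb]
    change inner ℝ (chartGradient ι x g y) (chartFrame ι x y l) = _
    simp only [chartGradient, sum_inner, inner_smul_left, conj_trivial]
    calc ∑ i, ∑ j, (Matrix.gram ℝ (chartFrame ι x y))⁻¹ i j *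
          fderiv ℝ g y (EuclideanSpace.single i 1) *
            inner ℝ (chartFrame ι x y j) (chartFrame ι x y l)
        = ∑ i, fderiv ℝ g y (EuclideanSpace.single i 1) *
            ∑ j, (Matrix.gram ℝ (chartFrame ι x y))⁻¹ i j *
              inner ℝ (chartFrame ι x y l) (chartFrame ι x y j) := by
          simp only [Finset.mul_sum]
          refine Finset.sum_congr rfl fun i _ => Finset.sum_congr rfl fun j _ => ?_
          rw [real_inner_comm]; ring
      _ = _ := by simp [sum_gram_inv_mul_inner hind]
  exact congrArg (fun L : EuclideanSpace ℝ (Fin n) →ₗ[ℝ] ℝ => L u) this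

/-- Makes a test function in coordinates an admissible function for radial variations: inside the
chart the inverse metric raises the index of dg, and outside everything vanishes. -/
theorem isGradient_chartExtend (hι : IsSmoothImmersion ι) (hN : IsUnitNormal ι N) {x : S}
    {g : EuclideanSpace ℝ (Fin n) → ℝ} (hg : ContDiff ℝ ∞ g) (hgc : HasCompactSupport g)
    (hgt : tsupport g ⊆ (extChartAt (𝓡∂ n) x).target) :
    IsGradient ι N (chartExtend x g) (chartExtend x (chartGradient ι x g)) := by
  have hg0 : ∀ y ∉ tsupport g, g y = 0 := fun y hy => image_eq_zero_of_notMem_tsupport hy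
  have hZ0 : ∀ y ∉ tsupport g, chartGradient ι x g y = 0 := fun y hy => by
    have h2 : fderiv ℝ g y = 0 :=
      image_eq_zero_of_notMem_tsupport fun h => hy (tsupport_fderiv_subset ℝ h)
    simp [chartGradient, h2]
  have hsm := contMDiff_chartExtend hgc hgt hg0 hg
  have hG0 : ∀ y ∈ (extChartAt (𝓡∂ n) x).target,
      (Matrix.gram ℝ (chartFrame ι x y)).det ≠ 0 :=
    fun y hy => (det_gram_pos (linearIndependent_chartFrame hι hy)).ne'
  have hmem : ∀ p ∈ (extChartAt (𝓡∂ n) x).source, ∃ y ∈ (extChartAt (𝓡∂ n) x).target,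
      (extChartAt (𝓡∂ n) x).symm y = p := fun p hp =>
    ⟨_, (extChartAt (𝓡∂ n) x).map_source hp, (extChartAt (𝓡∂ n) x).left_inv hp⟩
  refine ⟨hsm, continuous_chartExtend hgc hgt hZ0 ?_, fun p => ?_, fun p v => ?_⟩
  · refine continuousOn_finsetSum _ fun i _ => continuousOn_finsetSum _ fun j _ => ?_
    refine ((contDiffOn_inv_apply (contDiffOn_gram hι.smooth x) hG0 i j).continuousOn.mul
      ((hg.continuous_fderiv (by simp)).clm_apply continuous_const).continuousOn).smul
      (contDiffOn_chartFrame hι.smooth x j).continuousOn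
  · by_cases hp : p ∈ (extChartAt (𝓡∂ n) x).source
    · obtain ⟨y, hy, rfl⟩ := hmem p hp
      rw [chartExtend_symm x _ hy, chartGradient, sum_inner]
      refine Finset.sum_eq_zero fun i _ => ?_
      rw [sum_inner]
      refine Finset.sum_eq_zero fun j _ => ?_
      rw [inner_smul_left, chartFrame_eq hι.smooth hy, real_inner_comm, (hN _).2, mul_zero]
    · rw [chartExtend, indicator_of_notMem hp, inner_zero_left]
  · by_cases hp : p ∈ (extChartAt (𝓡∂ n) x).source
    · obtain ⟨y, hy, rfl⟩ := hmem p hp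
      obtain ⟨e, he⟩ := chartSymmDeriv_isInvertible hy
      obtain ⟨u, hu⟩ : ∃ u, chartSymmDeriv x y u = v := by
        rw [← he]; exact e.surjective v
      have h1 := chartDeriv_eq hsm hy u
      have h2 := chartDeriv_eq hι.smooth hy u
      rw [hu] at h1 h2
      have h3 : chartDeriv (chartExtend x g) x y = fderiv ℝ g y := by
        have a : HasFDerivWithinAt g (fderiv ℝ g y) (range (𝓡∂ n)) y :=
          (hg.differentiable (by simp) y).hasFDerivAt.hasFDerivWithinAt
        have hev : ∀ z ∈ (extChartAt (𝓡∂ n) x).target,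
            (chartExtend x g ∘ (extChartAt (𝓡∂ n) x).symm) z = g z := fun z hz =>
          chartExtend_symm x g hz
        refine HasFDerivWithinAt.fderivWithin (a.congr_of_eventuallyEq ?_ (hev y hy))
          (uniqueDiffWithinAt_range hy)
        rw [← nhdsWithin_target_eq hy]
        exact Filter.eventuallyEq_of_mem self_mem_nhdsWithin hev
      rw [chartExtend_symm x _ hy]
      refine Eq.trans ?_ h1
      rw [h3, ← inner_chartGradient hι g hy u, h2]
      rfl
    · have hp' : p ∉ (extChartAt (𝓡∂ n) x).symm '' tsupport g := by
        rintro ⟨y, hy, rfl⟩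
        exact hp ((extChartAt (𝓡∂ n) x).map_target (hgt hy))
      have hev : chartExtend x g =ᶠ[𝓝 p] fun _ => 0 :=
        Filter.eventuallyEq_of_mem ((isClosed_image_symm hgc hgt).isOpen_compl.mem_nhds hp')
          fun q hq => chartExtend_eq_zero x hg0 hq
      rw [hev.mfderiv_eq, mfderiv_const, chartExtend_eq_zero x hZ0 hp', inner_zero_left]
      rfl

end ChartExtension

/-! ### The Lagrange multiplier and the pointwise stationarity equation. -/

section Stationary

variable {n : ℕ} [NeZero n] {S : Type*} [TopologicalSpace S]
  [ChartedSpace (EuclideanHalfSpace n) S] [IsManifold (𝓡∂ n) ∞ S] [T2Space S] [CompactSpace S]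
  {ι N : S → E n} {M U : Set (E n)} {k : ℝ} {f F : E n → ℝ}

/-- Euler's identity. -/
theorem IsHomogeneousExtension.fderiv_self (hF : IsHomogeneousExtension M k f U F) {p : E n}
    (hp : p ∈ U) : fderiv ℝ F p p = k * F p := by
  have h1 : HasFDerivAt F (fderiv ℝ F p) ((1 : ℝ) • p) := by
    rw [one_smul]
    exact ((hF.smooth.differentiableOn (by simp)).differentiableAt
      (hF.isOpen.mem_nhds hp)).hasFDerivAt
  have h2 : HasDerivAt (fun t : ℝ => t • p) p 1 := by
    simpa using (hasDerivAt_id (1 : ℝ)).smul_const p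
  have h3 := h1.comp_hasDerivAt (1 : ℝ) h2
  have h4 : HasDerivAt (fun t : ℝ => t ^ k * F p) (k * F p) 1 := by
    simpa using (Real.hasDerivAt_rpow_const (x := 1) (p := k) (Or.inl one_ne_zero)).mul_const (F p)
  refine h3.unique (h4.congr_of_eventuallyEq ?_)
  filter_upwards [lt_mem_nhds (zero_lt_one (α := ℝ))] with t ht using hF.homogeneous p hp t ht

theorem IsHomogeneousExtension.apply_eq (hF : IsHomogeneousExtension M k f U F)
    (hS : IsHypersurface M ι N) (p : S) : F (ι p) = f (ι p) := hF.eqOn (hS.mapsTo p)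

/-- Were the integral zero, pure dilation (h = 1) would preserve volume, and stationarity would
force n+k times the positive weighted area to vanish. -/
theorem IsStationary.areaIntegral_inner_ne_zero [Nonempty S] (hM : IsSolidCone M)
    (hf : IsHomogeneousDensity M k f) (hS : IsHypersurface M ι N)
    (hstat : IsStationary M k f ι N) (hk : (n : ℝ) + k + 1 ≠ 0) (hk' : (n : ℝ) + k ≠ 0) :
    areaIntegral ι (fun p => inner ℝ (ι p) (N p) * f (ι p)) ≠ 0 := by
  intro h0
  have := hstat.areaIntegral_eq_zero hM hf hS hk (isGradient_const 1) (by simpa using h0)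
  simp only [mul_one, inner_zero_left, add_zero] at this
  rw [areaIntegral_const_mul] at this
  exact (areaIntegral_pos hS.immersion
    (hf.continuous_comp hS.immersion.smooth.continuous hS.mapsTo)
    fun p => hf.pos _ (hS.mapsTo p)).ne' ((mul_eq_zero.1 this).resolve_left hk')

/-- The Lagrange multiplier of a stationary hypersurface. -/
def multiplier [Nonempty S] (k : ℝ) (f : E n → ℝ) (ι N : S → E n) : ℝ :=
  -((n + k) * weightedArea f ι) / areaIntegral ι (fun p => inner ℝ (ι p) (N p) * f (ι p))

/-- Subtracting the constant c that makes g - c admissible leaves the gradient alone. It costs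
(n+k)c times the area, which is exactly what the multiplier term accounts for. -/
theorem IsStationary.weak_equation [Nonempty S] (hM : IsSolidCone M)
    (hf : IsHomogeneousDensity M k f) (hS : IsHypersurface M ι N)
    (hstat : IsStationary M k f ι N) (hk : (n : ℝ) + k + 1 ≠ 0) (hk' : (n : ℝ) + k ≠ 0)
    {g : S → ℝ} {Z : S → E n} (hZ : IsGradient ι N g Z) :
    areaIntegral ι (fun p => ((n + k) * g p + inner ℝ (Z p) (ι p) +
      multiplier k f ι N * (g p * inner ℝ (ι p) (N p))) * f (ι p)) = 0 := by
  have hI := hstat.areaIntegral_inner_ne_zero hM hf hS hk hk'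
  have hι := hS.immersion
  have hι' := hι.smooth.continuous
  have hN' := hS.smooth_normal.continuous
  have hZ' := hZ.continuous
  have hg' := hZ.smooth.continuous
  have hf' := hf.continuous_comp hι' hS.mapsTo
  have hu : Continuous fun p => inner ℝ (ι p) (N p) * f (ι p) := (hι'.inner hN').mul hf'
  have hgu : Continuous fun p => g p * (inner ℝ (ι p) (N p) * f (ι p)) := hg'.mul hu
  have hA : Continuous fun p => ((n + k) * g p + inner ℝ (Z p) (ι p)) * f (ι p) :=
    Continuous.mul (by fun_prop) hf'
  have hcu : ∀ c : ℝ, Continuous fun p => c * (inner ℝ (ι p) (N p) * f (ι p)) :=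
    fun c => continuous_const.mul hu
  have hcf : ∀ c : ℝ, Continuous fun p => c * f (ι p) := fun c => continuous_const.mul hf'
  have hcgu : ∀ c : ℝ, Continuous fun p => c * (g p * (inner ℝ (ι p) (N p) * f (ι p))) :=
    fun c => continuous_const.mul hgu
  set I := areaIntegral ι fun p => inner ℝ (ι p) (N p) * f (ι p) with hIdef
  set c := areaIntegral ι (fun p => g p * (inner ℝ (ι p) (N p) * f (ι p))) / I with hc
  have h1 := hstat.areaIntegral_eq_zero hM hf hS hk (hZ.sub_const c) (by
    have e : ∀ p, (g p - c) * (inner ℝ (ι p) (N p) * f (ι p)) =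
      g p * (inner ℝ (ι p) (N p) * f (ι p)) + (-c) * (inner ℝ (ι p) (N p) * f (ι p)) :=
        fun p => by ring
    simp only [e]
    rw [areaIntegral_add hι hgu (hcu _), areaIntegral_const_mul, hc, ← hIdef]
    field_simp
    ring)
  have e : ∀ p, ((n + k) * (g p - c) + inner ℝ (Z p) (ι p)) * f (ι p) =
      ((n + k) * g p + inner ℝ (Z p) (ι p)) * f (ι p) + (-((n + k) * c)) * f (ι p) :=
    fun p => by ring
  simp only [e] at h1
  rw [areaIntegral_add hι hA (hcf _), areaIntegral_const_mul] at h1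
  have e2 : ∀ p, ((n + k) * g p + inner ℝ (Z p) (ι p) +
      multiplier k f ι N * (g p * inner ℝ (ι p) (N p))) * f (ι p) =
      ((n + k) * g p + inner ℝ (Z p) (ι p)) * f (ι p) +
        multiplier k f ι N * (g p * (inner ℝ (ι p) (N p) * f (ι p))) := fun p => by ring
  simp only [e2]
  rw [areaIntegral_add hι hA (hcgu _), areaIntegral_const_mul]
  have e3 : multiplier k f ι N * areaIntegral ι (fun p => g p * (inner ℝ (ι p) (N p) * f (ι p))) =
      -((n + k) * c) * areaIntegral ι fun p => f (ι p) := by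
    rw [multiplier, ← hIdef, hc, weightedArea]
    field_simp
  rw [e3, h1]

/-- The trace of the shape operator and the logarithmic normal derivative of the density, in the
chart at `x`: this is `-H_f`. -/
def chartMeanCurvature (F : E n → ℝ) (ι N : S → E n) (x : S)
    (y : EuclideanSpace ℝ (Fin n)) : ℝ :=
  (shapeMatrix (chartFrame ι x y) (chartFrame N x y)).trace +
    fderiv ℝ F (ι ((extChartAt (𝓡∂ n) x).symm y)) (N ((extChartAt (𝓡∂ n) x).symm y)) /
      F (ι ((extChartAt (𝓡∂ n) x).symm y))

theorem chartFrame_eq_frame {φ : S → E n} {x : S} {y : EuclideanSpace ℝ (Fin n)}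
    (hy : y ∈ interior (range (𝓡∂ n))) :
    chartFrame φ x y = frame (φ ∘ (extChartAt (𝓡∂ n) x).symm) y := by
  ext1 i
  rw [chartFrame, chartDeriv, fderivWithin_of_mem_nhds (mem_interior_iff_mem_nhds.1 hy)]
  rfl

theorem continuousOn_shapeMatrix (hS : IsHypersurface M ι N) (x : S) (i j : Fin n) :
    ContinuousOn (fun y => shapeMatrix (chartFrame ι x y) (chartFrame N x y) i j)
      (extChartAt (𝓡∂ n) x).target := by
  have hι := hS.immersion
  simp only [shapeMatrix, Matrix.mul_apply]
  refine continuousOn_finsetSum _ fun l _ => ContinuousOn.mul ?_ ?_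
  · exact ((contDiffOn_chartFrame hS.smooth_normal x i).inner ℝ
      (contDiffOn_chartFrame hι.smooth x l)).continuousOn
  · exact (contDiffOn_inv_apply (contDiffOn_gram hι.smooth x)
      (fun y hy => (det_gram_pos (linearIndependent_chartFrame hι hy)).ne') l j).continuousOn

theorem IsHypersurface.continuous_comp {G : E n → ℝ} (hS : IsHypersurface M ι N)
    (hF : IsHomogeneousExtension M k f U F) (hG : ContinuousOn G U) :
    Continuous fun p => G (ι p) :=
  hG.comp_continuous hS.immersion.smooth.continuous fun p => hF.subset (hS.mapsTo p)

theorem continuousOn_chartMeanCurvature (hS : IsHypersurface M ι N)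
    (hF : IsHomogeneousExtension M k f U F) (x : S) :
    ContinuousOn (chartMeanCurvature F ι N x) (extChartAt (𝓡∂ n) x).target := by
  refine ContinuousOn.add ?_ ?_
  · simp only [Matrix.trace, Matrix.diag_apply]
    exact continuousOn_finsetSum _ fun i _ => continuousOn_shapeMatrix hS x i i
  · have h1 : Continuous fun p => F (ι p) := hS.continuous_comp hF hF.smooth.continuousOn
    have h2 : Continuous fun p => fderiv ℝ F (ι p) (N p) :=
      ((hF.smooth.continuousOn_fderiv_of_isOpen hF.isOpen (by simp)).comp_continuous
        hS.immersion.smooth.continuous fun p => hF.subset (hS.mapsTo p)).clm_apply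
          hS.smooth_normal.continuous
    exact (continuousOn_comp_chart h2 x).div (continuousOn_comp_chart h1 x)
      fun y _ => (hF.pos _ (hF.subset (hS.mapsTo _))).ne'

/-- The stationarity equation `(H_f - H) ⟨X, N⟩ = 0` at every point of the hypersurface. -/
theorem IsStationary.inner_mul_eq_zero [Nonempty S] (hM : IsSolidCone M)
    (hf : IsHomogeneousDensity M k f) (hS : IsHypersurface M ι N)
    (hstat : IsStationary M k f ι N) (hk : (n : ℝ) + k + 1 ≠ 0) (hk' : (n : ℝ) + k ≠ 0)
    (hF : IsHomogeneousExtension M k f U F) (x : S) {y : EuclideanSpace ℝ (Fin n)}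
    (hy : y ∈ (extChartAt (𝓡∂ n) x).target) :
    inner ℝ (ι ((extChartAt (𝓡∂ n) x).symm y)) (N ((extChartAt (𝓡∂ n) x).symm y)) *
      (multiplier k f ι N + chartMeanCurvature F ι N x y) = 0 := by
  set Ω := (extChartAt (𝓡∂ n) x).target ∩ interior (range (𝓡∂ n)) with hΩdef
  have hι := hS.immersion
  have hι' := hι.smooth.continuous
  have hN' := hS.smooth_normal.continuous
  have hf' := hf.continuous_comp hι' hS.mapsTo
  have hΩ : IsOpen Ω := isOpen_target_inter_interior x
  have hφ : ContDiffOn ℝ ∞ (ι ∘ (extChartAt (𝓡∂ n) x).symm) Ω :=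
    (contDiffOn_chart hι.smooth x).mono inter_subset_left
  have hν : ContDiffOn ℝ ∞ (N ∘ (extChartAt (𝓡∂ n) x).symm) Ω :=
    (contDiffOn_chart hS.smooth_normal x).mono inter_subset_left
  have hfr : ∀ (φ : S → E n), ∀ z ∈ Ω, frame (φ ∘ (extChartAt (𝓡∂ n) x).symm) z =
      chartFrame φ x z := fun φ z hz => (chartFrame_eq_frame hz.2).symm
  have hind : ∀ z ∈ Ω, LinearIndependent ℝ (frame (ι ∘ (extChartAt (𝓡∂ n) x).symm) z) :=
    fun z hz => by rw [hfr ι z hz]; exact linearIndependent_chartFrame hι hz.1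
  -- the equation holds in the interior
  have hint : ∀ z ∈ Ω,
      inner ℝ (ι ((extChartAt (𝓡∂ n) x).symm z)) (N ((extChartAt (𝓡∂ n) x).symm z)) *
        (multiplier k f ι N + chartMeanCurvature F ι N x z) = 0 := by
    intro z hz
    have := inner_mul_eq_zero_of_weak hΩ hφ hν (fun z _ => (hS.unit_normal _).1)
      (fun z hz i => by
        rw [hfr ι z hz, chartFrame_eq hι.smooth hz.1]; exact (hS.unit_normal _).2 _)
      hind hF.isOpen hF.smooth hF.pos (fun p hp => hF.fderiv_self hp)
      (fun z _ => hF.subset (hS.mapsTo _)) (multiplier k f ι N) ?_ hz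
    · rw [hfr ι z hz, hfr N z hz, ← trace_shapeMatrix] at this
      exact this
    · intro g hg hgc hgΩ
      have hgt : tsupport g ⊆ (extChartAt (𝓡∂ n) x).target := hgΩ.trans inter_subset_left
      have hgrad := isGradient_chartExtend hι hS.unit_normal hg hgc hgt
      have hweak := hstat.weak_equation hM hf hS hk hk' hgrad
      have hg0 : ∀ y ∉ tsupport g, g y = 0 := fun y hy => image_eq_zero_of_notMem_tsupport hy
      have hdg0 : ∀ y ∉ tsupport g, fderiv ℝ g y = 0 := fun y hy =>
        image_eq_zero_of_notMem_tsupport fun h => hy (tsupport_fderiv_subset ℝ h)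
      have hZ0 : ∀ y ∉ tsupport g, chartGradient ι x g y = 0 := fun y hy => by
        simp [chartGradient, hdg0 y hy]
      have hgc' := hgrad.smooth.continuous
      have hZc := hgrad.continuous
      have hcont : Continuous fun p => ((n + k) * chartExtend x g p +
          inner ℝ (chartExtend x (chartGradient ι x g) p) (ι p) +
          multiplier k f ι N * (chartExtend x g p * inner ℝ (ι p) (N p))) * f (ι p) :=
        Continuous.mul (by fun_prop) hf'
      -- The integrand is supported in one chart, so the partition of unity disappears and the weak
      -- equation becomes a single Euclidean integral.
      rw [areaIntegral_eq_of_tsupport hι hcont x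
        (tsupport_subset_source hgc hgt fun p hp => by
          rw [chartExtend_eq_zero x hg0 hp, chartExtend_eq_zero x hZ0 hp]; simp)] at hweak
      rw [← hweak, ← setIntegral_eq_integral_of_forall_compl_eq_zero
        (s := (extChartAt (𝓡∂ n) x).target)
        fun y hy => weakIntegrand_eq_zero _ _ _ fun h => hy (hgt h)]
      refine setIntegral_congr_fun (measurableSet_target x) fun z hz => ?_
      simp only [chartExtend_symm x _ hz]
      by_cases hzg : z ∈ tsupport g
      · rw [weakIntegrand, hfr ι z (hgΩ hzg), areaDensity_eq, chartGradient, sum_inner]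
        simp only [Function.comp_apply, hF.apply_eq hS, sum_inner, inner_smul_left, conj_trivial]
        rw [mul_assoc]
        congr 3
        exact Finset.sum_congr rfl fun i _ => Finset.sum_congr rfl fun j _ => by
          rw [real_inner_comm]
      · rw [weakIntegrand_eq_zero _ _ _ hzg, hg0 z hzg, hZ0 z hzg]
        simp
  -- and extends to the boundary by continuity
  have hc : ContinuousOn (fun z =>
      inner ℝ (ι ((extChartAt (𝓡∂ n) x).symm z)) (N ((extChartAt (𝓡∂ n) x).symm z)) *
        (multiplier k f ι N + chartMeanCurvature F ι N x z)) (extChartAt (𝓡∂ n) x).target :=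
    (continuousOn_comp_chart (hι'.inner hN') x).mul
      (continuousOn_const.add (continuousOn_chartMeanCurvature hS hF x))
  have hne := mem_closure_iff_nhdsWithin_neBot.1 (mem_closure_target_inter_interior hy)
  have h1 := (hc y hy).mono inter_subset_left (s := Ω)
  have h2 : Filter.Tendsto (fun z =>
      inner ℝ (ι ((extChartAt (𝓡∂ n) x).symm z)) (N ((extChartAt (𝓡∂ n) x).symm z)) *
        (multiplier k f ι N + chartMeanCurvature F ι N x z)) (𝓝[Ω] y) (𝓝 0) :=
    tendsto_const_nhds.congr' (Filter.eventuallyEq_of_mem self_mem_nhdsWithin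
      fun z hz => (hint z hz).symm)
  exact tendsto_nhds_unique h1 h2

end Stationary

/-! ### Unique differentiability on the cone and extension of the density. -/

section ConeGeometry

variable {n : ℕ} {M : Set (E n)} {k : ℝ} {f : E n → ℝ}

theorem norm_of_mem_sphere {D : Set (E n)} (hD : IsSmoothRegion D) {p : E n} (hp : p ∈ D) :
    ‖p‖ = 1 := by simpa using hD.subset_sphere hp

theorem mem_coneOver_iff {D : Set (E n)} (hD : IsSmoothRegion D) {p : E n} (hp : p ≠ 0) :
    p ∈ coneOver D ↔ ‖p‖⁻¹ • p ∈ D := by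
  have hp' : 0 < ‖p‖ := norm_pos_iff.2 hp
  constructor
  · rintro ⟨t, ht, d, hd, rfl⟩
    have ht0 : t ≠ 0 := fun h => hp (by simp [h])
    rw [norm_smul, norm_of_mem_sphere hD hd, mul_one, Real.norm_of_nonneg ht,
      inv_smul_smul₀ ht0]
    exact hd
  · intro h
    exact ⟨‖p‖, hp'.le, _, h, (smul_inv_smul₀ hp'.ne' p).symm⟩

theorem contDiffAt_normalize {p : E n} (hp : p ≠ 0) :
    ContDiffAt ℝ ∞ (fun q : E n => ‖q‖⁻¹ • q) p :=
  ((contDiffAt_norm ℝ hp).inv (norm_ne_zero_iff.2 hp)).smul contDiffAt_id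

theorem normalize_smul {p : E n} {t : ℝ} (ht : 0 < t) : ‖t • p‖⁻¹ • t • p = ‖p‖⁻¹ • p := by
  rw [norm_smul, Real.norm_of_nonneg ht.le, smul_smul, mul_inv, mul_comm t⁻¹, mul_assoc,
    inv_mul_cancel₀ ht.ne', mul_one]

/-- A solid cone has unique derivatives away from its vertex. -/
theorem IsSolidCone.uniqueDiffWithinAt (hM : IsSolidCone M) {p : E n} (hp : p ∈ M \ {0}) :
    UniqueDiffWithinAt ℝ M p := by
  obtain ⟨D, hD, rfl⟩ := hM
  have hp0 : p ≠ 0 := hp.2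
  have hn : 0 < ‖p‖ := norm_pos_iff.2 hp0
  set r : E n → E n := fun q => ‖q‖⁻¹ • q with hr
  have hrD : r p ∈ D := (mem_coneOver_iff hD hp0).1 hp.1
  have hne : ∀ᶠ q in 𝓝 p, q ≠ 0 := isOpen_ne.mem_nhds hp0
  have hrs : ∀ q : E n, q ≠ 0 → r q ∈ Metric.sphere (0 : E n) 1 := fun q hq => by
    rw [mem_sphere_zero_iff_norm, hr]
    simp only [norm_smul, norm_inv, norm_norm]
    exact inv_mul_cancel₀ (norm_ne_zero_iff.2 hq)
  have hrc : ContinuousAt r p := (contDiffAt_normalize hp0).continuousAt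
  by_cases hi : r p ∈ relInterior D
  · have h1 : Filter.Tendsto r (𝓝 p) (𝓝[Metric.sphere (0 : E n) 1] (r p)) :=
      tendsto_nhdsWithin_iff.2 ⟨hrc, hne.mono hrs⟩
    have h2 : coneOver D ∈ 𝓝 p := by
      filter_upwards [h1 hi.2, hne] with q hq hq0 using (mem_coneOver_iff hD hq0).2 hq
    exact uniqueDiffWithinAt_of_mem_nhds h2
  · obtain ⟨W, g, hW, hpW, hg, hg0, ⟨v, hv, hgv⟩, hWD⟩ := hD.smooth_boundary _ hrD hi
    have hgd : HasFDerivAt g (fderiv ℝ g (r p)) (r p) :=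
      ((hg.differentiableOn (by simp)).differentiableAt (hW.mem_nhds hpW)).hasFDerivAt
    have hrd : HasFDerivAt r (fderiv ℝ r p) p :=
      ((contDiffAt_normalize hp0).differentiableAt (by simp)).hasFDerivAt
    set L := (fderiv ℝ g (r p)).comp (fderiv ℝ r p) with hL
    have hGd : HasFDerivAt (g ∘ r) L p := hgd.comp p hrd
    -- the differential of the normalisation on vectors tangent to the sphere
    have hpv : inner ℝ p v = 0 := by
      have h1 := hv
      simp only [hr, inner_smul_left, conj_trivial] at h1
      exact (mul_eq_zero.1 h1).resolve_left (inv_ne_zero hn.ne')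
    have hline : ∀ w : E n, HasDerivAt (fun t : ℝ => p + t • w) w 0 := fun w => by
      simpa using ((hasDerivAt_id (0 : ℝ)).smul_const w).const_add p
    have hrv : fderiv ℝ r p v = ‖p‖⁻¹ • v := by
      have h1 : HasDerivAt (fun t : ℝ => ‖p + t • v‖) 0 0 := by
        have := (hline v).norm_sq.sqrt (by simpa using hp0)
        simpa [hpv, Real.sqrt_sq (norm_nonneg _)] using this
      have h2 := (h1.inv (by simpa using hp0)).smul (hline v)
      have h3 : HasDerivAt (fun t : ℝ => r (p + t • v)) (fderiv ℝ r p v) 0 := by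
        have hrd' : HasFDerivAt r (fderiv ℝ r p) (p + (0 : ℝ) • v) := by simpa using hrd
        exact hrd'.comp_hasDerivAt (0 : ℝ) (hline v)
      have h4 := h3.unique h2
      simpa using h4
    have hLv : L v ≠ 0 := by
      rw [hL, ContinuousLinearMap.comp_apply, hrv, map_smul]
      exact smul_ne_zero (inv_ne_zero hn.ne') hgv
    -- Moving in a direction with L w < 0 makes the defining function negative, so this open
    -- half-space lies in the tangent cone; being open and nonempty, it spans.
    set C : Set (E n) := {w | L w < 0} with hC
    have hCo : IsOpen C := isOpen_lt L.continuous continuous_const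
    have hCne : C.Nonempty := by
      rcases lt_or_gt_of_ne hLv with h | h
      · exact ⟨v, h⟩
      · exact ⟨-v, by simpa [hC] using h⟩
    have hCt : C ⊆ tangentConeAt ℝ (coneOver D) p := by
      intro w hw
      refine mem_tangentConeAt_of_add_smul_mem (l := 𝓝[>] (0 : ℝ)) (c := id) ?_ ?_
      · exact tendsto_nhdsWithin_iff.2 ⟨Filter.tendsto_id.mono_left nhdsWithin_le_nhds,
          Filter.mem_of_superset self_mem_nhdsWithin fun t ht => (ne_of_gt ht)⟩
      · have hd : HasDerivAt (fun t : ℝ => (g ∘ r) (p + t • w)) (L w) 0 := by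
          have hGd' : HasFDerivAt (g ∘ r) L (p + (0 : ℝ) • w) := by
            rw [zero_smul, add_zero]; exact hGd
          exact HasFDerivAt.comp_hasDerivAt (f := fun t : ℝ => p + t • w) (0 : ℝ) hGd' (hline w)
        have h1 : ∀ᶠ t in 𝓝[>] (0 : ℝ), (g ∘ r) (p + t • w) < 0 := by
          have := (hasDerivWithinAt_iff_tendsto_slope' (s := Ioi (0 : ℝ)) (by simp)).1
            hd.hasDerivWithinAt
          filter_upwards [this (Iio_mem_nhds hw), self_mem_nhdsWithin] with t ht ht0
          have ht' : slope (fun t : ℝ => (g ∘ r) (p + t • w)) 0 t < 0 := ht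
          have ht0' : (0 : ℝ) < t := ht0
          rw [slope_def_field] at ht'
          simp only [zero_smul, add_zero, sub_zero, Function.comp_apply, hg0] at ht'
          rwa [div_lt_iff₀ ht0', zero_mul] at ht'
        have hlc : Filter.Tendsto (fun t : ℝ => p + t • w) (𝓝[>] 0) (𝓝 p) := by
          have := (hline w).continuousAt.tendsto
          simp only [zero_smul, add_zero] at this
          exact this.mono_left nhdsWithin_le_nhds
        filter_upwards [h1, hlc.eventually hne, hlc.eventually (hrc.eventually (hW.mem_nhds hpW))]
          with t ht ht0 htW
        exact (mem_coneOver_iff hD ht0).2 ((hWD _ ⟨htW, hrs _ ht0⟩).2 ht.le)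
    refine ⟨?_, subset_closure hp.1⟩
    have htop : Submodule.span ℝ (tangentConeAt ℝ (coneOver D) p) = ⊤ := by
      refine Submodule.eq_top_of_nonempty_interior' _ ?_
      exact hCne.mono (interior_maximal (hCt.trans Submodule.subset_span) hCo)
    rw [htop]
    exact dense_univ

/-- A local smooth extension g need not be homogeneous, so only its values at p/|p| are kept and the
extension is |p|^k g(p/|p|), over the directions where g is positive. -/
theorem IsHomogeneousDensity.exists_extension (hM : IsSolidCone M)
    (hf : IsHomogeneousDensity M k f) :
    ∃ (U : Set (E n)) (F : E n → ℝ), IsHomogeneousExtension M k f U F := by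
  obtain ⟨W, g, hW, hMW, hg, he⟩ := hf.smooth
  set W' := W ∩ g ⁻¹' Ioi 0 with hW'
  have hW'o : IsOpen W' := hg.continuousOn.isOpen_inter_preimage hW isOpen_Ioi
  set r : E n → E n := fun q => ‖q‖⁻¹ • q with hr
  have hrc : ContinuousOn r {0}ᶜ := fun q hq =>
    (contDiffAt_normalize hq).continuousAt.continuousWithinAt
  set U : Set (E n) := {0}ᶜ ∩ r ⁻¹' W' with hU
  have hUo : IsOpen U := hrc.isOpen_inter_preimage isOpen_compl_singleton hW'o
  have hnp : ∀ p ∈ U, 0 < ‖p‖ := fun p hp => norm_pos_iff.2 hp.1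
  have hrM : ∀ p ∈ M \ {0}, r p ∈ M \ {0} := fun p hp => by
    have h0 : p ≠ 0 := hp.2
    have h1 : 0 < ‖p‖⁻¹ := inv_pos.2 (norm_pos_iff.2 h0)
    exact ⟨hM.smul_mem hp.1 h1, smul_ne_zero h1.ne' h0⟩
  refine ⟨U, fun p => ‖p‖ ^ k * g (r p), hUo, fun p hp => ⟨hp.2, hMW (hrM p hp), ?_⟩, ?_, ?_, ?_,
    ?_, ?_⟩
  · rw [mem_preimage, ← he (hrM p hp)]; exact hf.pos _ (hrM p hp)
  · intro p hp t ht
    refine ⟨smul_ne_zero ht.ne' hp.1, ?_⟩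
    rw [mem_preimage, hr]
    simp only [normalize_smul ht]
    exact hp.2
  · intro p hp
    have h0 : p ≠ 0 := hp.2
    have h1 : 0 < ‖p‖ := norm_pos_iff.2 h0
    simp only
    rw [← he (hrM p hp), ← hf.homogeneous _ (hrM p hp) _ h1, hr]
    simp only
    rw [smul_inv_smul₀ h1.ne']
  · intro p hp
    have h0 : p ≠ 0 := hp.1
    refine ContDiffAt.contDiffWithinAt (ContDiffAt.mul ?_ ?_)
    · exact (contDiffAt_norm ℝ h0).rpow_const_of_ne (hnp p hp).ne'
    · exact (hg.contDiffAt (hW.mem_nhds hp.2.1)).comp p (contDiffAt_normalize h0)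
  · intro p hp
    exact mul_pos (Real.rpow_pos_of_pos (hnp p hp) k) hp.2.2
  · intro p hp t ht
    simp only [hr, normalize_smul ht]
    rw [norm_smul, Real.norm_of_nonneg ht.le, Real.mul_rpow ht.le (norm_nonneg p), mul_assoc]

end ConeGeometry

/-! ### Geometry of parallel hypersurfaces. -/

section Parallel

variable {n : ℕ} [NeZero n] {S : Type*} [TopologicalSpace S]
  [ChartedSpace (EuclideanHalfSpace n) S] [IsManifold (𝓡∂ n) ∞ S] [T2Space S] [CompactSpace S]
  {ι N : S → E n} {M U : Set (E n)} {k : ℝ} {f F : E n → ℝ}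

theorem symm_extChartAt_self (p : S) :
    (extChartAt (𝓡∂ n) p).symm (extChartAt (𝓡∂ n) p p) = p :=
  (extChartAt (𝓡∂ n) p).left_inv (mem_extChartAt_source p)

/-- Differentiate |N|² = 1; at the edge of the half-space uniqueness of the derivative within it is
used. -/
theorem inner_chartDeriv_normal (hN : ContMDiff (𝓡∂ n) 𝓘(ℝ, E n) ∞ N) (hN1 : ∀ p, ‖N p‖ = 1)
    {x : S} {y : EuclideanSpace ℝ (Fin n)} (hy : y ∈ (extChartAt (𝓡∂ n) x).target)
    (v : EuclideanSpace ℝ (Fin n)) :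
    inner ℝ (chartDeriv N x y v) (N ((extChartAt (𝓡∂ n) x).symm y)) = 0 := by
  have h := hasFDerivWithinAt_chart hN hy
  have h1 := h.inner ℝ h
  have h2 : HasFDerivWithinAt (fun z => inner ℝ ((N ∘ (extChartAt (𝓡∂ n) x).symm) z)
      ((N ∘ (extChartAt (𝓡∂ n) x).symm) z)) (0 : EuclideanSpace ℝ (Fin n) →L[ℝ] ℝ)
      (range (𝓡∂ n)) y := by
    have e : (fun z => inner ℝ ((N ∘ (extChartAt (𝓡∂ n) x).symm) z)
      ((N ∘ (extChartAt (𝓡∂ n) x).symm) z)) = fun _ => (1 : ℝ) := by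
      ext z
      rw [real_inner_self_eq_norm_sq, Function.comp_apply, hN1, one_pow]
    rw [e]
    exact hasFDerivWithinAt_const _ _ _
  have h3 := DFunLike.congr_fun ((uniqueDiffWithinAt_range hy).eq h1 h2) v
  simp only [ContinuousLinearMap.comp_apply, ContinuousLinearMap.prod_apply,
    fderivInnerCLM_apply, Function.comp_apply, zero_apply] at h3
  rw [real_inner_comm] at h3
  linarith

theorem inner_diff_normal (hN : ContMDiff (𝓡∂ n) 𝓘(ℝ, E n) ∞ N) (hN1 : ∀ p, ‖N p‖ = 1) (p : S)
    (v : EuclideanSpace ℝ (Fin n)) : inner ℝ (N p) (diff N p v) = 0 := by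
  have h := inner_chartDeriv_normal hN hN1 (mem_extChartAt_target (I := 𝓡∂ n) p) v
  rw [symm_extChartAt_self] at h
  rw [diff_eq_chartDeriv N hN, real_inner_comm, h]

theorem contMDiff_parallelMap (hι : ContMDiff (𝓡∂ n) 𝓘(ℝ, E n) ∞ ι)
    (hN : ContMDiff (𝓡∂ n) 𝓘(ℝ, E n) ∞ N) (c t : ℝ) :
    ContMDiff (𝓡∂ n) 𝓘(ℝ, E n) ∞ (parallelMap c ι N t) :=
  hι.add ((contMDiff_const (I := 𝓡∂ n) (I' := 𝓘(ℝ, ℝ)) (c := t * c)).smul hN)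

theorem chartDeriv_parallelMap (hι : ContMDiff (𝓡∂ n) 𝓘(ℝ, E n) ∞ ι)
    (hN : ContMDiff (𝓡∂ n) 𝓘(ℝ, E n) ∞ N) (c t : ℝ) {x : S}
    {y : EuclideanSpace ℝ (Fin n)} (hy : y ∈ (extChartAt (𝓡∂ n) x).target) :
    chartDeriv (parallelMap c ι N t) x y = chartDeriv ι x y + (t * c) • chartDeriv N x y :=
  ((hasFDerivWithinAt_chart hι hy).add ((hasFDerivWithinAt_chart hN hy).const_smul
    (t * c))).fderivWithin (uniqueDiffWithinAt_range hy)

/-- The derivatives of both ι and N are orthogonal to N, so the normal does not change along the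
parallel family. -/
theorem isUnitNormal_parallelMap (hS : IsHypersurface M ι N) (c t : ℝ) :
    IsUnitNormal (parallelMap c ι N t) N := fun p => by
  have hι := hS.immersion.smooth
  have hN := hS.smooth_normal
  refine ⟨(hS.unit_normal p).1, fun v => ?_⟩
  rw [diff_eq_chartDeriv _ (contMDiff_parallelMap hι hN c t),
    chartDeriv_parallelMap hι hN c t (mem_extChartAt_target p), ← diff_eq_chartDeriv ι hι,
    ← diff_eq_chartDeriv N hN, add_apply, smul_apply,
    inner_add_right, inner_smul_right, inner_diff_normal hN (fun p => (hS.unit_normal p).1),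
    (hS.unit_normal p).2, mul_zero, add_zero]

theorem areaDensity_parallelMap (hS : IsHypersurface M ι N) (c t : ℝ) {x : S}
    {y : EuclideanSpace ℝ (Fin n)} (hy : y ∈ (extChartAt (𝓡∂ n) x).target) :
    areaDensity (parallelMap c ι N t) x y =
      |(1 + (t * c) • shapeMatrix (chartFrame ι x y) (chartFrame N x y)).det| *
        areaDensity ι x y := by
  have hN1 := fun p => (hS.unit_normal p).1
  rw [areaDensity_eq, areaDensity_eq, ← sqrt_det_gram_add_smul_shape
    (N := N ((extChartAt (𝓡∂ n) x).symm y)) (N' := chartFrame N x y) (hN1 _)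
    (fun i => by rw [chartFrame_eq hS.immersion.smooth hy]; exact (hS.unit_normal _).2 _)
    (linearIndependent_chartFrame hS.immersion hy)
    (fun i => inner_chartDeriv_normal hS.smooth_normal hN1 hy _)]
  congr 3
  ext1 i
  rw [chartFrame, chartDeriv_parallelMap hS.immersion.smooth hS.smooth_normal c t hy]
  rfl

/-- The position, the normal and the shape operator, in the chart at `x`. -/
def chartData (ι N : S → E n) (x : S) (y : EuclideanSpace ℝ (Fin n)) :
    E n × E n × (Fin n → Fin n → ℝ) :=
  (ι ((extChartAt (𝓡∂ n) x).symm y), N ((extChartAt (𝓡∂ n) x).symm y),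
    shapeMatrix (chartFrame ι x y) (chartFrame N x y))

theorem continuousOn_chartData (hS : IsHypersurface M ι N) (x : S) :
    ContinuousOn (chartData ι N x) (extChartAt (𝓡∂ n) x).target :=
  (continuousOn_comp_chart hS.immersion.smooth.continuous x).prodMk
    ((continuousOn_comp_chart hS.smooth_normal.continuous x).prodMk
      (continuousOn_pi.2 fun i => continuousOn_pi.2 fun j => continuousOn_shapeMatrix hS x i j))

end Parallel

/-! ### The volume integrand of parallel hypersurfaces. -/

section ParallelDensity

variable {n : ℕ} {U : Set (E n)} {F : E n → ℝ}

/-- The point at distance `t c` in the direction of the normal. -/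
def parallelPoint (c : ℝ) (z : ℝ × (E n × E n × (Fin n → Fin n → ℝ))) : E n :=
  z.2.1 + (z.1 * c) • z.2.2.1

/-- The Jacobian of the parallel map. -/
def parallelDet (c : ℝ) (z : ℝ × (E n × E n × (Fin n → Fin n → ℝ))) : ℝ :=
  (1 + (z.1 * c) • Matrix.of z.2.2.2).det

/-- The volume integrand of the parallel hypersurfaces. -/
def parallelIntegrand (c : ℝ) (F : E n → ℝ) (z : ℝ × (E n × E n × (Fin n → Fin n → ℝ))) : ℝ :=
  inner ℝ (parallelPoint c z) z.2.2.1 * F (parallelPoint c z) * parallelDet c z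

/-- The domain on which the parallel hypersurfaces are immersed in `U`. -/
def parallelDomain (c : ℝ) (U : Set (E n)) : Set (ℝ × (E n × E n × (Fin n → Fin n → ℝ))) :=
  {z | parallelPoint c z ∈ U ∧ 0 < parallelDet c z}

theorem contDiff_parallelPoint (c : ℝ) : ContDiff ℝ ∞ (parallelPoint (n := n) c) := by
  unfold parallelPoint; fun_prop

theorem contDiff_parallelDet (c : ℝ) : ContDiff ℝ ∞ (parallelDet (n := n) c) := by
  rw [← contDiffOn_univ]
  refine contDiffOn_det fun i j => ContDiff.contDiffOn ?_
  simp only [Matrix.add_apply, Matrix.smul_apply, Matrix.of_apply, smul_eq_mul]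
  fun_prop

theorem isOpen_parallelDomain (c : ℝ) (hU : IsOpen U) : IsOpen (parallelDomain c U) :=
  (hU.preimage (contDiff_parallelPoint c).continuous).inter
    (isOpen_lt continuous_const (contDiff_parallelDet c).continuous)

theorem contDiffOn_parallelIntegrand (c : ℝ) (hF : ContDiffOn ℝ ∞ F U) :
    ContDiffOn ℝ ∞ (parallelIntegrand c F) (parallelDomain c U) :=
  (((contDiff_parallelPoint c).inner ℝ (by fun_prop)).contDiffOn.mul
    (hF.comp (contDiff_parallelPoint c).contDiffOn fun _ hz => hz.1)).mul
      (contDiff_parallelDet c).contDiffOn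

theorem zero_mem_parallelDomain (c : ℝ) {a : E n × E n × (Fin n → Fin n → ℝ)} (ha : a.1 ∈ U) :
    (0, a) ∈ parallelDomain c U := by
  simpa [parallelDomain, parallelPoint, parallelDet] using ha

/-- Product rule: the support function grows at rate c, the density at c times its normal
derivative, the Jacobian at c times the trace of the shape operator. -/
theorem hasDerivAt_parallelIntegrand (c : ℝ) {X N : E n} {A : Fin n → Fin n → ℝ} (hN : ‖N‖ = 1)
    (hF : DifferentiableAt ℝ F X) :
    HasDerivAt (fun t => parallelIntegrand c F (t, X, N, A))
      (c * (F X + inner ℝ X N * (fderiv ℝ F X N + F X * (Matrix.of A).trace))) 0 := by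
  have h1 : HasDerivAt (fun t : ℝ => X + (t * c) • N) (c • N) 0 := by
    simpa using (((hasDerivAt_id (0 : ℝ)).mul_const c).smul_const N).const_add X
  have h2 : HasDerivAt (fun t : ℝ => inner ℝ (X + (t * c) • N) N) c 0 := by
    have := h1.inner ℝ (hasDerivAt_const (0 : ℝ) N)
    simpa [inner_smul_left, real_inner_self_eq_norm_sq, hN] using this
  have h3 : HasDerivAt (fun t : ℝ => F (X + (t * c) • N)) (c * fderiv ℝ F X N) 0 := by
    have h0 : HasFDerivAt F (fderiv ℝ F X) (X + ((0 : ℝ) * c) • N) := by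
      simpa using hF.hasFDerivAt
    have := h0.comp_hasDerivAt (0 : ℝ) h1
    rwa [map_smul, smul_eq_mul] at this
  have h4 : HasDerivAt (fun t : ℝ => (1 + (t * c) • Matrix.of A).det)
      (c * (Matrix.of A).trace) 0 := by
    have := hasDerivAt_det_one_add_smul (c • Matrix.of A)
    simpa only [smul_smul, Matrix.trace_smul, smul_eq_mul] using this
  refine ((h2.mul h3).mul h4).congr_deriv ?_
  simp only [Pi.mul_apply, zero_mul, zero_smul, add_zero, Matrix.det_one]
  ring

end ParallelDensity

/-! ### Volume of the parallel family and its first derivative. -/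

section ParallelVolume

variable {n : ℕ} [NeZero n] {S : Type*} [TopologicalSpace S]
  [ChartedSpace (EuclideanHalfSpace n) S] [IsManifold (𝓡∂ n) ∞ S] [T2Space S] [CompactSpace S]
  {ι N : S → E n} {M U : Set (E n)} {k : ℝ} {f F : E n → ℝ}

/-- The tube lemma around time 0 over a compact set of chart data; finitely many charts allow a
common ε. -/
theorem eventually_mem_parallelDomain (hS : IsHypersurface M ι N) (hU : IsOpen U)
    (hMU : M \ {0} ⊆ U) (c : ℝ) :
    ∃ ε > 0, ∀ t ∈ Ioo (-ε) ε, ∀ x ∈ chartIndices n S, ∀ y ∈ chartSupport n x,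
      (t, chartData ι N x y) ∈ parallelDomain c U := by
  have h : ∀ x ∈ chartIndices n S, ∀ᶠ t in 𝓝 (0 : ℝ), ∀ y ∈ chartSupport n x,
      (t, chartData ι N x y) ∈ parallelDomain c U := fun x _ => by
    have hK : IsCompact (chartData ι N x '' chartSupport n x) :=
      (isCompact_chartSupport x).image_of_continuousOn
        ((continuousOn_chartData hS x).mono (chartSupport_subset x))
    obtain ⟨u, v, hu, -, h0, hv, huv⟩ := generalized_tube_lemma (isCompact_singleton (x := (0 : ℝ)))
      hK (isOpen_parallelDomain c hU) (by
        rintro ⟨t, _⟩ ⟨rfl, y, hy, rfl⟩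
        exact zero_mem_parallelDomain c (hMU (hS.mapsTo _)))
    filter_upwards [hu.mem_nhds (h0 rfl)] with t ht y hy
    exact huv ⟨ht, hv ⟨y, hy, rfl⟩⟩
  obtain ⟨ε, hε, H⟩ := Metric.eventually_nhds_iff.1 ((Filter.eventually_all_finset _).2 h)
  exact ⟨ε, hε, fun t ht => H (by simpa [abs_lt] using ht)⟩

theorem parallelMap_mem {c t : ℝ} (h : ∀ x ∈ chartIndices n S, ∀ y ∈ chartSupport n x,
    (t, chartData ι N x y) ∈ parallelDomain c U) (p : S) : parallelMap c ι N t p ∈ U := by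
  obtain ⟨x, hx, y, hy, rfl, -⟩ := exists_mem_chartSupport (n := n) p
  exact (h x hx y hy).1

theorem isSmoothImmersion_parallelMap (hS : IsHypersurface M ι N) {c t : ℝ}
    (h : ∀ x ∈ chartIndices n S, ∀ y ∈ chartSupport n x,
      (t, chartData ι N x y) ∈ parallelDomain c U) :
    IsSmoothImmersion (parallelMap c ι N t) := by
  have hφ := contMDiff_parallelMap hS.immersion.smooth hS.smooth_normal c t
  refine ⟨hφ, fun p => ?_⟩
  obtain ⟨x, hx, y, hy, rfl, -⟩ := exists_mem_chartSupport (n := n) p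
  have hy' := chartSupport_subset x hy
  rw [← injective_chartDeriv_iff hφ hy', ← linearIndependent_chartFrame_iff]
  have hpos : 0 < areaDensity (parallelMap c ι N t) x y := by
    rw [areaDensity_parallelMap hS c t hy']
    exact mul_pos (abs_pos.2 (h x hx y hy).2.ne') (areaDensity_pos hS.immersion hy')
  exact Matrix.linearIndependent_of_det_gram_ne_zero (Real.sqrt_pos.1 hpos).ne'

/-- On the parallel domain the Jacobian is positive, so its absolute value can be dropped and the
integrand is smooth in t. -/
theorem weightedVolume_parallelMap (hS : IsHypersurface M ι N) {c t : ℝ}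
    (h : ∀ x ∈ chartIndices n S, ∀ y ∈ chartSupport n x,
      (t, chartData ι N x y) ∈ parallelDomain c U) :
    weightedVolume k F (parallelMap c ι N t) N = -1 / (n + k + 1) *
      ∑ x ∈ chartIndices n S, ∫ y in chartSupport n x,
        chartWeight x y * areaDensity ι x y *
          parallelIntegrand c F (t, chartData ι N x y) := by
  rw [weightedVolume, areaIntegral_eq]
  congr 1
  refine Finset.sum_congr rfl fun x hx =>
    setIntegral_congr_fun (isCompact_chartSupport x).measurableSet fun y hy => ?_
  have hd := (h x hx y hy).2
  simp only [areaDensity_parallelMap hS c t (chartSupport_subset x hy)]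
  rw [show (1 + (t * c) • shapeMatrix (chartFrame ι x y) (chartFrame N x y)).det =
    parallelDet c (t, chartData ι N x y) from rfl, abs_of_pos hd, parallelIntegrand]
  simp only [chartData, parallelPoint, parallelMap]
  ring

theorem contDiffOn_weightedVolume_parallelMap (hS : IsHypersurface M ι N) (hU : IsOpen U)
    (hF : ContDiffOn ℝ ∞ F U) {c ε : ℝ}
    (h : ∀ t ∈ Ioo (-ε) ε, ∀ x ∈ chartIndices n S, ∀ y ∈ chartSupport n x,
      (t, chartData ι N x y) ∈ parallelDomain c U) :
    ContDiffOn ℝ ∞ (fun t => weightedVolume k F (parallelMap c ι N t) N) (Ioo (-ε) ε) := by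
  refine ContDiffOn.congr ?_ fun t ht => weightedVolume_parallelMap hS (h t ht)
  refine contDiffOn_const.mul (ContDiffOn.sum fun x hx => ?_)
  exact contDiffOn_integral_comp (isCompact_chartSupport x)
    (continuousOn_weight_mul_areaDensity hS.immersion x)
    ((continuousOn_chartData hS x).mono (chartSupport_subset x)) (isOpen_parallelDomain c hU)
    (contDiffOn_parallelIntegrand c hF) fun t ht y hy => h t ht x hx y hy

/-- The derivative is -(n+k)/(n+k+1) times ∫(1 - H_f⟨X,N⟩)f. Stationarity replaces H_f by the
multiplier H, and H∫⟨X,N⟩f = -(n+k)A by definition, so the integral is (1+n+k)A and the denominator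
cancels. -/
theorem IsStationary.hasDerivAt_weightedVolume_parallelMap [Nonempty S] (hM : IsSolidCone M)
    (hf : IsHomogeneousDensity M k f) (hS : IsHypersurface M ι N)
    (hstat : IsStationary M k f ι N) (hk : (n : ℝ) + k + 1 ≠ 0) (hk' : (n : ℝ) + k ≠ 0)
    (hF : IsHomogeneousExtension M k f U F) {ε : ℝ} (hε : 0 < ε)
    (h : ∀ t ∈ Ioo (-ε) ε, ∀ x ∈ chartIndices n S, ∀ y ∈ chartSupport n x,
      (t, chartData ι N x y) ∈ parallelDomain (n + k) U) :
    HasDerivAt (fun t => weightedVolume k F (parallelMap (n + k) ι N t) N)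
      (-((n + k) * weightedArea f ι)) 0 := by
  have h0 : (0 : ℝ) ∈ Ioo (-ε) ε := ⟨by linarith, hε⟩
  have hι := hS.immersion
  have hf' := hf.continuous_comp hι.smooth.continuous hS.mapsTo
  have hu : Continuous fun p => inner ℝ (ι p) (N p) * f (ι p) :=
    (hι.smooth.continuous.inner hS.smooth_normal.continuous).mul hf'
  have hd : ∀ x ∈ chartIndices n S, HasDerivAt (fun t => ∫ y in chartSupport n x,
      chartWeight x y * areaDensity ι x y *
        parallelIntegrand (n + k) F (t, chartData ι N x y)) _ 0 := fun x hx =>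
    hasDerivAt_integral_comp (isCompact_chartSupport x)
      (continuousOn_weight_mul_areaDensity hι x)
      ((continuousOn_chartData hS x).mono (chartSupport_subset x))
      (isOpen_parallelDomain (n + k) hF.isOpen)
      ((contDiffOn_parallelIntegrand (n + k) hF.smooth).of_le (by exact_mod_cast le_top))
      (fun t ht y hy => h t ht x hx y hy) h0
  have hd' := (HasDerivAt.fun_sum hd).const_mul (-1 / ((n : ℝ) + k + 1))
  refine (hd'.congr_of_eventuallyEq ?_).congr_deriv ?_
  · filter_upwards [Ioo_mem_nhds h0.1 h0.2] with t ht
    exact weightedVolume_parallelMap hS (h t ht)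
  have hval : ∀ x ∈ chartIndices n S, ∀ y ∈ chartSupport n x,
      fderiv ℝ (parallelIntegrand (n + k) F) (0, chartData ι N x y) (1, 0) =
        (n + k) * (f (ι ((extChartAt (𝓡∂ n) x).symm y)) + -multiplier k f ι N *
          (inner ℝ (ι ((extChartAt (𝓡∂ n) x).symm y)) (N ((extChartAt (𝓡∂ n) x).symm y)) *
            f (ι ((extChartAt (𝓡∂ n) x).symm y)))) := by
    intro x hx y hy
    have hpU : ι ((extChartAt (𝓡∂ n) x).symm y) ∈ U := hF.subset (hS.mapsTo _)
    have h1 : HasFDerivAt (parallelIntegrand (n + k) F) (fderiv ℝ (parallelIntegrand (n + k) F)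
        (0, chartData ι N x y)) (0, chartData ι N x y) :=
      (((contDiffOn_parallelIntegrand (n + k) hF.smooth).differentiableOn
        (by simp)).differentiableAt ((isOpen_parallelDomain (n + k) hF.isOpen).mem_nhds
          (h 0 h0 x hx y hy))).hasFDerivAt
    have h2 := h1.comp_hasDerivAt (0 : ℝ)
      ((hasDerivAt_id (0 : ℝ)).prodMk (hasDerivAt_const (0 : ℝ) (chartData ι N x y)))
    have h3 := hasDerivAt_parallelIntegrand (n + k)
      (A := shapeMatrix (chartFrame ι x y) (chartFrame N x y))
      (hS.unit_normal ((extChartAt (𝓡∂ n) x).symm y)).1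
      ((hF.smooth.differentiableOn (by simp)).differentiableAt (hF.isOpen.mem_nhds hpU))
    rw [h2.unique h3]
    have hkey := hstat.inner_mul_eq_zero hM hf hS hk hk' hF x (chartSupport_subset x hy)
    rw [chartMeanCurvature] at hkey
    have hF0 := (hF.pos _ hpU).ne'
    rw [← hF.apply_eq hS]
    set X := ι ((extChartAt (𝓡∂ n) x).symm y)
    set ν := N ((extChartAt (𝓡∂ n) x).symm y)
    have hdiv : fderiv ℝ F X ν = fderiv ℝ F X ν / F X * F X := by field_simp
    rw [hdiv]
    change (n + k) * (F X + inner ℝ X ν * (fderiv ℝ F X ν / F X * F X +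
      F X * (shapeMatrix (chartFrame ι x y) (chartFrame N x y)).trace)) = _
    linear_combination (n + k) * F X * hkey
  have hsum : ∑ x ∈ chartIndices n S, ∫ y in chartSupport n x,
      chartWeight x y * areaDensity ι x y *
        fderiv ℝ (parallelIntegrand (n + k) F) (0, chartData ι N x y) (1, 0) =
      areaIntegral ι (fun p => (n + k) * (f (ι p) + -multiplier k f ι N *
        (inner ℝ (ι p) (N p) * f (ι p)))) := by
    rw [areaIntegral_eq]
    refine Finset.sum_congr rfl fun x hx =>
      setIntegral_congr_fun (isCompact_chartSupport x).measurableSet fun y hy => ?_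
    simp only [hval x hx y hy]
  have hcu : Continuous fun p => -multiplier k f ι N * (inner ℝ (ι p) (N p) * f (ι p)) :=
    continuous_const.mul hu
  rw [hsum, areaIntegral_const_mul, areaIntegral_add hι hf' hcu,
    areaIntegral_const_mul, multiplier]
  have hI := hstat.areaIntegral_inner_ne_zero hM hf hS hk hk'
  rw [weightedArea]
  field_simp
  ring

theorem chartDeriv_const_smul {φ : S → E n} (hφ : ContMDiff (𝓡∂ n) 𝓘(ℝ, E n) ∞ φ) (r : ℝ) {x : S}
    {y : EuclideanSpace ℝ (Fin n)} (hy : y ∈ (extChartAt (𝓡∂ n) x).target) :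
    chartDeriv (fun p => r • φ p) x y = r • chartDeriv φ x y :=
  ((hasFDerivWithinAt_chart hφ hy).const_smul r).fderivWithin (uniqueDiffWithinAt_range hy)

/-- With a nonzero exponent this determines the dilation factor restoring a prescribed volume. -/
theorem IsHomogeneousExtension.weightedVolume_smul (hF : IsHomogeneousExtension M k f U F)
    {φ : S → E n} (hφ : ContMDiff (𝓡∂ n) 𝓘(ℝ, E n) ∞ φ) (hU : ∀ p, φ p ∈ U) (ν : S → E n) {r : ℝ}
    (hr : 0 < r) : weightedVolume k F (fun p => r • φ p) ν =
      r ^ ((n : ℝ) + k + 1) * weightedVolume k F φ ν := by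
  rw [weightedVolume, weightedVolume, mul_left_comm,
    ← areaIntegral_const_mul (r ^ ((n : ℝ) + k + 1))]
  congr 1
  refine areaIntegral_congr fun x y hy => ?_
  have h1 : areaDensity (fun p => r • φ p) x y = r ^ n * areaDensity φ x y := by
    rw [areaDensity_eq, areaDensity_eq]
    conv_rhs => rw [← abs_of_pos hr]
    rw [← sqrt_det_gram_smul]
    congr 3
    ext1 i
    rw [chartFrame, chartDeriv_const_smul hφ r hy]
    rfl
  rw [h1, hF.homogeneous _ (hU _) r hr, inner_smul_left, Real.rpow_add hr, Real.rpow_add hr,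
    Real.rpow_natCast, Real.rpow_one, conj_trivial]
  ring

/-- Also at boundary points of M the derivative within M is unique, so it is computed by any smooth
extension of the density. -/
theorem meanCurvature_eq (hM : IsSolidCone M) (hS : IsHypersurface M ι N)
    (hF : IsHomogeneousExtension M k f U F) (p : S) :
    meanCurvature M f ι N p = -chartMeanCurvature F ι N p (extChartAt (𝓡∂ n) p p) := by
  have hp := hS.mapsTo p
  have hpU := hF.subset hp
  have h1 : surfaceDiv ι N p =
      (shapeMatrix (chartFrame ι p (extChartAt (𝓡∂ n) p p))
        (chartFrame N p (extChartAt (𝓡∂ n) p p))).trace := by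
    rw [trace_shapeMatrix, surfaceDiv, diff_eq_chartDeriv ι hS.immersion.smooth,
      diff_eq_chartDeriv N hS.smooth_normal]
    rfl
  have h2 : fderivWithin ℝ (fun x => Real.log (f x)) M (ι p) (N p) =
      fderiv ℝ F (ι p) (N p) / F (ι p) := by
    have hd : HasFDerivAt F (fderiv ℝ F (ι p)) (ι p) :=
      ((hF.smooth.differentiableOn (by simp)).differentiableAt
        (hF.isOpen.mem_nhds hpU)).hasFDerivAt
    have hl := (hd.log (hF.pos _ hpU).ne').hasFDerivWithinAt (s := M)
    have hl' : HasFDerivWithinAt (fun x => Real.log (f x)) ((F (ι p))⁻¹ • fderiv ℝ F (ι p)) M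
        (ι p) := by
      refine hl.congr_of_eventuallyEq ?_ (by rw [hF.eqOn hp])
      have hne : ∀ᶠ q in 𝓝[M] (ι p), q ≠ 0 :=
        mem_nhdsWithin_of_mem_nhds (isOpen_ne.mem_nhds hp.2)
      filter_upwards [hne, self_mem_nhdsWithin] with q hq hqM
      rw [hF.eqOn ⟨hqM, hq⟩]
    rw [hl'.fderivWithin (hM.uniqueDiffWithinAt hp)]
    simp [div_eq_inv_mul]
  rw [meanCurvature, h1, h2, chartMeanCurvature, symm_extChartAt_self]

end ParallelVolume

end ConeHypersurface

end

/-! ### The rescaled parallel family. -/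

open ConeHypersurface
theorem mainTheorem12 {n : ℕ} [NeZero n]
    {S : Type*} [TopologicalSpace S] [ChartedSpace (EuclideanHalfSpace n) S]
    [IsManifold (𝓡∂ n) ∞ S] [T2Space S] [CompactSpace S] [Nonempty S]
    (M : Set (E n)) (hM : IsSolidCone M)
    (k : ℝ) (hk₁ : k ≠ -(n + 1)) (hk₂ : k ≠ -n)
    (f : E n → ℝ) (hf : IsHomogeneousDensity M k f)
    (ι N : S → E n) (hS : IsHypersurface M ι N) (hstat : IsStationary M k f ι N) :
    (∃ (U : Set (E n)) (F : E n → ℝ), IsHomogeneousExtension M k f U F) ∧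
    ∀ (U : Set (E n)) (F : E n → ℝ), IsHomogeneousExtension M k f U F →
      ∃ (ε : ℝ) (s : ℝ → ℝ), 0 < ε ∧ s 0 = 1 ∧ ContDiffOn ℝ ∞ s (Ioo (-ε) ε) ∧
        (∀ t ∈ Ioo (-ε) ε,
          (∀ p, parallelMap (n + k) ι N t p ∈ U) ∧
          IsSmoothImmersion (parallelMap (n + k) ι N t) ∧
          IsUnitNormal (parallelMap (n + k) ι N t) N ∧
          ∀ r : ℝ, 0 < r →
            (weightedVolume k F (fun p => r • parallelMap (n + k) ι N t p) N
                = weightedVolume k f ι N ↔ r = s t)) ∧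
        (∀ t ∈ Ioo (-ε) ε, 0 < s t) ∧
        ∀ p : S, ∃ W : E n,
          HasDerivAt (fun t => s t • parallelMap (n + k) ι N t p) W 0 ∧
          inner ℝ W (N p) = n + k + meanCurvature M f ι N p * inner ℝ (ι p) (N p) := by
  refine ⟨hf.exists_extension hM, fun U F hF => ?_⟩
  have hk : (n : ℝ) + k + 1 ≠ 0 := fun h => hk₁ (by linarith)
  have hk' : (n : ℝ) + k ≠ 0 := fun h => hk₂ (by linarith)
  have hI := hstat.areaIntegral_inner_ne_zero hM hf hS hk hk'
  obtain ⟨δ, hδ, hmem⟩ := eventually_mem_parallelDomain hS hF.isOpen hF.subset ((n : ℝ) + k)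
  set V : ℝ → ℝ := fun t => weightedVolume k F (parallelMap (n + k) ι N t) N with hV
  set V₀ := weightedVolume k f ι N with hV₀
  have hV₀' : V₀ ≠ 0 := mul_ne_zero (div_ne_zero (by norm_num) hk) hI
  have hV0 : V 0 = V₀ := by
    have h1 : parallelMap ((n : ℝ) + k) ι N 0 = ι := by ext1 p; simp [parallelMap]
    simp only [hV, hV₀, h1, weightedVolume, hF.apply_eq hS]
  have hVs : ContDiffOn ℝ ∞ V (Ioo (-δ) δ) :=
    contDiffOn_weightedVolume_parallelMap hS hF.isOpen hF.smooth hmem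
  have hVd := hstat.hasDerivAt_weightedVolume_parallelMap hM hf hS hk hk' hF hδ hmem
  -- The volumes may be negative; only their ratio, which equals 1 at t = 0, has to be positive.
  have hpos : ∀ᶠ t in 𝓝 (0 : ℝ), 0 < V₀ / V t := by
    refine ((tendsto_const_nhds (x := V₀)).div hVd.continuousAt.tendsto ?_).eventually
      (lt_mem_nhds ?_)
    · change V 0 ≠ 0
      rwa [hV0]
    · change 0 < V₀ / V 0
      rw [hV0, div_self hV₀']
      exact one_pos
  obtain ⟨η, hη, hpos'⟩ := Metric.eventually_nhds_iff.1 hpos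
  have hsub : Ioo (-min δ η) (min δ η) ⊆ Ioo (-δ) δ :=
    Ioo_subset_Ioo (neg_le_neg (min_le_left _ _)) (min_le_left _ _)
  have hposI : ∀ t ∈ Ioo (-min δ η) (min δ η), 0 < V₀ / V t := fun t ht =>
    hpos' (by
      rw [Real.dist_eq, sub_zero]
      exact (abs_lt.2 ht).trans_le (min_le_right _ _))
  have hne : ∀ t ∈ Ioo (-min δ η) (min δ η), V t ≠ 0 := fun t ht h => by
    have := hposI t ht
    simp [h] at this
  -- The factor solving r^(n+k+1) V(t) = V₀.
  refine ⟨min δ η, fun t => (V₀ / V t) ^ ((n : ℝ) + k + 1)⁻¹, lt_min hδ hη, ?_, ?_, ?_, ?_, ?_⟩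
  · simp only [hV0, div_self hV₀', Real.one_rpow]
  · exact (contDiffOn_const.div (hVs.mono hsub) hne).rpow_const_of_ne fun t ht => (hposI t ht).ne'
  · intro t ht
    have hU := parallelMap_mem (hmem t (hsub ht))
    have himm := isSmoothImmersion_parallelMap hS (hmem t (hsub ht))
    refine ⟨hU, himm, isUnitNormal_parallelMap hS _ t, fun r hr => ?_⟩
    rw [hF.weightedVolume_smul himm.smooth hU N hr, Real.eq_rpow_inv hr.le (hposI t ht).le hk,
      eq_div_iff (hne t ht)]
  · exact fun t ht => Real.rpow_pos_of_pos (hposI t ht) _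
  · intro p
    -- Logarithmic differentiation gives -V'(0)/((n+k+1)V₀) with V'(0) = -(n+k)A; since (n+k+1)V₀ =
    -- -∫⟨X,N⟩f, this is the multiplier.
    have hsd : HasDerivAt (fun t => (V₀ / V t) ^ ((n : ℝ) + k + 1)⁻¹) (multiplier k f ι N) 0 := by
      have h1 := ((hasDerivAt_const (0 : ℝ) V₀).div hVd (by change V 0 ≠ 0; rwa [hV0])).rpow_const
        (p := ((n : ℝ) + k + 1)⁻¹) (Or.inl (by
          change V₀ / V 0 ≠ 0
          rw [hV0, div_self hV₀']
          exact one_ne_zero))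
      refine h1.congr_deriv ?_
      change _ * (V₀ / V 0) ^ _ = _
      change (0 * V 0 - V₀ * -((n + k) * weightedArea f ι)) / V 0 ^ 2 * _ * _ = _
      rw [hV0, div_self hV₀', Real.one_rpow, hV₀, weightedVolume, multiplier]
      field_simp
      ring
    have hpd : HasDerivAt (fun t => parallelMap ((n : ℝ) + k) ι N t p) (((n : ℝ) + k) • N p) 0 := by
      have := (((hasDerivAt_id (0 : ℝ)).mul_const ((n : ℝ) + k)).smul_const (N p)).const_add (ι p)
      simpa [parallelMap] using this
    refine ⟨_, hsd.smul hpd, ?_⟩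
    -- The multiplier enters the normal velocity only through its product with ⟨X,N⟩, so the product
    -- form of stationarity suffices, including where ⟨X,N⟩ = 0.
    have h := hstat.inner_mul_eq_zero hM hf hS hk hk' hF p (mem_extChartAt_target (I := 𝓡∂ n) p)
    rw [symm_extChartAt_self] at h
    rw [meanCurvature_eq hM hS hF, hV0, div_self hV₀', Real.one_rpow, one_smul, inner_add_left,
      inner_smul_left, inner_smul_left, real_inner_self_eq_norm_sq, (hS.unit_normal p).1]
    simp only [conj_trivial, parallelMap, zero_mul, zero_smul, add_zero]
    linear_combination h
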